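/- Let $\Delta>0$, $\gamma\in\mathbb R$, $\zeta>0$, and let $\nu$ be a Lévy measure on $\mathbb R$ (so $\nu(\{0\})=0$) with $\int\min(|x|,1)\,\nu(dx)<\infty$. Let $\psi(u)=i\gamma u+\int(e^{iux}-1)\,\nu(dx)$, $\varphi(u)=e^{\Delta\psi(u)}$, and let $P$ be the probability measure on $\mathbb R$ with characteristic function $\varphi$, that is, the law of the increments over time $\Delta$ of the Lévy process of locally finite variation with drift $\gamma$ and Lévy measure $\nu$. Write $\varphi^{-1}=1/\varphi$, and let $\mathcal F f(u)=\int e^{iux}f(x)\,dx$ and $\mathcal F^{-1}f(x)=\frac1{2\pi}\int e^{-iux}f(u)\,du$ denote the Fourier(-Plancherel) transform and its inverse. Assume that for some $\varepsilon>0$: (a) $\int\max(|x|,|x|^{2+\varepsilon})\,\nu(dx)<\infty$; (b) the measure $x\,\nu(dx)$ has a bounded Lebesgue density, and $|\mathcal F[x\nu](u)|\le C(1+|u|)^{-1}$ for all $u\in\mathbb R$ and some constant $C$; (c) $u\mapsto(1+|u|)^{-1+\varepsilon}\varphi^{-1}(u)$ belongs to $L^2(\mathbb R)$. For $t\neq0$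 let $g_t(x)=x^{-1}\mathbf 1_{(-\infty,t]}(x)$ if $t<0$ and $g_t(x)=x^{-1}\mathbf 1_{[t,\infty)}(x)$ if $t>0$, and let $$h_t(x)=\mathcal F^{-1}\big[\varphi^{-1}(-u)\,\mathcal Fg_t(u)\big](x)\,ix+\mathcal F^{-1}\big[(\varphi^{-1})'(-u)\,\mathcal Fg_t(u)\big](x),$$ where the right-hand side, which is determined up to Lebesgue null sets, is evaluated at $x$ as the limit of its averages over $[x-r,x+r]$ as $r\downarrow0$. Then for every $t$ with $|t|\ge\zeta$ the function $h_t$ is well defined as an element of $L^2(P)$ (both inverse transforms are of $L^2(\mathbb R)$ functions, and the limit exists for $P$-almost every $x$), and there is a centered Gaussian process $\mathbb G^\varphi=\{\mathbb G^\varphi(t)\}_{|t|\ge\zeta}$ with covariance $$\mathbb E\,\mathbb G^\varphi(t)\,\mathbb G^\varphi(s)=\Sigma_{t,s}=(i\Delta)^{-2}\int_{\mathbb R}h_t(x)h_s(x)\,P(dx).$$ Every such process, on any probability space, admits a version (a process on the same probability space that equals $\mathbb G^\varphi(t)$ almost surely, for each $t$), still denoted by $\mathbb G^\varphi$, whose sample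 paths are almost surely uniformly continuous on $\{t:|t|\ge\zeta\}$ for the intrinsic covariance metric $d(s,t)=\big(\mathbb E(\mathbb G^\varphi(s)-\mathbb G^\varphi(t))^2\big)^{1/2}$, and which satisfies $\sup_{|t|\ge\zeta}|\mathbb G^\varphi(t)|<\infty$ almost surely. -/

import Mathlib

open MeasureTheory ProbabilityTheory Filter Topology
open scoped FourierTransform

noncomputable section

namespace LevyDonsker

/-! ### Fourier transforms

Conventions: `(F f)(u) = ∫ exp(i u x) f(x) dx` and `(F⁻¹ f)(x) = (2π)⁻¹ ∫ exp(-i u x) f(u) du`.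
Mathlib's transform on `L²(ℝ)` is `(𝓕 f)(w) = ∫ exp(-2π i w v) f(v) dv`. -/

/-- The Fourier-Plancherel transform `F f` of `f ∈ L²(ℝ)`, with
`(F f)(u) = ∫ exp(i u x) f(x) dx = (𝓕⁻ f)(u / 2π)`; a function determined up to Lebesgue null
sets. -/
def fourierL2 (f : ℝ → ℂ) : ℝ → ℂ :=
  open Classical in
  if hf : MemLp f 2 (volume : Measure ℝ) then
    fun u => (𝓕⁻ (hf.toLp f) : Lp ℂ 2 (volume : Measure ℝ)) (u / (2 * Real.pi))
  else 0

/-- The inverse Fourier-Plancherel transform `F⁻¹ f` of `f ∈ L²(ℝ)`, with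
`(F⁻¹ f)(x) = (2π)⁻¹ ∫ exp(-i u x) f(u) du = ∫ exp(-2π i v x) f(2π v) dv`; a function determined
up to Lebesgue null sets. -/
def fourierInvL2 (f : ℝ → ℂ) : ℝ → ℂ :=
  open Classical in
  if hf : MemLp (fun v => f (2 * Real.pi * v)) 2 (volume : Measure ℝ) then
    fun x => (𝓕 (hf.toLp (fun v => f (2 * Real.pi * v))) : Lp ℂ 2 (volume : Measure ℝ)) x
  else 0

/-- The average of a locally integrable function over `[x - r, x + r]`. -/
def ballAverage (f : ℝ → ℂ) (x r : ℝ) : ℂ :=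
  ⨍ y in Metric.closedBall x r, f y

/-- The precise representative of a locally integrable function: the limit of its averages over
`[x - r, x + r]` as `r ↓ 0`. It agrees with `f` Lebesgue almost everywhere, depends only on
the Lebesgue class of `f`, and is the continuous value at every point near which the class has a
continuous representative. -/
def preciseRep (f : ℝ → ℂ) (x : ℝ) : ℂ :=
  limUnder (𝓝[>] (0 : ℝ)) (ballAverage f x)

/-! ### The Lévy model -/

/-- `ψ(u) = i γ u + ∫ (exp(i u x) - 1) ν(dx)`. -/
def levyExponent (γ : ℝ) (ν : Measure ℝ) (u : ℝ) : ℂ :=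
  Complex.I * γ * u + ∫ x, (Complex.exp (Complex.I * u * x) - 1) ∂ν

/-- `φ(u) = exp(Δ ψ(u))`. -/
def levyCharFun (Δ γ : ℝ) (ν : Measure ℝ) (u : ℝ) : ℂ :=
  Complex.exp (Δ * levyExponent γ ν u)

/-- `ν` is the Lévy measure of a Lévy process of locally finite variation. -/
structure IsFiniteVariationLevyMeasure (ν : Measure ℝ) : Prop where
  zero : ν {0} = 0
  integrable_min : Integrable (fun x : ℝ => min |x| 1) ν

/-- `P` is the law of the increments `L_{kΔ} - L_{(k-1)Δ}` of a Lévy process of locally finite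
variation with drift `γ` and Lévy measure `ν`. -/
structure IsIncrementLaw (Δ γ : ℝ) (ν : Measure ℝ) (P : Measure ℝ) : Prop where
  isProbabilityMeasure : IsProbabilityMeasure P
  charFun_eq : ∀ u : ℝ, charFun P u = levyCharFun Δ γ ν u

/-- The standing conditions on the Lévy process, for a given `ε`. -/
structure RegularityCondition (Δ γ : ℝ) (ν : Measure ℝ) (ε : ℝ) : Prop where
  moment : Integrable (fun x : ℝ => max |x| (|x| ^ (2 + ε))) ν
  /-- the finite signed measure `x ν(dx)` has a bounded Lebesgue density -/
  bounded_density : ∃ k : ℝ → ℝ, Measurable k ∧ Integrable k volume ∧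
    (∃ C : ℝ, ∀ x, |k x| ≤ C) ∧
    ν.withDensityᵥ (fun x : ℝ => x) = (volume : Measure ℝ).withDensityᵥ k
  fourier_decay : ∃ C : ℝ, ∀ u : ℝ,
    ‖∫ x : ℝ, Complex.exp (Complex.I * u * x) * (x : ℂ) ∂ν‖ ≤ C * (1 + |u|)⁻¹
  inv_charFun : MemLp (fun u : ℝ =>
    (((1 + |u|) ^ (-1 + ε) : ℝ) : ℂ) * (levyCharFun Δ γ ν u)⁻¹) 2 volume

/-! ### The covariance -/

/-- `g_t(x) = x⁻¹ 1_{(-∞,t]}(x)` for `t < 0` and `g_t(x) = x⁻¹ 1_{[t,∞)}(x)` for `t > 0`. -/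
def gFun (t : ℝ) : ℝ → ℂ :=
  if t < 0 then (Set.Iic t).indicator (fun x => ((x⁻¹ : ℝ) : ℂ))
  else (Set.Ici t).indicator (fun x => ((x⁻¹ : ℝ) : ℂ))

/-- `u ↦ φ⁻¹(-u) F g_t(u)`. -/
def mult₁ (Δ γ : ℝ) (ν : Measure ℝ) (t : ℝ) (u : ℝ) : ℂ :=
  (levyCharFun Δ γ ν (-u))⁻¹ * fourierL2 (gFun t) u

/-- `u ↦ (φ⁻¹)'(-u) F g_t(u)`. -/
def mult₂ (Δ γ : ℝ) (ν : Measure ℝ) (t : ℝ) (u : ℝ) : ℂ :=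
  deriv (fun v : ℝ => (levyCharFun Δ γ ν v)⁻¹) (-u) * fourierL2 (gFun t) u

/-- The Lebesgue class of `h_t`:
`F⁻¹[φ⁻¹(-u) F g_t(u)](x) i x + F⁻¹[(φ⁻¹)'(-u) F g_t(u)](x)`. -/
def hClass (Δ γ : ℝ) (ν : Measure ℝ) (t : ℝ) (x : ℝ) : ℂ :=
  fourierInvL2 (mult₁ Δ γ ν t) x * (Complex.I * x) + fourierInvL2 (mult₂ Δ γ ν t) x

/-- The function `h_t`. The law `P` may charge a single point, so `h_t` is needed there also:
we take the precise representative. -/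
def hFun (Δ γ : ℝ) (ν : Measure ℝ) (t : ℝ) : ℝ → ℂ :=
  preciseRep (hClass Δ γ ν t)

/-- `h_t` is rigorously defined as an element of `L²(P)`: both inverse Fourier transforms are
applied to functions in `L²(ℝ)`, the precise representative exists `P`-almost everywhere, and it
is square integrable with respect to `P`. -/
structure HWellDefined (Δ γ : ℝ) (ν P : Measure ℝ) (t : ℝ) : Prop where
  memLp_g : MemLp (gFun t) 2 volume
  memLp_mult₁ : MemLp (mult₁ Δ γ ν t) 2 volume
  memLp_mult₂ : MemLp (mult₂ Δ γ ν t) 2 volume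
  tendsto : ∀ᵐ x ∂P,
    Tendsto (ballAverage (hClass Δ γ ν t) x) (𝓝[>] (0 : ℝ)) (𝓝 (hFun Δ γ ν t x))
  memLp : MemLp (hFun Δ γ ν t) 2 P

/-- `Σ_{t,s} = (i Δ)⁻² ∫ h_t(x) h_s(x) P(dx)`. -/
def covSigma (Δ γ : ℝ) (ν P : Measure ℝ) (t s : ℝ) : ℂ :=
  ((Complex.I * Δ) ^ 2)⁻¹ * ∫ x, hFun Δ γ ν t x * hFun Δ γ ν s x ∂P

/-! ### The Gaussian process -/

/-- The index set `{t : |t| ≥ ζ}`. -/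
abbrev Idx (ζ : ℝ) : Type := {t : ℝ // ζ ≤ |t|}

/-- `G` is a centered Gaussian process indexed by `|t| ≥ ζ` with covariance `Σ`. -/
structure IsLimitProcess (Δ γ : ℝ) (ν P : Measure ℝ) (ζ : ℝ)
    {Ω : Type*} [MeasurableSpace Ω] (μ : Measure Ω) (G : Idx ζ → Ω → ℝ) : Prop where
  isGaussian : IsGaussianProcess G μ
  centered : ∀ t, ∫ ω, G t ω ∂μ = 0
  covariance : ∀ t s, ((∫ ω, G t ω * G s ω ∂μ : ℝ) : ℂ) = covSigma Δ γ ν P t s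

/-- The intrinsic covariance metric `d(s,t) = (E (G s - G t)²)^{1/2}` (a pseudometric). -/
def intrinsicDist {T Ω : Type*} [MeasurableSpace Ω] (μ : Measure Ω) (G : T → Ω → ℝ)
    (s t : T) : ℝ :=
  √(∫ ω, (G s ω - G t ω) ^ 2 ∂μ)

/-- Uniform continuity of a function on `T` for a (pseudo)metric `d`. -/
def UniformContinuousFor {T : Type*} (d : T → T → ℝ) (f : T → ℝ) : Prop :=
  ∀ η > 0, ∃ δ > 0, ∀ s t, d s t < δ → |f s - f t| < η

end LevyDonsker

end

noncomputable section

namespace LevyDonsker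
open scoped SchwartzMap ENNReal ContDiff ComplexConjugate

/-! ### The Fourier transform on `L²(ℝ)` -/

/-! Write `b(v) = φ⁻¹(-2πv)` and `a = γΔ`. The core is an explicit formula for `h_t`. Dividing `b`
by `1 - 2πiv` gives the symbol of an `L²` function `w` (`kernel`), and undoing the division amounts
to applying `1 - d/dx` to a test function. By the product rule the two terms of `h_t` combine so
that a factor `x` cancels the `1/x` in `g_t`. What is left is the deconvolution operator acting on
the indicator of a half-line, so with `σ = sign t` `h_t(x) = i (σ w(x - t) + ∫_{σ(x - t - z) ≥ 0}
w(z) dz)` almost everywhere (`hClass_ae_eq`). In particular `-i h_t` is real.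

Regularity of `w`: since `φ' = iΔ(γ + F[xν]) φ` and `F[xν]` decays, `b' - 2πi a b` is smaller than
`b` by a factor `1/(1 + |v|)`. Hence `(x - a) w(x)` has an integrable transform with half a
derivative to spare, and `w` is continuous off `a`, Hölder away from `a`, and decaying. Condition
(c) gives translations of `w` an `L²` modulus of order `ε`.

Regularity of `P`: the same differential equation reads `(x - a) P = P * (Δ x ν)`, so `|x - a| P`
has a bounded density (`exists_withDensity_le`). Thus `P` is dominated by Lebesgue measure outside
every neighbourhood of `a`, and its only possible atom is `a`. The singularity of `h_t` sits at `a +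
t`, at distance `|t| ≥ ζ` from `a`. Near `a` the Hölder bound applies, and elsewhere the `L²(dx)`
bounds do. This yields a modulus `|t - s|^{2ε}` and the decay `|t|^{-1/2}` for squared `L²(P)`
norms.

In the coordinate `1/t`, with the value `0` at `t = ∞`, the index set embeds in a compact interval
on which the increment variance is Hölder (`exists_integral_invKernel_sub_sq_le`). Gaussian moments
and Kolmogorov's criterion give a continuous version, bounded by compactness. A compactness argument
on pairs of times upgrades continuity to uniform continuity for the intrinsic metric
(`ae_uniform_of_continuousOn`). Existence of the process is the isonormal construction on `L²(P)`.
-/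

/-- Locally integrable functions with the same integrals against Schwartz functions agree almost
everywhere. -/
theorem ae_eq_of_forall_schwartz {f g : ℝ → ℂ} (hf : LocallyIntegrable f volume)
    (hg : LocallyIntegrable g volume)
    (h : ∀ η : 𝓢(ℝ, ℂ), HasCompactSupport η → ∫ x, η x * f x = ∫ x, η x * g x) :
    f =ᵐ[volume] g := by
  have : ∀ᵐ x, (f - g) x = 0 := by
    apply ae_eq_zero_of_integral_contDiff_smul_eq_zero (hf.sub hg)
    intro p hp hpc
    have hg₁ : HasCompactSupport (Complex.ofRealCLM ∘ p) := hpc.comp_left rfl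
    have hg₂ : ContDiff ℝ ∞ (Complex.ofRealCLM ∘ p) := by fun_prop
    have h1 := h (hg₁.toSchwartzMap hg₂) hg₁
    have i1 : Integrable (fun x => (p x : ℂ) * f x) := by
      have := hf.integrable_smul_left_of_hasCompactSupport (g := Complex.ofRealCLM ∘ p)
        hg₂.continuous hg₁
      simpa [smul_eq_mul] using this
    have i2 : Integrable (fun x => (p x : ℂ) * g x) := by
      have := hg.integrable_smul_left_of_hasCompactSupport (g := Complex.ofRealCLM ∘ p)
        hg₂.continuous hg₁
      simpa [smul_eq_mul] using this
    have h2 : ∫ x, p x • (f - g) x = (∫ x, (p x : ℂ) * f x) - ∫ x, (p x : ℂ) * g x := by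
      rw [← integral_sub i1 i2]
      congr 1
      ext x
      simp [mul_sub]
    rw [h2, sub_eq_zero]
    simpa using h1
  filter_upwards [this] with x hx
  simpa [sub_eq_zero] using hx

theorem integral_mul_fourier_lp (F : Lp ℂ 2 (volume : Measure ℝ)) (η : 𝓢(ℝ, ℂ)) :
    ∫ x, η x * (𝓕 F : Lp ℂ 2 (volume : Measure ℝ)) x = ∫ x, 𝓕 (η : ℝ → ℂ) x * F x := by
  have h := DFunLike.congr_fun (Lp.fourier_toTemperedDistribution_eq F) η
  rw [TemperedDistribution.fourier_apply, Lp.toTemperedDistribution_apply,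
    Lp.toTemperedDistribution_apply] at h
  simpa [SchwartzMap.fourier_coe] using h.symm

theorem integral_mul_fourierInv_lp (F : Lp ℂ 2 (volume : Measure ℝ)) (η : 𝓢(ℝ, ℂ)) :
    ∫ x, η x * (𝓕⁻ F : Lp ℂ 2 (volume : Measure ℝ)) x = ∫ x, 𝓕⁻ (η : ℝ → ℂ) x * F x := by
  have h := DFunLike.congr_fun (Lp.fourierInv_toTemperedDistribution_eq F) η
  rw [TemperedDistribution.fourierInv_apply, Lp.toTemperedDistribution_apply,
    Lp.toTemperedDistribution_apply] at h
  simpa [SchwartzMap.fourierInv_coe] using h.symm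

theorem integral_fourier_mul_flip {f g : ℝ → ℂ} (hf : Integrable f) (hg : Integrable g) :
    ∫ x, 𝓕 f x * g x = ∫ x, f x * 𝓕 g x := by
  have := VectorFourier.integral_fourierIntegral_smul_eq_flip (μ := volume) (ν := volume)
    (L := innerₗ ℝ) (e := Real.fourierChar) (f := f) (g := g) Real.continuous_fourierChar
    (by exact continuous_inner) hf hg
  simp only [smul_eq_mul, flip_innerₗ] at this
  exact this

theorem integral_fourierInv_mul_flip {f g : ℝ → ℂ} (hf : Integrable f) (hg : Integrable g) :
    ∫ x, 𝓕⁻ f x * g x = ∫ x, f x * 𝓕⁻ g x := by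
  have h := integral_fourier_mul_flip hf hg.comp_neg
  have e1 : ∫ x, 𝓕⁻ f x * g x = ∫ x, 𝓕 f x * g (-x) := by
    rw [← integral_neg_eq_self]
    simp [Real.fourierInv_eq_fourier_neg]
  rw [e1, h]
  simp_rw [Real.fourierInv_eq_fourier_comp_neg]

/-- The two Fourier transforms agree on `L¹ ∩ L²`. -/
theorem fourier_toLp_ae {h : ℝ → ℂ} (h1 : Integrable h) (h2 : MemLp h 2 volume) :
    (𝓕 (h2.toLp h) : Lp ℂ 2 (volume : Measure ℝ)) =ᵐ[volume] 𝓕 h := by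
  apply ae_eq_of_forall_schwartz ((Lp.memLp _).locallyIntegrable (by norm_num))
  · exact (VectorFourier.fourierIntegral_continuous Real.continuous_fourierChar
      (L := innerₗ ℝ) (by exact continuous_inner) h1).locallyIntegrable
  · intro η _
    rw [integral_mul_fourier_lp, ← integral_fourier_mul_flip η.integrable h1]
    apply integral_congr_ae
    filter_upwards [h2.coeFn_toLp] with x hx
    rw [hx]

theorem fourierInv_toLp_ae {h : ℝ → ℂ} (h1 : Integrable h) (h2 : MemLp h 2 volume) :
    (𝓕⁻ (h2.toLp h) : Lp ℂ 2 (volume : Measure ℝ)) =ᵐ[volume] 𝓕⁻ h := by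
  have hc : Continuous (𝓕⁻ h) := by
    have := (VectorFourier.fourierIntegral_continuous Real.continuous_fourierChar
      (L := innerₗ ℝ) (by exact continuous_inner) h1)
    have e : 𝓕⁻ h = fun x => 𝓕 h (-x) := by ext x; exact Real.fourierInv_eq_fourier_neg h x
    rw [e]; exact this.comp continuous_neg
  apply ae_eq_of_forall_schwartz ((Lp.memLp _).locallyIntegrable (by norm_num))
    hc.locallyIntegrable
  intro η _
  rw [integral_mul_fourierInv_lp, ← integral_fourierInv_mul_flip η.integrable h1]
  apply integral_congr_ae
  filter_upwards [h2.coeFn_toLp] with x hx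
  rw [hx]

theorem continuous_integral_mul_lp {h : ℝ → ℂ} (h2 : MemLp h 2 volume) :
    Continuous fun F : Lp ℂ 2 (volume : Measure ℝ) => ∫ x, h x * F x := by
  have hs : MemLp (fun x => conj (h x)) 2 volume := h2.star
  have : (fun F : Lp ℂ 2 (volume : Measure ℝ) => ∫ x, h x * F x)
      = fun F => inner ℂ (hs.toLp _) F := by
    ext F
    rw [L2.inner_def]
    apply integral_congr_ae
    filter_upwards [hs.coeFn_toLp] with x hx
    rw [hx]
    simp [mul_comm]
  rw [this]
  exact continuous_const.inner continuous_id

/-- Duality against a function that is only in `L¹ ∩ L²`. It is needed later for `b` times a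
Schwartz function, which need not be Schwartz. Both sides are continuous in `F`, so Schwartz `F`
suffice. -/
theorem integral_fourierInv_lp_mul {h : ℝ → ℂ} (h1 : Integrable h) (h2 : MemLp h 2 volume)
    (F : Lp ℂ 2 (volume : Measure ℝ)) :
    ∫ x, h x * (𝓕⁻ F : Lp ℂ 2 (volume : Measure ℝ)) x = ∫ x, 𝓕⁻ h x * F x := by
  have h3 : MemLp (𝓕⁻ h) 2 volume :=
    (memLp_congr_ae (fourierInv_toLp_ae h1 h2)).1 (Lp.memLp _)
  refine DenseRange.induction_on (p := fun F : Lp ℂ 2 (volume : Measure ℝ) =>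
      ∫ x, h x * (𝓕⁻ F : Lp ℂ 2 (volume : Measure ℝ)) x = ∫ x, 𝓕⁻ h x * F x)
    (SchwartzMap.denseRange_toLpCLM (E := ℝ) (F := ℂ) (μ := volume) (p := 2) ENNReal.ofNat_ne_top)
    F ?_ ?_
  · exact isClosed_eq ((continuous_integral_mul_lp h2).comp
      (FourierTransform.fourierInvCLM ℂ (Lp ℂ 2 (volume : Measure ℝ))).continuous)
      (continuous_integral_mul_lp h3)
  · intro η
    have e1 : (SchwartzMap.toLpCLM ℝ ℂ 2 volume) η = η.toLp 2 := rfl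
    rw [e1, SchwartzMap.toLp_fourierInv_eq]
    have e2 : ∫ x, h x * ((𝓕⁻ η).toLp 2 : Lp ℂ 2 (volume : Measure ℝ)) x
        = ∫ x, h x * 𝓕⁻ (η : ℝ → ℂ) x := by
      apply integral_congr_ae
      filter_upwards [(𝓕⁻ η).coeFn_toLp 2 volume] with x hx
      rw [hx, SchwartzMap.fourierInv_coe]
    have e3 : ∫ x, 𝓕⁻ h x * (η.toLp 2 : Lp ℂ 2 (volume : Measure ℝ)) x
        = ∫ x, 𝓕⁻ h x * η x := by
      apply integral_congr_ae
      filter_upwards [η.coeFn_toLp 2 volume] with x hx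
      rw [hx]
    rw [e2, e3, integral_fourierInv_mul_flip h1 η.integrable]

end LevyDonsker
end

/-! ### Translation, differentiation and isometry rules for the Fourier transform on `L²` -/

noncomputable section

namespace LevyDonsker
open scoped SchwartzMap ENNReal ContDiff ComplexConjugate

/-- Multiplication of a Schwartz function by the variable. -/
def mulX (η : 𝓢(ℝ, ℂ)) : 𝓢(ℝ, ℂ) :=
  SchwartzMap.smulLeftCLM ℂ (fun x : ℝ => Complex.ofRealCLM x) η

@[simp]
theorem mulX_apply (η : 𝓢(ℝ, ℂ)) (x : ℝ) : mulX η x = x * η x := by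
  have h : Function.HasTemperateGrowth (fun x : ℝ => Complex.ofRealCLM x) := by fun_prop
  rw [mulX, SchwartzMap.smulLeftCLM_apply_apply h]
  simp

/-- Translation of a Schwartz function. -/
def translate (t : ℝ) (η : 𝓢(ℝ, ℂ)) : 𝓢(ℝ, ℂ) := SchwartzMap.compSubConstCLM ℂ (-t) η

@[simp]
theorem translate_apply (t : ℝ) (η : 𝓢(ℝ, ℂ)) (x : ℝ) : translate t η x = η (x + t) := by
  simp [translate]

theorem fourier_translate (t : ℝ) (η : 𝓢(ℝ, ℂ)) (v : ℝ) :
    𝓕 (translate t η : ℝ → ℂ) v = Complex.exp (2 * Real.pi * Complex.I * t * v) * 𝓕 (η : ℝ → ℂ) v := by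
  rw [Real.fourier_real_eq_integral_exp_smul, Real.fourier_real_eq_integral_exp_smul]
  simp only [translate_apply]
  rw [← integral_add_right_eq_self
    (fun x : ℝ => Complex.exp (↑(-2 * Real.pi * x * v) * Complex.I) • η x) t, ← integral_const_mul]
  congr 1
  ext x
  simp only [smul_eq_mul]
  rw [← mul_assoc, ← Complex.exp_add]
  congr 2
  push_cast
  ring

theorem hasDerivAt_fourier_schwartz (η : 𝓢(ℝ, ℂ)) (v : ℝ) :
    HasDerivAt (𝓕 (η : ℝ → ℂ)) (-2 * Real.pi * Complex.I * 𝓕 (mulX η : ℝ → ℂ) v) v := by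
  have h := Real.hasDerivAt_fourier η.integrable (by
    refine (mulX η).integrable.congr (ae_of_all _ fun x => ?_)
    simp) v
  refine h.congr_deriv ?_
  rw [Real.fourier_real_eq_integral_exp_smul, Real.fourier_real_eq_integral_exp_smul,
    ← integral_const_mul]
  congr 1
  ext x
  simp
  ring

/-- The translation rule for the Fourier transform on `L²`. -/
theorem fourier_lp_modulate {f : ℝ → ℂ} (hf : MemLp f 2 volume) (t : ℝ)
    (hg : MemLp (fun v : ℝ => Complex.exp (2 * Real.pi * Complex.I * t * v) * f v) 2 volume) :
    (𝓕 (hg.toLp _) : Lp ℂ 2 (volume : Measure ℝ)) =ᵐ[volume]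
      fun x => (𝓕 (hf.toLp f) : Lp ℂ 2 (volume : Measure ℝ)) (x - t) := by
  have hm : MemLp (fun x => (𝓕 (hf.toLp f) : Lp ℂ 2 (volume : Measure ℝ)) (x - t)) 2 volume :=
    (Lp.memLp _).comp_measurePreserving (measurePreserving_sub_right volume t)
  apply ae_eq_of_forall_schwartz ((Lp.memLp _).locallyIntegrable (by norm_num))
    (hm.locallyIntegrable (by norm_num))
  intro η _
  rw [integral_mul_fourier_lp]
  have e : ∫ x, η x * (𝓕 (hf.toLp f) : Lp ℂ 2 (volume : Measure ℝ)) (x - t)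
      = ∫ x, translate t η x * (𝓕 (hf.toLp f) : Lp ℂ 2 (volume : Measure ℝ)) x := by
    rw [← integral_add_right_eq_self _ t]
    simp
  rw [e, integral_mul_fourier_lp]
  apply integral_congr_ae
  filter_upwards [hf.coeFn_toLp, hg.coeFn_toLp] with x h1 h2
  rw [h1, h2, fourier_translate]
  ring

/-- The differentiation rule for the Fourier transform on `L²`. -/
theorem fourier_lp_deriv {f f' : ℝ → ℂ} (hd : ∀ x, HasDerivAt f (f' x) x)
    (hf : MemLp f 2 volume) (hf' : MemLp f' 2 volume) :
    (𝓕 (hf'.toLp f') : Lp ℂ 2 (volume : Measure ℝ)) =ᵐ[volume]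
      fun x => 2 * Real.pi * Complex.I * x * (𝓕 (hf.toLp f) : Lp ℂ 2 (volume : Measure ℝ)) x := by
  have hl : LocallyIntegrable (fun x : ℝ => 2 * Real.pi * Complex.I * x *
      (𝓕 (hf.toLp f) : Lp ℂ 2 (volume : Measure ℝ)) x) volume := by
    have := ((Lp.memLp (𝓕 (hf.toLp f) : Lp ℂ 2 (volume : Measure ℝ))).locallyIntegrable
      (by norm_num)).continuous_smul (g := fun x : ℝ => (2 * Real.pi * Complex.I * x : ℂ))
      (by fun_prop)
    exact this
  apply ae_eq_of_forall_schwartz ((Lp.memLp _).locallyIntegrable (by norm_num)) hl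
  intro η _
  rw [integral_mul_fourier_lp]
  have e : ∫ x : ℝ, η x * (2 * Real.pi * Complex.I * x *
      (𝓕 (hf.toLp f) : Lp ℂ 2 (volume : Measure ℝ)) x)
      = 2 * Real.pi * Complex.I *
        ∫ x, mulX η x * (𝓕 (hf.toLp f) : Lp ℂ 2 (volume : Measure ℝ)) x := by
    rw [← integral_const_mul]
    congr 1
    ext x
    simp
    ring
  rw [e, integral_mul_fourier_lp]
  have e1 : ∫ x, 𝓕 (η : ℝ → ℂ) x * hf'.toLp f' x = ∫ x, 𝓕 (η : ℝ → ℂ) x * f' x := by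
    apply integral_congr_ae
    filter_upwards [hf'.coeFn_toLp] with x h1
    rw [h1]
  have e2 : ∫ x, 𝓕 (mulX η : ℝ → ℂ) x * hf.toLp f x = ∫ x, 𝓕 (mulX η : ℝ → ℂ) x * f x := by
    apply integral_congr_ae
    filter_upwards [hf.coeFn_toLp] with x h1
    rw [h1]
  have m1 : ∀ ξ : 𝓢(ℝ, ℂ), MemLp (𝓕 (ξ : ℝ → ℂ)) 2 volume := fun ξ => by
    rw [← SchwartzMap.fourier_coe]
    exact (𝓕 ξ).memLp 2 volume
  -- Integration by parts on the whole line: there is no boundary term because the product and both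
  -- derivative products are integrable, being products of `L²` functions.
  rw [e1, e2, integral_mul_deriv_eq_deriv_mul_of_integrable
    (fun x _ => hasDerivAt_fourier_schwartz η x) (fun x _ => hd x) ((m1 η).integrable_mul hf') _
    ((m1 η).integrable_mul hf)]
  · rw [← integral_const_mul, ← integral_neg]
    congr 1
    ext x
    ring
  · have := ((m1 (mulX η)).integrable_mul hf).const_mul (-2 * Real.pi * Complex.I)
    refine this.congr (ae_of_all _ fun x => ?_)
    simp
    ring

theorem norm_fourier_toLp_sub {f g : ℝ → ℂ} (hf : MemLp f 2 volume) (hg : MemLp g 2 volume) :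
    ∫ x, ‖(𝓕 (hf.toLp f) : Lp ℂ 2 (volume : Measure ℝ)) x
      - (𝓕 (hg.toLp g) : Lp ℂ 2 (volume : Measure ℝ)) x‖ ^ 2 = ∫ v, ‖f v - g v‖ ^ 2 := by
  have h : ∀ F : Lp ℂ 2 (volume : Measure ℝ), ∫ x, ‖F x‖ ^ 2 = ‖F‖ ^ 2 := by
    intro F
    have h2 : (inner ℂ F F : ℂ) = ∫ x, ((‖F x‖ ^ 2 : ℝ) : ℂ) := by
      rw [L2.inner_def]
      congr 1
      ext x
      rw [inner_self_eq_norm_sq_to_K]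
      simp
    rw [inner_self_eq_norm_sq_to_K, integral_complex_ofReal] at h2
    exact (Complex.ofReal_injective (by simpa using h2)).symm
  have e1 := h (𝓕 (hf.toLp f) - 𝓕 (hg.toLp g))
  have e2 := h (hf.toLp f - hg.toLp g)
  have e3 : ‖(𝓕 (hf.toLp f) - 𝓕 (hg.toLp g) : Lp ℂ 2 (volume : Measure ℝ))‖
      = ‖hf.toLp f - hg.toLp g‖ := by
    rw [← Lp.norm_fourier_eq (hf.toLp f - hg.toLp g)]
    congr 1
    exact ((Lp.fourierTransformₗᵢ ℝ ℂ).map_sub _ _).symm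
  rw [e3, ← e2] at e1
  calc _ = ∫ x, ‖(𝓕 (hf.toLp f) - 𝓕 (hg.toLp g) : Lp ℂ 2 (volume : Measure ℝ)) x‖ ^ 2 := by
        apply integral_congr_ae
        filter_upwards [Lp.coeFn_sub (𝓕 (hf.toLp f)) (𝓕 (hg.toLp g))] with x hx
        rw [hx]
        rfl
    _ = _ := e1
    _ = _ := by
        apply integral_congr_ae
        filter_upwards [Lp.coeFn_sub (hf.toLp f) (hg.toLp g), hf.coeFn_toLp, hg.coeFn_toLp]
          with x hx h1 h2
        rw [hx, Pi.sub_apply, h1, h2]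

end LevyDonsker
end

noncomputable section

namespace LevyDonsker
open scoped SchwartzMap ENNReal ContDiff ComplexConjugate

/-! ### Symbols of deconvolution operators -/

/-- Interpolates between the trivial bound `2` and the Lipschitz bound. The free exponent turns
moments of a symbol into Hölder regularity of its transform. -/
theorem norm_exp_I_sub_exp_I_le (x y : ℝ) {θ : ℝ} (h0 : 0 ≤ θ) (h1 : θ ≤ 1) :
    ‖Complex.exp (Complex.I * x) - Complex.exp (Complex.I * y)‖ ≤ 2 * |x - y| ^ θ := by
  have e : Complex.exp (Complex.I * x) - Complex.exp (Complex.I * y)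
      = Complex.exp (Complex.I * y) * (Complex.exp (Complex.I * ((x - y : ℝ) : ℂ)) - 1) := by
    rw [mul_sub, ← Complex.exp_add, mul_one]
    congr 2
    push_cast
    ring
  rw [e, norm_mul, mul_comm Complex.I (y : ℂ), Complex.norm_exp_ofReal_mul_I, one_mul]
  rcases le_total 1 |x - y| with h | h
  · calc _ ≤ ‖Complex.exp (Complex.I * ((x - y : ℝ) : ℂ))‖ + ‖(1 : ℂ)‖ := norm_sub_le _ _
      _ = 2 := by
        rw [mul_comm, Complex.norm_exp_ofReal_mul_I]; norm_num
      _ ≤ _ := by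
        have := Real.one_le_rpow h h0
        linarith
  · calc _ ≤ ‖x - y‖ := Real.norm_exp_I_mul_ofReal_sub_one_le
      _ = |x - y| ^ (1 : ℝ) := by rw [Real.rpow_one, Real.norm_eq_abs]
      _ ≤ |x - y| ^ θ := Real.rpow_le_rpow_of_exponent_ge_of_imp (abs_nonneg _) h h1
          (fun _ h' => absurd h' one_ne_zero)
      _ ≤ _ := by
        have := Real.rpow_nonneg (abs_nonneg (x - y)) θ
        linarith

theorem memLp_one_add_abs_rpow {s : ℝ} (hs : s < -(1 / 2)) :
    MemLp (fun v : ℝ => (1 + |v|) ^ s) 2 volume := by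
  have hc : Continuous fun v : ℝ => (1 + |v|) ^ s :=
    (by fun_prop : Continuous fun v : ℝ => 1 + |v|).rpow_const
      (fun v => Or.inl (by positivity))
  rw [memLp_two_iff_integrable_sq hc.aestronglyMeasurable]
  have := integrable_one_add_norm (E := ℝ) (μ := volume) (r := -(2 * s)) (by simp; linarith)
  refine this.congr (ae_of_all _ fun v => ?_)
  simp only [neg_neg, Real.norm_eq_abs]
  rw [mul_comm, Real.rpow_mul (by positivity)]
  simp

/-- The properties of the symbol `v ↦ φ⁻¹(-2πv)` of the deconvolution operator. -/
structure IsDeconvSymbol (b b' : ℝ → ℂ) (a ε : ℝ) : Prop where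
  hasDerivAt : ∀ v, HasDerivAt b (b' v) v
  continuous_deriv : Continuous b'
  bound : ∃ C, ∀ v, ‖b' v - 2 * Real.pi * Complex.I * a * b v‖ ≤ C * (1 + |v|)⁻¹ * ‖b v‖
  memLp : MemLp (fun v => (1 + |v|) ^ (-1 + ε) * ‖b v‖) 2 volume
  symm : ∀ v, b (-v) = conj (b v)
  pos : 0 < ε
  le_half : ε ≤ 1 / 2

/-- `b(v) / (1 - 2πiv)`. -/
def smoothed (b : ℝ → ℂ) (v : ℝ) : ℂ := b v / (1 - 2 * Real.pi * Complex.I * v)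

/-- The derivative of `smoothed b`. -/
def smoothedDeriv (b b' : ℝ → ℂ) (v : ℝ) : ℂ :=
  b' v / (1 - 2 * Real.pi * Complex.I * v)
    + 2 * Real.pi * Complex.I * b v / (1 - 2 * Real.pi * Complex.I * v) ^ 2

/-- The symbol of `(x - a)` times the kernel with symbol `smoothed b`. -/
def remainder (b b' : ℝ → ℂ) (a v : ℝ) : ℂ :=
  (smoothedDeriv b b' v - 2 * Real.pi * Complex.I * a * smoothed b v) / (2 * Real.pi * Complex.I)

/-- The continuous representative, off `a`, of the kernel with symbol `smoothed b`. -/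
def kernel (b b' : ℝ → ℂ) (a x : ℝ) : ℝ := (𝓕 (remainder b b' a) x).re / (x - a)

theorem one_add_abs_le_norm (v : ℝ) : (1 + |v|) / 2 ≤ ‖(1 - 2 * Real.pi * Complex.I * v : ℂ)‖ := by
  have h1 := Complex.abs_re_le_norm (1 - 2 * Real.pi * Complex.I * v : ℂ)
  have h2 := Complex.abs_im_le_norm (1 - 2 * Real.pi * Complex.I * v : ℂ)
  have e1 : (1 - 2 * Real.pi * Complex.I * v : ℂ).re = 1 := by simp
  have e2 : (1 - 2 * Real.pi * Complex.I * v : ℂ).im = -(2 * Real.pi * v) := by simp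
  rw [e1] at h1
  rw [e2, abs_neg, abs_mul, abs_of_pos (by positivity)] at h2
  have : |v| ≤ 2 * Real.pi * |v| := by
    have := Real.pi_gt_three
    nlinarith [abs_nonneg v]
  simp only [abs_one] at h1
  linarith

theorem one_sub_ne_zero (v : ℝ) : (1 - 2 * Real.pi * Complex.I * v : ℂ) ≠ 0 := by
  have := one_add_abs_le_norm v
  rw [← norm_pos_iff]
  have := abs_nonneg v
  linarith

theorem norm_inv_one_sub_le (v : ℝ) :
    ‖(1 - 2 * Real.pi * Complex.I * v : ℂ)‖⁻¹ ≤ 2 * (1 + |v|)⁻¹ := by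
  have h := inv_anti₀ (by positivity) (one_add_abs_le_norm v)
  rwa [inv_div, div_eq_mul_inv] at h

theorem hasDerivAt_smoothed {b b' : ℝ → ℂ} (h : ∀ v, HasDerivAt b (b' v) v) (v : ℝ) :
    HasDerivAt (smoothed b) (smoothedDeriv b b' v) v := by
  have h1 : HasDerivAt (fun v : ℝ => (1 - 2 * Real.pi * Complex.I * v : ℂ))
      (-(2 * Real.pi * Complex.I)) v := by
    have := (((hasDerivAt_id v).ofReal_comp).const_mul (2 * Real.pi * Complex.I)).const_sub 1
    simpa using this
  refine ((h v).div h1 (one_sub_ne_zero v)).congr_deriv ?_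
  rw [smoothedDeriv]
  field_simp [one_sub_ne_zero v]
  ring

theorem norm_smoothed_le (b : ℝ → ℂ) (v : ℝ) : ‖smoothed b v‖ ≤ 2 * ((1 + |v|)⁻¹ * ‖b v‖) := by
  rw [smoothed, norm_div, div_eq_mul_inv]
  have := mul_le_mul_of_nonneg_left (norm_inv_one_sub_le v) (norm_nonneg (b v))
  linarith

theorem exists_norm_fourier_remainder_le (b b' : ℝ → ℂ) (a : ℝ) :
    ∃ M, 0 ≤ M ∧ ∀ x, ‖𝓕 (remainder b b' a) x‖ ≤ M :=
  ⟨∫ v, ‖remainder b b' a v‖, by positivity, fun x =>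
    VectorFourier.norm_fourierIntegral_le_integral_norm _ _ _ _ x⟩

namespace IsDeconvSymbol

variable {b b' : ℝ → ℂ} {a ε : ℝ} (h : IsDeconvSymbol b b' a ε)
include h

theorem continuous : Continuous b :=
  continuous_iff_continuousAt.2 fun v => (h.hasDerivAt v).continuousAt

/-- The factor `1/(1 + |v|)` in `bound` is at most one, so `b'` is dominated by `b` and inherits its
weighted square integrability. -/
theorem exists_norm_deriv_le : ∃ C, 0 ≤ C ∧ ∀ v, ‖b' v‖ ≤ C * ‖b v‖ := by
  obtain ⟨C, hC⟩ := h.bound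
  refine ⟨|C| + 2 * Real.pi * |a|, by positivity, fun v => ?_⟩
  have h1 : ‖b' v‖ ≤ ‖b' v - 2 * Real.pi * Complex.I * a * b v‖
      + ‖2 * Real.pi * Complex.I * a * b v‖ := by
    simpa using norm_add_le (b' v - 2 * Real.pi * Complex.I * a * b v)
      (2 * Real.pi * Complex.I * a * b v)
  have h2 : ‖(2 * Real.pi * Complex.I * a * b v : ℂ)‖ = 2 * Real.pi * |a| * ‖b v‖ := by
    simp [abs_of_pos Real.pi_pos]
  have h3 : C * (1 + |v|)⁻¹ ≤ |C| := by
    calc C * (1 + |v|)⁻¹ ≤ |C| * (1 + |v|)⁻¹ := by gcongr; exact le_abs_self C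
      _ ≤ |C| * 1 := by
        gcongr
        exact inv_le_one_of_one_le₀ (by linarith [abs_nonneg v])
      _ = |C| := mul_one _
  have h4 := hC v
  have := norm_nonneg (b v)
  nlinarith

theorem memLp_rpow_mul_smoothed :
    MemLp (fun v => (1 + |v|) ^ ε * ‖smoothed b v‖) 2 volume := by
  have hs : Continuous (smoothed b) :=
    continuous_iff_continuousAt.2 fun v => (hasDerivAt_smoothed h.hasDerivAt v).continuousAt
  have hc : Continuous fun v : ℝ => (1 + |v|) ^ ε :=
    (by fun_prop : Continuous fun v : ℝ => 1 + |v|).rpow_const (fun v => Or.inl (by positivity))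
  refine (h.memLp.const_mul 2).mono' (hc.mul hs.norm).aestronglyMeasurable
    (ae_of_all _ fun v => ?_)
  have := norm_smoothed_le b v
  have hp : 0 < 1 + |v| := by positivity
  rw [Real.norm_of_nonneg (by positivity), Real.rpow_add hp, Real.rpow_neg_one]
  have h2 : 0 ≤ (1 + |v|) ^ ε := by positivity
  nlinarith

theorem continuous_smoothed : Continuous (smoothed b) :=
  continuous_iff_continuousAt.2 fun v => (hasDerivAt_smoothed h.hasDerivAt v).continuousAt

theorem memLp_inv_mul : MemLp (fun v => (1 + |v|)⁻¹ * ‖b v‖) 2 volume := by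
  refine h.memLp.mono' ?_ (ae_of_all _ fun v => ?_)
  · exact (((by fun_prop : Continuous fun v : ℝ => 1 + |v|).inv₀
      (fun v => by positivity)).mul h.continuous.norm).aestronglyMeasurable
  · rw [Real.norm_of_nonneg (by positivity)]
    gcongr
    rw [← Real.rpow_neg_one]
    exact Real.rpow_le_rpow_of_exponent_le (by linarith [abs_nonneg v]) (by linarith [h.pos])

theorem memLp_smoothed : MemLp (smoothed b) 2 volume :=
  (h.memLp_inv_mul.const_mul 2).mono' h.continuous_smoothed.aestronglyMeasurable
    (ae_of_all _ (norm_smoothed_le b))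

theorem continuous_smoothedDeriv : Continuous (smoothedDeriv b b') := by
  have hd := h.continuous_deriv
  have hc := h.continuous
  have h1 : Continuous fun v : ℝ => (1 - 2 * Real.pi * Complex.I * v : ℂ) := by fun_prop
  exact (hd.div h1 one_sub_ne_zero).add ((continuous_const.mul hc).div (h1.pow 2)
    fun v => pow_ne_zero _ (one_sub_ne_zero v))

theorem memLp_smoothedDeriv : MemLp (smoothedDeriv b b') 2 volume := by
  obtain ⟨C, hC0, hC⟩ := h.exists_norm_deriv_le
  refine (h.memLp_inv_mul.const_mul (2 * C + 8 * Real.pi)).mono'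
    h.continuous_smoothedDeriv.aestronglyMeasurable (ae_of_all _ fun v => ?_)
  have hi := norm_inv_one_sub_le v
  set n := ‖(1 - 2 * Real.pi * Complex.I * v : ℂ)‖⁻¹ with hn
  have hn0 : 0 ≤ n := by positivity
  have hp : (1 + |v|)⁻¹ ≤ 1 := inv_le_one_of_one_le₀ (by linarith [abs_nonneg v])
  have hp0 : 0 ≤ (1 + |v|)⁻¹ := by positivity
  calc ‖smoothedDeriv b b' v‖ ≤ ‖b' v‖ * n + 2 * Real.pi * ‖b v‖ * n ^ 2 := by
        refine (norm_add_le _ _).trans (le_of_eq ?_)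
        simp [hn, abs_of_pos Real.pi_pos, div_eq_mul_inv]
    _ ≤ (C * ‖b v‖) * (2 * (1 + |v|)⁻¹) + 2 * Real.pi * ‖b v‖ * (2 * (1 + |v|)⁻¹) ^ 2 := by
        gcongr
        exact hC v
    _ ≤ (C * ‖b v‖) * (2 * (1 + |v|)⁻¹) + 2 * Real.pi * ‖b v‖ * (4 * (1 + |v|)⁻¹) := by
        gcongr
        nlinarith
    _ = _ := by ring

theorem continuous_remainder : Continuous (remainder b b' a) :=
  (h.continuous_smoothedDeriv.sub (continuous_const.mul h.continuous_smoothed)).div_const _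

theorem memLp_remainder : MemLp (remainder b b' a) 2 volume := by
  have := (h.memLp_smoothedDeriv.sub (h.memLp_smoothed.const_mul
    (2 * Real.pi * Complex.I * a))).const_mul (2 * Real.pi * Complex.I)⁻¹
  refine (memLp_congr_ae (ae_of_all _ fun v => ?_)).1 this
  simp [remainder, div_eq_mul_inv, mul_comm]

/-- The leading part `2πi a b` of `b'` cancels against the term with `a`. What remains is a piece
with `b' - 2πi a b` over `1 - 2πiv` and a piece with `b` over `(1 - 2πiv)²`, both gaining two powers
of `1 + |v|` on `b`. -/
theorem exists_norm_remainder_le :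
    ∃ C, 0 ≤ C ∧ ∀ v, ‖remainder b b' a v‖ ≤ C * ((1 + |v|) ^ (-2 : ℝ) * ‖b v‖) := by
  obtain ⟨C, hC⟩ := h.bound
  refine ⟨2 * |C| + 4, by positivity, fun v => ?_⟩
  have hi := norm_inv_one_sub_le v
  set n := ‖(1 - 2 * Real.pi * Complex.I * v : ℂ)‖⁻¹ with hn
  have hn0 : 0 ≤ n := by positivity
  have hp : (1 + |v|) ^ (-2 : ℝ) = ((1 + |v|)⁻¹) ^ 2 := by
    rw [Real.rpow_neg (by positivity), inv_pow]
    norm_num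
  have hb := norm_nonneg (b v)
  have e : remainder b b' a v = (2 * Real.pi * Complex.I)⁻¹ *
      ((b' v - 2 * Real.pi * Complex.I * a * b v) / (1 - 2 * Real.pi * Complex.I * v))
      + b v / (1 - 2 * Real.pi * Complex.I * v) ^ 2 := by
    have hpi : (2 * Real.pi * Complex.I : ℂ) ≠ 0 := by simp [Real.pi_ne_zero]
    rw [remainder, smoothedDeriv, smoothed]
    field_simp
    ring
  have h2pi : (2 * Real.pi)⁻¹ ≤ 1 := by
    apply inv_le_one_of_one_le₀
    linarith [Real.pi_gt_three]
  rw [e, hp]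
  calc _ ≤ (2 * Real.pi)⁻¹ * (‖b' v - 2 * Real.pi * Complex.I * a * b v‖ * n)
        + ‖b v‖ * n ^ 2 := by
        refine (norm_add_le _ _).trans (le_of_eq ?_)
        simp [hn, abs_of_pos Real.pi_pos, div_eq_mul_inv]
    _ ≤ 1 * ((|C| * (1 + |v|)⁻¹ * ‖b v‖) * (2 * (1 + |v|)⁻¹))
        + ‖b v‖ * (2 * (1 + |v|)⁻¹) ^ 2 := by
        gcongr
        refine (hC v).trans ?_
        gcongr
        exact le_abs_self C
    _ = _ := by ring

/-- Cauchy–Schwarz: the weight `(1 + |v|)^{1/2 - 2}` splits as `(1 + |v|)^{-1/2 - ε}`, which is in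
`L²`, times the weight `(1 + |v|)^{-1 + ε}` of condition (c). -/
theorem integrable_rpow_mul_remainder :
    Integrable (fun v => (1 + |v|) ^ (1 / 2 : ℝ) * ‖remainder b b' a v‖) := by
  obtain ⟨C, hC0, hC⟩ := h.exists_norm_remainder_le
  have h1 := ((memLp_one_add_abs_rpow (s := -(1 / 2) - ε) (by linarith [h.pos])).integrable_mul
    h.memLp).const_mul C
  have hc : Continuous fun v : ℝ => (1 + |v|) ^ (1 / 2 : ℝ) :=
    (by fun_prop : Continuous fun v : ℝ => 1 + |v|).rpow_const (fun v => Or.inl (by positivity))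
  refine h1.mono' (hc.mul h.continuous_remainder.norm).aestronglyMeasurable
    (ae_of_all _ fun v => ?_)
  have hp : 0 < 1 + |v| := by positivity
  rw [Real.norm_of_nonneg (by positivity)]
  calc _ ≤ (1 + |v|) ^ (1 / 2 : ℝ) * (C * ((1 + |v|) ^ (-2 : ℝ) * ‖b v‖)) := by
        gcongr
        exact hC v
    _ = C * (((1 + |v|) ^ (1 / 2 : ℝ) * (1 + |v|) ^ (-2 : ℝ)) * ‖b v‖) := by ring
    _ = C * (((1 + |v|) ^ (-(1 / 2) - ε) * (1 + |v|) ^ (-1 + ε)) * ‖b v‖) := by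
        rw [← Real.rpow_add hp, ← Real.rpow_add hp]
        ring_nf
    _ = _ := by simp only [Pi.mul_apply]; ring

theorem integrable_remainder : Integrable (remainder b b' a) := by
  refine h.integrable_rpow_mul_remainder.mono' h.continuous_remainder.aestronglyMeasurable
    (ae_of_all _ fun v => ?_)
  have : 1 ≤ (1 + |v|) ^ (1 / 2 : ℝ) :=
    Real.one_le_rpow (by linarith [abs_nonneg v]) (by norm_num)
  exact le_mul_of_one_le_left (norm_nonneg _) this

theorem deriv_symm (v : ℝ) : b' (-v) = -conj (b' v) := by
  have h1 : HasDerivAt (fun v => b (-v)) (-b' (-v)) v := by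
    have := (h.hasDerivAt (-v)).scomp v (hasDerivAt_neg v)
    simp only [neg_smul, one_smul] at this
    exact this
  have h2 : HasDerivAt (fun v => conj (b v)) (conj (b' v)) v := (h.hasDerivAt v).star
  have : (fun v => b (-v)) = fun v => conj (b v) := funext h.symm
  rw [this] at h1
  rw [← h1.unique h2, neg_neg]

theorem remainder_symm (v : ℝ) : remainder b b' a (-v) = conj (remainder b b' a v) := by
  simp only [remainder, smoothedDeriv, smoothed, h.symm, h.deriv_symm, map_div₀, map_sub, map_add,
    map_mul, map_pow, map_one, map_ofNat, Complex.conj_I, Complex.conj_ofReal]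
  have e : (1 - 2 * Real.pi * Complex.I * ((-v : ℝ) : ℂ))
    = (1 - 2 * Real.pi * -Complex.I * v : ℂ) := by push_cast; ring
  rw [e, ← neg_div_neg_eq]
  congr 1
  · ring
  · ring

/-- Hermitian symmetry of the symbol makes its transform real, so taking the real part in `kernel`
loses nothing. -/
theorem fourier_remainder_real (x : ℝ) :
    ((𝓕 (remainder b b' a) x).re : ℂ) = 𝓕 (remainder b b' a) x := by
  rw [← Complex.conj_eq_iff_re]
  rw [Real.fourier_real_eq_integral_exp_smul, ← integral_conj, ← integral_neg_eq_self]
  congr 1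
  ext v
  simp only [smul_eq_mul, map_mul, h.remainder_symm, Complex.conj_conj, ← Complex.exp_conj,
    Complex.conj_I, Complex.conj_ofReal]
  congr 2
  push_cast
  ring

/-- The half moment of the symbol from `integrable_rpow_mul_remainder` becomes Hölder continuity of
order `1/2`. -/
theorem exists_norm_fourier_remainder_sub_le : ∃ M, 0 ≤ M ∧ ∀ x y,
    ‖𝓕 (remainder b b' a) x - 𝓕 (remainder b b' a) y‖ ≤ M * |x - y| ^ (1 / 2 : ℝ) := by
  refine ⟨2 * (2 * Real.pi) ^ (1 / 2 : ℝ) *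
    ∫ v, (1 + |v|) ^ (1 / 2 : ℝ) * ‖remainder b b' a v‖, by positivity, fun x y => ?_⟩
  have i : ∀ x : ℝ, Integrable fun v : ℝ =>
      Complex.exp (↑(-2 * Real.pi * v * x) * Complex.I) * remainder b b' a v := fun x => by
    refine h.integrable_remainder.bdd_mul (c := 1) (by fun_prop) (ae_of_all _ fun v => ?_)
    rw [Complex.norm_exp_ofReal_mul_I]
  rw [Real.fourier_real_eq_integral_exp_smul, Real.fourier_real_eq_integral_exp_smul]
  simp only [smul_eq_mul]
  rw [← integral_sub (i x) (i y)]
  calc _ ≤ ∫ v, 2 * (2 * Real.pi) ^ (1 / 2 : ℝ) * |x - y| ^ (1 / 2 : ℝ) *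
        ((1 + |v|) ^ (1 / 2 : ℝ) * ‖remainder b b' a v‖) := by
        refine norm_integral_le_of_norm_le (h.integrable_rpow_mul_remainder.const_mul _)
          (ae_of_all _ fun v => ?_)
        rw [← sub_mul, norm_mul, mul_comm _ Complex.I, mul_comm _ Complex.I, ← mul_assoc]
        gcongr
        refine (norm_exp_I_sub_exp_I_le _ _ (by norm_num) (by norm_num)
          (θ := 1 / 2)).trans ?_
        have e : |-2 * Real.pi * v * x - -2 * Real.pi * v * y|
            = 2 * Real.pi * |x - y| * |v| := by
          rw [show -2 * Real.pi * v * x - -2 * Real.pi * v * y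
            = -(2 * Real.pi * (x - y) * v) by ring, abs_neg, abs_mul, abs_mul,
            abs_of_pos (by positivity : 0 < 2 * Real.pi)]
        rw [e, Real.mul_rpow (by positivity) (by positivity),
          Real.mul_rpow (by positivity) (by positivity)]
        have : |v| ^ (1 / 2 : ℝ) ≤ (1 + |v|) ^ (1 / 2 : ℝ) := by
          gcongr
          linarith
        calc _ = 2 * (2 * Real.pi) ^ (1 / 2 : ℝ) * |x - y| ^ (1 / 2 : ℝ) * |v| ^ (1 / 2 : ℝ) := by
              ring
          _ ≤ _ := by gcongr
    _ = _ := by rw [integral_const_mul]; ring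

end IsDeconvSymbol

end LevyDonsker
end

/-! ### Size, continuity and decay of the kernel and the step kernel -/

noncomputable section

namespace LevyDonsker
open scoped SchwartzMap ENNReal ContDiff ComplexConjugate

/-- The kernel `σ w + ∫_{σ(x - z) ≥ 0} w(z) dz`; for `σ = 1` it is the distribution function, and
for `σ = -1` the survival function, of the deconvolution operator. -/
def stepKernel (b b' : ℝ → ℂ) (a σ x : ℝ) : ℝ :=
  σ * kernel b b' a x + ∫ z in {z | 0 ≤ σ * (x - z)}, kernel b b' a z

/-- Cauchy–Schwarz on an interval of length `|x - y|`, in the additive form `2|f| ≤ s f² + s⁻¹` with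
`s = |x - y|^{1/2}`. The `+ 1` is the contribution of `s⁻¹`. -/
theorem setIntegral_uIcc_abs_le {f : ℝ → ℝ} (hf : MemLp f 2 volume) (x y : ℝ) :
    ∫ z in Set.uIcc x y, |f z| ≤ ((∫ z, f z ^ 2) + 1) * |x - y| ^ (1 / 2 : ℝ) := by
  have hA : 0 ≤ ∫ z, f z ^ 2 := integral_nonneg fun z => sq_nonneg _
  rcases eq_or_ne x y with rfl | hxy
  · simp
  have hd : 0 < |x - y| := abs_pos.2 (sub_ne_zero.2 hxy)
  set s := |x - y| ^ (1 / 2 : ℝ) with hs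
  have hs0 : 0 < s := by positivity
  have hss : s * s = |x - y| := by
    rw [hs, ← Real.rpow_add hd]
    norm_num
  have hsq : Integrable (fun z => f z ^ 2) := hf.integrable_sq
  have hv : volume.real (Set.uIcc x y) = |x - y| := by
    rw [Measure.real, Real.volume_interval, ENNReal.toReal_ofReal (abs_nonneg _), abs_sub_comm]
  have hfin : volume (Set.uIcc x y) ≠ ⊤ := by
    rw [Real.volume_interval]
    exact ENNReal.ofReal_ne_top
  have ic : IntegrableOn (fun _ : ℝ => s⁻¹) (Set.uIcc x y) := integrableOn_const hfin
  calc ∫ z in Set.uIcc x y, |f z| ≤ ∫ z in Set.uIcc x y, (s * f z ^ 2 + s⁻¹) := by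
        refine integral_mono_of_nonneg (ae_of_all _ fun z => abs_nonneg _)
          ((hsq.const_mul s).integrableOn.add ic) (ae_of_all _ fun z => ?_)
        have : 0 ≤ s * (|f z| - s⁻¹) ^ 2 := by positivity
        have e : s * (|f z| - s⁻¹) ^ 2 = s * f z ^ 2 - 2 * |f z| + s⁻¹ := by
          have : s * s⁻¹ = 1 := mul_inv_cancel₀ hs0.ne'
          rw [sub_sq, sq_abs]
          linear_combination (-2 * |f z| + s⁻¹) * this
        have := abs_nonneg (f z)
        dsimp only
        linarith
    _ = s * (∫ z in Set.uIcc x y, f z ^ 2) + s := by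
        rw [integral_add (hsq.const_mul s).integrableOn ic, integral_const_mul,
          setIntegral_const, hv, ← hss, smul_eq_mul, mul_assoc, mul_inv_cancel₀ hs0.ne', mul_one]
    _ ≤ s * (∫ z, f z ^ 2) + s := by
        have := setIntegral_le_integral (s := Set.uIcc x y) hsq
          (ae_of_all _ fun z => sq_nonneg _)
        gcongr
    _ = _ := by ring

namespace IsDeconvSymbol

variable {b b' : ℝ → ℂ} {a ε : ℝ} (h : IsDeconvSymbol b b' a ε)
include h

/-- By the differentiation rule the transform of `smoothedDeriv` is `2πi x` times that of
`smoothed`. So the transform of `remainder` is `x - a` times the latter, and one divides by `x - a`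
off the null set `{a}`. -/
theorem kernel_ae_eq : (fun x => (kernel b b' a x : ℂ)) =ᵐ[volume]
    (𝓕 (h.memLp_smoothed.toLp _) : Lp ℂ 2 (volume : Measure ℝ)) := by
  set W := (𝓕 (h.memLp_smoothed.toLp _) : Lp ℂ 2 (volume : Measure ℝ)) with hW
  have h1 := fourier_lp_deriv (hasDerivAt_smoothed h.hasDerivAt) h.memLp_smoothed
    h.memLp_smoothedDeriv
  have h2 := fourier_toLp_ae h.integrable_remainder h.memLp_remainder
  have e : h.memLp_remainder.toLp _ = (2 * Real.pi * Complex.I : ℂ)⁻¹ •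
      (h.memLp_smoothedDeriv.toLp _ - (2 * Real.pi * Complex.I * a : ℂ) •
        h.memLp_smoothed.toLp _) := by
    rw [← MemLp.toLp_const_smul, ← MemLp.toLp_sub, ← MemLp.toLp_const_smul]
    congr 1
    ext v
    simp [remainder, div_eq_mul_inv, mul_comm]
  have e' : (𝓕 (h.memLp_remainder.toLp _) : Lp ℂ 2 (volume : Measure ℝ))
      = (2 * Real.pi * Complex.I : ℂ)⁻¹ •
      (𝓕 (h.memLp_smoothedDeriv.toLp _) - (2 * Real.pi * Complex.I * a : ℂ) • W) := by
    rw [e]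
    have hL : ∀ F : Lp ℂ 2 (volume : Measure ℝ), 𝓕 F = Lp.fourierTransformₗᵢ ℝ ℂ F := fun _ => rfl
    simp only [hW, hL, map_smul, map_sub]
  rw [e'] at h2
  have hne : ∀ᵐ x : ℝ, x ≠ a := by
    simp [ae_iff]
  filter_upwards [h1, h2, hne, Lp.coeFn_smul (2 * Real.pi * Complex.I : ℂ)⁻¹
      (𝓕 (h.memLp_smoothedDeriv.toLp _) - (2 * Real.pi * Complex.I * a : ℂ) • W),
    Lp.coeFn_sub (𝓕 (h.memLp_smoothedDeriv.toLp _)) ((2 * Real.pi * Complex.I * a : ℂ) • W),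
    Lp.coeFn_smul (2 * Real.pi * Complex.I * a : ℂ) W] with x h1 h2 hx h3 h4 h5
  rw [kernel, Complex.ofReal_div, h.fourier_remainder_real, ← h2, h3, Pi.smul_apply, h4,
    Pi.sub_apply, h5, Pi.smul_apply, h1]
  have hxa : ((x - a : ℝ) : ℂ) ≠ 0 := Complex.ofReal_ne_zero.2 (sub_ne_zero.2 hx)
  rw [div_eq_iff hxa]
  have hpi : (Real.pi : ℂ) ≠ 0 := Complex.ofReal_ne_zero.2 Real.pi_ne_zero
  simp only [smul_eq_mul]
  push_cast
  field_simp
  rw [← hW]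
  ring

theorem memLp_kernel : MemLp (kernel b b' a) 2 volume := by
  have := ((memLp_congr_ae h.kernel_ae_eq).2 (Lp.memLp _)).re
  simpa using this

theorem continuous_fourier_remainder : Continuous fun x => (𝓕 (remainder b b' a) x).re :=
  Complex.continuous_re.comp (VectorFourier.fourierIntegral_continuous Real.continuous_fourierChar
      (L := innerₗ ℝ) (by exact continuous_inner) h.integrable_remainder)

theorem measurable_kernel : Measurable (kernel b b' a) :=
  h.continuous_fourier_remainder.measurable.div (by fun_prop)

theorem continuousAt_kernel {x : ℝ} (hx : x ≠ a) : ContinuousAt (kernel b b' a) x :=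
  h.continuous_fourier_remainder.continuousAt.div (by fun_prop) (sub_ne_zero.2 hx)

/-- Apart from the `L²` bound on the kernel itself, `|x - a|` times the kernel is bounded by the
transform of `remainder`, which is in `L²` by Plancherel. -/
theorem memLp_one_add_mul_kernel :
    MemLp (fun x => (1 + |x - a|) * kernel b b' a x) 2 volume := by
  have h1 : MemLp (fun x => (𝓕 (remainder b b' a) x)) 2 volume :=
    (memLp_congr_ae (fourier_toLp_ae h.integrable_remainder h.memLp_remainder)).1 (Lp.memLp _)
  refine (h.memLp_kernel.norm.add h1.norm).mono'
    (((by fun_prop : Measurable fun x : ℝ => 1 + |x - a|).mul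
      h.measurable_kernel).aestronglyMeasurable) ?_
  filter_upwards with x
  rw [norm_mul, Real.norm_of_nonneg (by positivity), add_mul, one_mul]
  simp only [Pi.add_apply]
  gcongr
  rw [kernel, norm_div, Real.norm_eq_abs (x - a)]
  rcases eq_or_ne (x - a) 0 with hx | hx
  · simp [hx]
  · rw [mul_div_cancel₀ _ (abs_ne_zero.2 hx)]
    exact Complex.abs_re_le_norm _

/-- Cauchy–Schwarz with `1/4 = -3/4 + 1`, the power `-3/4` being square integrable. The extra
quarter moment is what makes the tails of the integrated kernel decay polynomially. -/
theorem integrable_rpow_mul_kernel :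
    Integrable (fun x => (1 + |x - a|) ^ (1 / 4 : ℝ) * |kernel b b' a x|) := by
  have h1 : MemLp (fun x : ℝ => (1 + |x - a|) ^ (-(3 / 4) : ℝ)) 2 volume :=
    (memLp_one_add_abs_rpow (s := -(3 / 4)) (by norm_num)).comp_measurePreserving
      (measurePreserving_sub_right volume a)
  have h2 := h1.integrable_mul h.memLp_one_add_mul_kernel.norm
  refine h2.congr (ae_of_all _ fun x => ?_)
  have hp : 0 < 1 + |x - a| := by positivity
  simp only [Pi.mul_apply, norm_mul, Real.norm_eq_abs, abs_of_pos hp]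
  rw [← mul_assoc]
  congr 1
  nth_rw 2 [← Real.rpow_one (1 + |x - a|)]
  rw [← Real.rpow_add hp]
  norm_num

theorem integrable_kernel : Integrable (kernel b b' a) := by
  refine h.integrable_rpow_mul_kernel.mono' h.measurable_kernel.aestronglyMeasurable
    (ae_of_all _ fun x => ?_)
  have : 1 ≤ (1 + |x - a|) ^ (1 / 4 : ℝ) :=
    Real.one_le_rpow (by linarith [abs_nonneg (x - a)]) (by norm_num)
  exact le_mul_of_one_le_left (norm_nonneg _) this

/-- The `L²` modulus of continuity of the kernel. -/
theorem exists_integral_kernel_sub_sq_le : ∃ M, 0 ≤ M ∧ ∀ s t : ℝ,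
    ∫ x, (kernel b b' a (x - t) - kernel b b' a (x - s)) ^ 2 ≤ M * |t - s| ^ (2 * ε) := by
  have hE := h.memLp_rpow_mul_smoothed.integrable_sq
  refine ⟨(2 * (2 * Real.pi) ^ ε) ^ 2 * ∫ v, ((1 + |v|) ^ ε * ‖smoothed b v‖) ^ 2,
    by positivity, fun s t => ?_⟩
  have hm : ∀ t : ℝ, MemLp (fun v : ℝ => Complex.exp (2 * Real.pi * Complex.I * t * v) *
      smoothed b v) 2 volume := fun t => by
    refine h.memLp_smoothed.mono ?_ (ae_of_all _ fun v => ?_)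
    · have := h.continuous_smoothed
      exact (by fun_prop : Continuous _).aestronglyMeasurable
    · rw [norm_mul, show (2 * Real.pi * Complex.I * t * v : ℂ)
        = ((2 * Real.pi * t * v : ℝ) : ℂ) * Complex.I by push_cast; ring,
        Complex.norm_exp_ofReal_mul_I, one_mul]
  -- Translating the kernel by `t` modulates its symbol, so by Plancherel the distance of two
  -- translates is an integral of `|e^{ix} - e^{iy}|²` against the squared symbol. Half the exponent
  -- `2ε` is then absorbed by each factor.
  have hk : ∀ t : ℝ, (fun x => (kernel b b' a (x - t) : ℂ)) =ᵐ[volume]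
      (𝓕 ((hm t).toLp _) : Lp ℂ 2 (volume : Measure ℝ)) := fun t => by
    have h1 := (measurePreserving_sub_right volume t).quasiMeasurePreserving.ae_eq_comp
      h.kernel_ae_eq
    exact h1.trans (fourier_lp_modulate h.memLp_smoothed t (hm t)).symm
  calc _ = ∫ x, ‖(𝓕 ((hm t).toLp _) : Lp ℂ 2 (volume : Measure ℝ)) x
        - (𝓕 ((hm s).toLp _) : Lp ℂ 2 (volume : Measure ℝ)) x‖ ^ 2 := by
        apply integral_congr_ae
        filter_upwards [hk t, hk s] with x h1 h2
        rw [← h1, ← h2, ← Complex.ofReal_sub, Complex.norm_real, Real.norm_eq_abs, sq_abs]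
    _ = _ := norm_fourier_toLp_sub (hm t) (hm s)
    _ ≤ ∫ v, (2 * (2 * Real.pi) ^ ε) ^ 2 * |t - s| ^ (2 * ε) *
        ((1 + |v|) ^ ε * ‖smoothed b v‖) ^ 2 := by
        refine integral_mono_of_nonneg (ae_of_all _ fun v => by positivity)
          (hE.const_mul _) (ae_of_all _ fun v => ?_)
        have e : |t - s| ^ (2 * ε) = (|t - s| ^ ε) ^ 2 := by
          rw [mul_comm, Real.rpow_mul (abs_nonneg _)]
          norm_num
        dsimp only
        rw [e, ← mul_pow, ← mul_pow]
        gcongr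
        rw [← sub_mul, norm_mul, ← mul_assoc]
        gcongr
        have e1 : ∀ t : ℝ, (2 * Real.pi * Complex.I * t * v : ℂ)
          = Complex.I * ((2 * Real.pi * t * v : ℝ) : ℂ) := fun t => by push_cast; ring
        rw [e1, e1]
        refine (norm_exp_I_sub_exp_I_le _ _ h.pos.le (by linarith [h.le_half])).trans ?_
        have e2 : |2 * Real.pi * t * v - 2 * Real.pi * s * v|
            = 2 * Real.pi * |t - s| * |v| := by
          rw [show 2 * Real.pi * t * v - 2 * Real.pi * s * v
            = 2 * Real.pi * (t - s) * v by ring, abs_mul, abs_mul,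
            abs_of_pos (by positivity : 0 < 2 * Real.pi)]
        rw [e2, Real.mul_rpow (by positivity) (by positivity),
          Real.mul_rpow (by positivity) (by positivity)]
        have : |v| ^ ε ≤ (1 + |v|) ^ ε := by
          have := h.pos
          gcongr
          linarith
        calc _ = 2 * (2 * Real.pi) ^ ε * |t - s| ^ ε * |v| ^ ε := by ring
          _ ≤ _ := by gcongr
    _ = _ := by rw [integral_const_mul]; ring

/-- The two half-lines differ only between `x` and `y`, where the kernel is square integrable. This
holds across `a` too, so the integrated kernel has no singularity. -/
theorem exists_setIntegral_kernel_sub_le : ∃ M, 0 ≤ M ∧ ∀ σ : ℝ, σ ≠ 0 → ∀ x y : ℝ,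
    |(∫ z in {z | 0 ≤ σ * (x - z)}, kernel b b' a z)
      - ∫ z in {z | 0 ≤ σ * (y - z)}, kernel b b' a z| ≤ M * |x - y| ^ (1 / 2 : ℝ) := by
  refine ⟨(∫ z, kernel b b' a z ^ 2) + 1, by positivity, fun σ hσ x y => ?_⟩
  refine le_trans ?_ (setIntegral_uIcc_abs_le h.memLp_kernel x y)
  have hm : ∀ x, MeasurableSet {z | 0 ≤ σ * (x - z)} := fun x =>
    measurableSet_le measurable_const (by fun_prop)
  have hi := h.integrable_kernel
  rw [← integral_indicator (hm x), ← integral_indicator (hm y),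
    ← integral_sub (hi.indicator (hm x)) (hi.indicator (hm y)),
    ← integral_indicator measurableSet_uIcc, ← Real.norm_eq_abs]
  refine norm_integral_le_of_norm_le (hi.abs.indicator measurableSet_uIcc)
    (ae_of_all _ fun z => ?_)
  have key : ∀ x y : ℝ, z ∉ Set.uIcc x y → 0 ≤ σ * (x - z) → 0 ≤ σ * (y - z) := by
    intro x y hz hx
    rw [Set.mem_uIcc] at hz
    push Not at hz
    rcases lt_or_gt_of_ne hσ with hs | hs
    · have : x ≤ z := by nlinarith
      have := hz.1 this
      nlinarith
    · have : z ≤ x := by nlinarith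
      have := (lt_of_not_ge fun hy => (hz.2 hy).not_ge this)
      nlinarith
  by_cases hz : z ∈ Set.uIcc x y
  · rw [Set.indicator_of_mem hz, Real.norm_eq_abs]
    simp only [Set.indicator_apply]
    split_ifs <;> simp
  · have hz' : z ∉ Set.uIcc y x := by rwa [Set.uIcc_comm]
    have : (0 ≤ σ * (x - z)) ↔ (0 ≤ σ * (y - z)) := ⟨key x y hz, key y x hz'⟩
    rw [Set.indicator_of_notMem hz]
    simp only [Set.indicator_apply, Set.mem_ofPred_eq, this, sub_self, norm_zero, le_refl]

theorem exists_abs_setIntegral_kernel_le : ∃ M, 0 ≤ M ∧ ∀ σ x : ℝ,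
    |∫ z in {z | 0 ≤ σ * (x - z)}, kernel b b' a z| ≤ M := by
  refine ⟨∫ z, |kernel b b' a z|, by positivity, fun σ x => ?_⟩
  refine (abs_integral_le_integral_abs).trans ?_
  exact integral_mono_measure Measure.restrict_le_self (ae_of_all _ fun z => abs_nonneg _)
    h.integrable_kernel.abs

theorem continuous_setIntegral_kernel {σ : ℝ} (hσ : σ ≠ 0) :
    Continuous fun x => ∫ z in {z | 0 ≤ σ * (x - z)}, kernel b b' a z := by
  obtain ⟨M, hM, hb⟩ := h.exists_setIntegral_kernel_sub_le
  refine continuous_iff_continuousAt.2 fun x => ?_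
  rw [ContinuousAt, tendsto_iff_norm_sub_tendsto_zero]
  refine squeeze_zero (fun _ => norm_nonneg _) (fun y => hb σ hσ y x) ?_
  have hc : Continuous fun y : ℝ => M * |y - x| ^ (1 / 2 : ℝ) :=
    continuous_const.mul ((by fun_prop : Continuous fun y : ℝ => |y - x|).rpow_const
      fun _ => Or.inr (by norm_num))
  have := hc.tendsto x
  simpa using this

theorem continuousAt_stepKernel {σ x : ℝ} (hσ : σ ≠ 0) (hx : x ≠ a) :
    ContinuousAt (stepKernel b b' a σ) x :=
  ((h.continuousAt_kernel hx).const_mul σ).add (h.continuous_setIntegral_kernel hσ).continuousAt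

/-- The step kernel is Hölder continuous away from `a`. -/
theorem exists_stepKernel_sub_le {δ : ℝ} (hδ : 0 < δ) : ∃ M, 0 ≤ M ∧ ∀ σ : ℝ, |σ| = 1 →
    ∀ x y, δ ≤ |x - a| → δ ≤ |y - a| →
      |stepKernel b b' a σ x - stepKernel b b' a σ y| ≤ M * |x - y| ^ (1 / 2 : ℝ) := by
  obtain ⟨M₁, hM₁, h1⟩ := h.exists_setIntegral_kernel_sub_le
  obtain ⟨M₂, hM₂, h2⟩ := exists_norm_fourier_remainder_le b b' a
  obtain ⟨M₃, hM₃, h3⟩ := h.exists_norm_fourier_remainder_sub_le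
  set D := δ⁻¹ + δ⁻¹ ^ 2 with hD
  refine ⟨M₃ * δ⁻¹ + M₂ * (2 * D) + M₁, by positivity, fun σ hσ x y hx hy => ?_⟩
  have hσ0 : σ ≠ 0 := by rintro rfl; simp at hσ
  have hxa : x - a ≠ 0 := abs_pos.1 (hδ.trans_le hx)
  have hya : y - a ≠ 0 := abs_pos.1 (hδ.trans_le hy)
  set q := |x - y| ^ (1 / 2 : ℝ) with hq
  have hq0 : 0 ≤ q := by positivity
  have hqq : q * q = |x - y| := by
    rw [hq, ← Real.rpow_add_of_nonneg (abs_nonneg _) (by norm_num) (by norm_num)]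
    norm_num
  have hix : |(x - a)⁻¹| ≤ δ⁻¹ := by rw [abs_inv]; exact inv_anti₀ hδ hx
  have hiy : |(y - a)⁻¹| ≤ δ⁻¹ := by rw [abs_inv]; exact inv_anti₀ hδ hy
  -- The reciprocal is bounded and Lipschitz at distance `δ` from `a`. With `q² = |x - y|`, the
  -- Lipschitz bound serves for `q ≤ 1` (there `q² ≤ q`) and the trivial bound for `q ≥ 1`.
  have hinv : |(x - a)⁻¹ - (y - a)⁻¹| ≤ 2 * D * q := by
    rcases le_total q 1 with hq1 | hq1
    · have e : (x - a)⁻¹ - (y - a)⁻¹ = (x - a)⁻¹ * (y - a)⁻¹ * (y - x) := by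
        field_simp
        ring
      rw [e, abs_mul, abs_mul, abs_sub_comm y x, ← hqq]
      have hqq' : q * q ≤ q := by nlinarith
      have hd : 0 < δ⁻¹ := by positivity
      calc |(x - a)⁻¹| * |(y - a)⁻¹| * (q * q) ≤ δ⁻¹ * δ⁻¹ * q := by gcongr
        _ ≤ 2 * D * q := by
          refine mul_le_mul_of_nonneg_right ?_ hq0
          rw [hD]
          nlinarith
    · calc _ ≤ |(x - a)⁻¹| + |(y - a)⁻¹| := abs_sub _ _
        _ ≤ δ⁻¹ + δ⁻¹ := by gcongr
        _ ≤ 2 * D * 1 := by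
          have : 0 ≤ δ⁻¹ ^ 2 := by positivity
          rw [hD]
          linarith
        _ ≤ 2 * D * q := by gcongr
  have hker : |kernel b b' a x - kernel b b' a y| ≤ (M₃ * δ⁻¹ + M₂ * (2 * D)) * q := by
    have e : kernel b b' a x - kernel b b' a y
        = ((𝓕 (remainder b b' a) x).re - (𝓕 (remainder b b' a) y).re) * (x - a)⁻¹
          + (𝓕 (remainder b b' a) y).re * ((x - a)⁻¹ - (y - a)⁻¹) := by
      simp only [kernel, div_eq_mul_inv]
      ring
    have r1 : |(𝓕 (remainder b b' a) x).re - (𝓕 (remainder b b' a) y).re| ≤ M₃ * q := by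
      rw [← Complex.sub_re]
      exact (Complex.abs_re_le_norm _).trans (h3 x y)
    have r2 : |(𝓕 (remainder b b' a) y).re| ≤ M₂ := (Complex.abs_re_le_norm _).trans (h2 y)
    rw [e]
    calc _ ≤ |(𝓕 (remainder b b' a) x).re - (𝓕 (remainder b b' a) y).re| * |(x - a)⁻¹|
          + |(𝓕 (remainder b b' a) y).re| * |(x - a)⁻¹ - (y - a)⁻¹| := by
          rw [← abs_mul, ← abs_mul]
          exact abs_add_le _ _
      _ ≤ M₃ * q * δ⁻¹ + M₂ * (2 * D * q) := by gcongr
      _ = _ := by ring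
  calc _ = |σ * (kernel b b' a x - kernel b b' a y)
        + ((∫ z in {z | 0 ≤ σ * (x - z)}, kernel b b' a z)
          - ∫ z in {z | 0 ≤ σ * (y - z)}, kernel b b' a z)| := by
        simp only [stepKernel]
        ring_nf
    _ ≤ |σ| * |kernel b b' a x - kernel b b' a y| + M₁ * q := by
        rw [← abs_mul]
        exact (abs_add_le _ _).trans (by gcongr; exact h1 σ hσ0 x y)
    _ ≤ 1 * ((M₃ * δ⁻¹ + M₂ * (2 * D)) * q) + M₁ * q := by
        rw [hσ]
        gcongr
    _ = _ := by ring

/-- The step kernel decays on the side where it has no jump. -/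
theorem exists_stepKernel_le {δ : ℝ} (hδ : 0 < δ) : ∃ M, 0 ≤ M ∧ ∀ σ : ℝ, |σ| = 1 →
    ∀ x, δ ≤ |x - a| → σ * (x - a) ≤ 0 →
      |stepKernel b b' a σ x| ≤ M * |x - a| ^ (-(1 / 4) : ℝ) := by
  obtain ⟨M₂, hM₂, h2⟩ := exists_norm_fourier_remainder_le b b' a
  set J := ∫ z, (1 + |z - a|) ^ (1 / 4 : ℝ) * |kernel b b' a z|
  have hJ : 0 ≤ J := integral_nonneg fun z => by positivity
  refine ⟨M₂ * δ ^ (-(3 / 4) : ℝ) + J, by positivity, fun σ hσ x hx hs => ?_⟩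
  have hp : 0 < |x - a| := hδ.trans_le hx
  have hk : |kernel b b' a x| ≤ M₂ * δ ^ (-(3 / 4) : ℝ) * |x - a| ^ (-(1 / 4) : ℝ) := by
    rw [kernel, abs_div, div_eq_mul_inv, mul_assoc]
    have r2 : |(𝓕 (remainder b b' a) x).re| ≤ M₂ := (Complex.abs_re_le_norm _).trans (h2 x)
    have : |x - a|⁻¹ = |x - a| ^ (-(3 / 4) : ℝ) * |x - a| ^ (-(1 / 4) : ℝ) := by
      rw [← Real.rpow_add hp, ← Real.rpow_neg_one]
      norm_num
    rw [this]
    gcongr ?_ * (?_ * _)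
    exact Real.rpow_le_rpow_of_nonpos hδ hx (by norm_num)
  have hm : MeasurableSet {z | 0 ≤ σ * (x - z)} :=
    measurableSet_le measurable_const (by fun_prop)
  have ht : |∫ z in {z | 0 ≤ σ * (x - z)}, kernel b b' a z| ≤ J * |x - a| ^ (-(1 / 4) : ℝ) := by
    rw [← integral_indicator hm, mul_comm, ← integral_const_mul, ← Real.norm_eq_abs]
    refine norm_integral_le_of_norm_le (h.integrable_rpow_mul_kernel.const_mul _)
      (ae_of_all _ fun z => ?_)
    by_cases hz : z ∈ {z | 0 ≤ σ * (x - z)}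
    · rw [Set.indicator_of_mem hz, Real.norm_eq_abs, ← mul_assoc]
      apply le_mul_of_one_le_left (abs_nonneg _)
      have hz' : 0 ≤ σ * (x - z) := hz
      -- Since `σ(x - a) ≤ 0`, the half-line of integration points away from `a`: each of its points
      -- is at least as far from `a` as `x`. The quarter moment of the kernel therefore controls the
      -- tail.
      have hle : |x - a| ≤ 1 + |z - a| := by
        have hs2 : σ = 1 ∨ σ = -1 := eq_or_eq_neg_of_abs_eq hσ
        rcases hs2 with rfl | rfl
        · rw [abs_of_nonpos (by linarith), abs_of_nonpos (by linarith)]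
          linarith
        · rw [abs_of_nonneg (by linarith), abs_of_nonneg (by linarith)]
          linarith
      rw [Real.rpow_neg hp.le, inv_mul_eq_div, one_le_div (by positivity)]
      gcongr
    · rw [Set.indicator_of_notMem hz, norm_zero]
      positivity
  calc _ ≤ |σ| * |kernel b b' a x| + |∫ z in {z | 0 ≤ σ * (x - z)}, kernel b b' a z| := by
        rw [← abs_mul]
        exact abs_add_le _ _
    _ ≤ 1 * (M₂ * δ ^ (-(3 / 4) : ℝ) * |x - a| ^ (-(1 / 4) : ℝ))
        + J * |x - a| ^ (-(1 / 4) : ℝ) := by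
        rw [hσ]
        gcongr
    _ = _ := by ring

end IsDeconvSymbol

end LevyDonsker
end

noncomputable section

namespace LevyDonsker
open scoped SchwartzMap ENNReal ContDiff ComplexConjugate

/-! ### The functions `g_t` and their Fourier transforms -/

/-- With `σ` the sign of `t`, the two half-lines become one formula, so that every later argument
treats both cases at once. -/
theorem gFun_eq_indicator {t σ : ℝ} (hσ : |σ| = 1) (ht : 0 < σ * t) :
    gFun t = {x | 0 ≤ σ * (x - t)}.indicator (fun x => ((x⁻¹ : ℝ) : ℂ)) := by
  rcases eq_or_eq_neg_of_abs_eq hσ with rfl | rfl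
  · rw [gFun, if_neg (by linarith)]
    congr 1
    ext x
    simp
  · rw [gFun, if_pos (by linarith)]
    congr 1
    ext x
    simp

theorem measurableSet_side (σ t : ℝ) : MeasurableSet {x : ℝ | 0 ≤ σ * (x - t)} :=
  measurableSet_le measurable_const (by fun_prop)

theorem abs_le_of_mem_side {t σ x : ℝ} (hσ : |σ| = 1) (ht : 0 < σ * t)
    (hx : 0 ≤ σ * (x - t)) : |t| ≤ |x| := by
  rcases eq_or_eq_neg_of_abs_eq hσ with rfl | rfl
  · rw [abs_of_pos (by linarith), abs_of_pos (by linarith)]; linarith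
  · rw [abs_of_neg (by linarith), abs_of_neg (by linarith)]; linarith

theorem abs_inv_le {t x : ℝ} (ht : t ≠ 0) (hx : |t| ≤ |x|) :
    |x|⁻¹ ≤ (1 + |t|⁻¹) * (1 + |x|)⁻¹ := by
  have h0 : 0 < |t| := abs_pos.2 ht
  have h1 : 0 < |x| := h0.trans_le hx
  have h2 : |x|⁻¹ ≤ |t|⁻¹ := inv_anti₀ h0 hx
  rw [← div_eq_mul_inv, le_div_iff₀ (by positivity), mul_add, inv_mul_cancel₀ h1.ne']
  linarith

theorem memLp_gFun {t σ : ℝ} (hσ : |σ| = 1) (ht : 0 < σ * t) : MemLp (gFun t) 2 volume := by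
  have ht0 : t ≠ 0 := by rintro rfl; simp at ht
  rw [gFun_eq_indicator hσ ht]
  refine ((memLp_one_add_abs_rpow (s := -1) (by norm_num)).const_mul (1 + |t|⁻¹)).mono' ?_
    (ae_of_all _ fun x => ?_)
  · exact ((Complex.measurable_ofReal.comp measurable_inv).indicator
      (measurableSet_side σ t)).aestronglyMeasurable
  · by_cases hx : x ∈ {x | 0 ≤ σ * (x - t)}
    · rw [Set.indicator_of_mem hx, Complex.norm_real, Real.norm_eq_abs, abs_inv, Real.rpow_neg_one]
      exact abs_inv_le ht0 (abs_le_of_mem_side hσ ht hx)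
    · rw [Set.indicator_of_notMem hx, norm_zero]
      positivity

theorem integrable_sq_inv_side {t σ : ℝ} (hσ : |σ| = 1) (ht : 0 < σ * t) :
    Integrable ({x | 0 ≤ σ * (x - t)}.indicator (fun x : ℝ => (((x ^ 2)⁻¹ : ℝ) : ℂ))) := by
  have := (memLp_two_iff_integrable_sq_norm (memLp_gFun hσ ht).1).1 (memLp_gFun hσ ht)
  rw [← integrable_norm_iff]
  · refine this.congr (ae_of_all _ fun x => ?_)
    rw [gFun_eq_indicator hσ ht]
    simp only [Set.indicator_apply]
    split_ifs <;> simp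
  · exact ((Complex.measurable_ofReal.comp (by fun_prop)).indicator
      (measurableSet_side σ t)).aestronglyMeasurable

/-- Fundamental theorem of calculus on the half-line starting at `t`; the orientation of the single
boundary point gives the sign `-σ`. -/
theorem setIntegral_side_deriv {t σ : ℝ} (hσ : |σ| = 1) {f f' : ℝ → ℂ}
    (hd : ∀ x, 0 ≤ σ * (x - t) → HasDerivAt f (f' x) x)
    (hi : IntegrableOn f' {x | 0 ≤ σ * (x - t)})
    (h0 : Tendsto f atTop (𝓝 0)) (h1 : Tendsto f atBot (𝓝 0)) :
    ∫ x in {x | 0 ≤ σ * (x - t)}, f' x = -σ * f t := by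
  rcases eq_or_eq_neg_of_abs_eq hσ with rfl | rfl
  · have e : {x : ℝ | 0 ≤ 1 * (x - t)} = Set.Ici t := by ext; simp
    rw [e] at hi ⊢
    rw [integral_Ici_eq_integral_Ioi, integral_Ioi_of_hasDerivAt_of_tendsto'
      (fun x hx => hd x (by simpa using hx)) (hi.mono_set Set.Ioi_subset_Ici_self) h0]
    simp
  · have e : {x : ℝ | 0 ≤ -1 * (x - t)} = Set.Iic t := by ext; simp
    rw [e] at hi ⊢
    rw [integral_Iic_of_hasDerivAt_of_tendsto'
      (fun x hx => hd x (by simpa using hx)) hi h1]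
    simp

theorem tendsto_schwartz_atTop (η : 𝓢(ℝ, ℂ)) : Tendsto η atTop (𝓝 0) :=
  (zero_at_infty η).mono_left (by rw [cocompact_eq_atBot_atTop]; exact le_sup_right)

theorem tendsto_schwartz_atBot (η : 𝓢(ℝ, ℂ)) : Tendsto η atBot (𝓝 0) :=
  (zero_at_infty η).mono_left (by rw [cocompact_eq_atBot_atTop]; exact le_sup_left)

theorem hasDerivAt_fourierInv_schwartz (η : 𝓢(ℝ, ℂ)) (x : ℝ) :
    HasDerivAt (𝓕⁻ (η : ℝ → ℂ)) (2 * Real.pi * Complex.I * 𝓕⁻ (mulX η : ℝ → ℂ) x) x := by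
  have h := (hasDerivAt_fourier_schwartz η (-x)).scomp x (hasDerivAt_neg x)
  have e : 𝓕⁻ (η : ℝ → ℂ) = 𝓕 (η : ℝ → ℂ) ∘ Neg.neg := by
    ext x
    exact Real.fourierInv_eq_fourier_neg _ x
  rw [e, Real.fourierInv_eq_fourier_neg]
  refine h.congr_deriv ?_
  simp

/-- `|F g_t(u)| ≤ C / |u|`. -/
theorem exists_norm_fourierInv_gFun_le {t σ : ℝ} (hσ : |σ| = 1) (ht : 0 < σ * t) :
    ∃ C, 0 ≤ C ∧ ∀ᵐ v : ℝ, |v| *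
      ‖(𝓕⁻ ((memLp_gFun hσ ht).toLp _) : Lp ℂ 2 (volume : Measure ℝ)) v‖ ≤ C := by
  have ht0 : t ≠ 0 := by rintro rfl; simp at ht
  set A := {x : ℝ | 0 ≤ σ * (x - t)} with hA
  have hAm : MeasurableSet A := measurableSet_side σ t
  set q : ℝ → ℂ := A.indicator (fun x : ℝ => (((x ^ 2)⁻¹ : ℝ) : ℂ)) with hq
  have hqi : Integrable q := integrable_sq_inv_side hσ ht
  set G := (memLp_gFun hσ ht).toLp _
  have hqc : Continuous (𝓕⁻ q) := by
    have := (VectorFourier.fourierIntegral_continuous Real.continuous_fourierChar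
      (L := innerₗ ℝ) (by exact continuous_inner) hqi)
    have e : 𝓕⁻ q = fun x => 𝓕 q (-x) := by ext x; exact Real.fourierInv_eq_fourier_neg q x
    rw [e]; exact this.comp continuous_neg
  -- Distributional form of integration by parts: multiplying the transform by `2πiv` differentiates
  -- `g_t`, whose derivative is a point mass `σ/t` at `t` minus `x⁻²` on the half-line. Both have
  -- bounded transforms.
  have key : (fun v : ℝ => (2 * Real.pi * Complex.I * v : ℂ) *
      (𝓕⁻ G : Lp ℂ 2 (volume : Measure ℝ)) v) =ᵐ[volume] fun v : ℝ =>
        -(σ * t⁻¹) * Complex.exp (↑(2 * Real.pi * v * t) * Complex.I) + 𝓕⁻ q v := by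
    apply ae_eq_of_forall_schwartz
    · exact ((Lp.memLp (𝓕⁻ G : Lp ℂ 2 (volume : Measure ℝ))).locallyIntegrable
        (by norm_num)).continuous_smul (g := fun x : ℝ => (2 * Real.pi * Complex.I * x : ℂ))
        (by fun_prop)
    · exact (by fun_prop : Continuous _).locallyIntegrable
    · intro η _
      set θ : 𝓢(ℝ, ℂ) := 𝓕⁻ η with hθ
      have hθc : (θ : ℝ → ℂ) = 𝓕⁻ (η : ℝ → ℂ) := SchwartzMap.fourierInv_coe η
      set θ' : 𝓢(ℝ, ℂ) := 𝓕⁻ (mulX η) with hθ'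
      have hθc' : (θ' : ℝ → ℂ) = 𝓕⁻ (mulX η : ℝ → ℂ) := SchwartzMap.fourierInv_coe _
      have e1 : ∫ v : ℝ, η v * ((2 * Real.pi * Complex.I * v : ℂ) *
          (𝓕⁻ G : Lp ℂ 2 (volume : Measure ℝ)) v)
          = ∫ x in A, ((x⁻¹ : ℝ) : ℂ) * (2 * Real.pi * Complex.I * θ' x) := by
        calc _ = (2 * Real.pi * Complex.I) *
              ∫ v : ℝ, mulX η v * (𝓕⁻ G : Lp ℂ 2 (volume : Measure ℝ)) v := by
              rw [← integral_const_mul]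
              congr 1
              ext v
              simp
              ring
          _ = (2 * Real.pi * Complex.I) * ∫ x, θ' x * gFun t x := by
              rw [integral_mul_fourierInv_lp, hθc']
              congr 1
              apply integral_congr_ae
              filter_upwards [(memLp_gFun hσ ht).coeFn_toLp] with x hx
              rw [hx]
          _ = _ := by
              rw [← integral_const_mul, ← integral_indicator hAm]
              congr 1
              ext x
              rw [gFun_eq_indicator hσ ht]
              by_cases hx : x ∈ A
              · rw [Set.indicator_of_mem hx, Set.indicator_of_mem hx]
                ring
              · rw [Set.indicator_of_notMem hx, Set.indicator_of_notMem hx]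
                ring
      have hbig : ∀ x ∈ A, x ≠ 0 := fun x hx h0 => by
        have := abs_le_of_mem_side hσ ht hx
        rw [h0, abs_zero] at this
        exact ht0 (abs_nonpos_iff.1 this)
      have i1 : Integrable fun x : ℝ => gFun t x * (2 * Real.pi * Complex.I * θ' x) :=
        (memLp_gFun hσ ht).integrable_mul ((θ'.memLp 2 volume).const_mul (2 * Real.pi * Complex.I))
      have i2 : Integrable fun x : ℝ => q x * θ x := by
        refine hqi.mul_bdd (c := SchwartzMap.seminorm ℝ 0 0 θ) θ.continuous.aestronglyMeasurable
          (ae_of_all _ fun x => ?_)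
        exact θ.norm_le_seminorm ℝ x
      have i1' : IntegrableOn (fun x : ℝ => ((x⁻¹ : ℝ) : ℂ) * (2 * Real.pi * Complex.I * θ' x)) A := by
        rw [← integrable_indicator_iff hAm]
        refine i1.congr (ae_of_all _ fun x => ?_)
        rw [gFun_eq_indicator hσ ht, Set.indicator_mul_left]
      have i2' : IntegrableOn (fun x : ℝ => (((x ^ 2)⁻¹ : ℝ) : ℂ) * θ x) A := by
        rw [← integrable_indicator_iff hAm]
        refine i2.congr (ae_of_all _ fun x => ?_)
        rw [hq, Set.indicator_mul_left]
      have e2 : ∫ x in A, (((x⁻¹ : ℝ) : ℂ) * (2 * Real.pi * Complex.I * θ' x)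
          - (((x ^ 2)⁻¹ : ℝ) : ℂ) * θ x) = -σ * (((t⁻¹ : ℝ) : ℂ) * θ t) := by
        have tz : ∀ l : Filter ℝ, Tendsto θ l (𝓝 0) → Tendsto (fun x : ℝ => x⁻¹) l (𝓝 0) →
            Tendsto (fun x : ℝ => ((x⁻¹ : ℝ) : ℂ) * θ x) l (𝓝 0) := fun l h1 h2 => by
          have := ((Complex.continuous_ofReal.tendsto 0).comp h2).mul h1
          simpa using this
        refine setIntegral_side_deriv hσ (f := fun x : ℝ => ((x⁻¹ : ℝ) : ℂ) * θ x)
          (fun x hx => ?_) (i1'.sub i2')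
          (tz _ (tendsto_schwartz_atTop θ) tendsto_inv_atTop_zero)
          (tz _ (tendsto_schwartz_atBot θ) tendsto_inv_atBot_zero)
        have d1 : HasDerivAt (fun x : ℝ => ((x⁻¹ : ℝ) : ℂ)) ((-(x ^ 2)⁻¹ : ℝ) : ℂ) x :=
          (hasDerivAt_inv (hbig x hx)).ofReal_comp
        have d2 : HasDerivAt θ (2 * Real.pi * Complex.I * θ' x) x := by
          rw [hθc, hθc']
          exact hasDerivAt_fourierInv_schwartz η x
        refine (d1.mul d2).congr_deriv ?_
        push_cast
        ring
      rw [integral_sub i1' i2', sub_eq_iff_eq_add] at e2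
      have e3 : ∫ x in A, (((x ^ 2)⁻¹ : ℝ) : ℂ) * θ x = ∫ v, η v * 𝓕⁻ q v := by
        rw [← integral_fourierInv_mul_flip η.integrable hqi, ← integral_indicator hAm, ← hθc]
        congr 1
        ext x
        rw [hq, Set.indicator_mul_left, mul_comm]
      have e4 : θ t = ∫ v : ℝ, η v * Complex.exp (↑(2 * Real.pi * v * t) * Complex.I) := by
        rw [hθc, Real.fourierInv_eq']
        congr 1
        ext v
        simp [mul_comm, mul_assoc]
      have i3 : Integrable fun v : ℝ => η v * Complex.exp (↑(2 * Real.pi * v * t) * Complex.I) := by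
        refine η.integrable.mul_bdd (c := 1) (by fun_prop) (ae_of_all _ fun v => ?_)
        rw [Complex.norm_exp_ofReal_mul_I]
      have i4 : Integrable fun v : ℝ => η v * 𝓕⁻ q v := by
        refine η.integrable.mul_bdd (c := ∫ v, ‖q v‖) hqc.aestronglyMeasurable
          (ae_of_all _ fun v => ?_)
        rw [Real.fourierInv_eq_fourier_neg]
        exact VectorFourier.norm_fourierIntegral_le_integral_norm _ _ _ _ _
      rw [e1, e2, e3, e4]
      simp only [mul_add]
      rw [integral_add _ i4]
      · congr 1
        rw [← integral_const_mul, ← integral_const_mul]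
        congr 1
        ext v
        push_cast
        ring
      · refine (i3.const_mul (-(σ * t⁻¹) : ℂ)).congr (ae_of_all _ fun v => ?_)
        simp only
        ring
  refine ⟨|t|⁻¹ + ∫ v, ‖q v‖, by positivity, ?_⟩
  filter_upwards [key] with v hv
  have h1 : |v| * ‖(𝓕⁻ G : Lp ℂ 2 (volume : Measure ℝ)) v‖
      ≤ ‖(2 * Real.pi * Complex.I * v : ℂ) * (𝓕⁻ G : Lp ℂ 2 (volume : Measure ℝ)) v‖ := by
    rw [norm_mul]
    gcongr
    simp only [norm_mul, Complex.norm_I, Complex.norm_real, Real.norm_eq_abs,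
      abs_of_pos Real.pi_pos, Complex.norm_ofNat, mul_one]
    have := Real.pi_gt_three
    nlinarith [abs_nonneg v]
  refine h1.trans ?_
  rw [hv]
  refine (norm_add_le _ _).trans (add_le_add ?_ ?_)
  · rw [norm_mul, Complex.norm_exp_ofReal_mul_I]
    simp [hσ]
  · rw [Real.fourierInv_eq_fourier_neg]
    exact VectorFourier.norm_fourierIntegral_le_integral_norm _ _ _ _ _

end LevyDonsker
end

noncomputable section

namespace LevyDonsker
open scoped SchwartzMap ENNReal ContDiff ComplexConjugate

/-! ### The class of `h_t` -/

theorem setIntegral_integral_comp_add_mul {θ w : ℝ → ℂ} (hθ : Integrable θ) (hθm : Measurable θ)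
    (hw : Integrable w) (hwm : Measurable w) (A : Set ℝ) :
    ∫ x in A, ∫ z, θ (z + x) * w z = ∫ z, (∫ x in A, θ (z + x)) * w z := by
  have hi : Integrable (Function.uncurry fun x z : ℝ => θ (z + x) * w z)
      ((volume.restrict A).prod volume) := by
    have h1 : Integrable (Function.uncurry fun x z : ℝ => θ (z + x) * w z)
        (volume.prod volume) := by
      rw [integrable_prod_iff']
      · refine ⟨ae_of_all _ fun z => (hθ.comp_add_left z).mul_const (w z), ?_⟩
        simp only [Function.uncurry, norm_mul, integral_mul_const]
        have : ∀ z, ∫ x, ‖θ (z + x)‖ = ∫ x, ‖θ x‖ := fun z =>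
          integral_add_left_eq_self (fun x => ‖θ x‖) z
        simp only [this]
        exact hw.norm.const_mul _
      · refine Measurable.aestronglyMeasurable ?_
        exact (hθm.comp (measurable_snd.add measurable_fst)).mul (hwm.comp measurable_snd)
    exact h1.mono_measure (Measure.prod_mono Measure.restrict_le_self le_rfl)
  rw [integral_integral_swap hi]
  simp only [integral_mul_const]

/-- Fubini with `y = z + x`, which moves the half-line from the test function onto the kernel. -/
theorem integral_setIntegral_comp_add_mul {θ w : ℝ → ℂ} (hθ : Integrable θ)
    (hw : Integrable w) {A : Set ℝ} (hA : MeasurableSet A) :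
    ∫ z, (∫ x in A, θ (z + x)) * w z = ∫ y, θ y * ∫ z in {z | y - z ∈ A}, w z := by
  have hi : Integrable (Function.uncurry fun z y : ℝ =>
      {p : ℝ × ℝ | p.2 - p.1 ∈ A}.indicator (fun p => θ p.2 * w p.1) (z, y))
      (volume.prod volume) := by
    have h1 : Integrable (fun p : ℝ × ℝ => θ p.2 * w p.1) (volume.prod volume) := by
      refine (hw.mul_prod hθ).congr (ae_of_all _ fun p => ?_)
      simp [mul_comm]
    exact h1.indicator (hA.preimage (measurable_snd.sub measurable_fst))
  have e1 : ∀ z, (∫ x in A, θ (z + x)) * w z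
      = ∫ y, {p : ℝ × ℝ | p.2 - p.1 ∈ A}.indicator (fun p => θ p.2 * w p.1) (z, y) := by
    intro z
    rw [← integral_mul_const, ← integral_indicator hA, ← integral_add_left_eq_self
      (fun y => {p : ℝ × ℝ | p.2 - p.1 ∈ A}.indicator (fun p => θ p.2 * w p.1) (z, y)) z]
    congr 1
    ext x
    by_cases hx : x ∈ A
    · rw [Set.indicator_of_mem hx, Set.indicator_of_mem (by simpa using hx)]
    · rw [Set.indicator_of_notMem hx, Set.indicator_of_notMem (by simpa using hx)]
  simp only [e1]
  rw [integral_integral_swap hi]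
  congr 1
  ext y
  have hm : MeasurableSet {z | y - z ∈ A} :=
    hA.preimage (by fun_prop : Measurable fun z => y - z)
  rw [← integral_const_mul, ← integral_indicator hm]
  rfl

theorem setIntegral_side_comp_add_deriv {t σ : ℝ} (hσ : |σ| = 1) (η : 𝓢(ℝ, ℂ)) (z : ℝ) :
    ∫ x in {x | 0 ≤ σ * (x - t)}, deriv η (z + x) = -σ * η (z + t) := by
  have ha : Tendsto (fun x => η (z + x)) atTop (𝓝 0) :=
    (tendsto_schwartz_atTop η).comp (tendsto_atTop_add_const_left _ _ tendsto_id)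
  have hb : Tendsto (fun x => η (z + x)) atBot (𝓝 0) :=
    (tendsto_schwartz_atBot η).comp (tendsto_atBot_add_const_left _ _ tendsto_id)
  refine setIntegral_side_deriv hσ (f := fun x => η (z + x)) (fun x _ => ?_) ?_ ha hb
  · have := (η.differentiable (z + x)).hasDerivAt.comp_const_add z x
    exact this
  · have : Integrable (deriv η) := (SchwartzMap.derivCLM ℂ ℂ η).integrable
    exact (this.comp_add_left z).integrableOn

namespace IsDeconvSymbol

variable {b b' : ℝ → ℂ} {a ε : ℝ} (h : IsDeconvSymbol b b' a ε)
include h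

/-- `(1 + |v|)⁻¹ b` is square integrable, and the compensating factor `(1 + |v|) ξ` is both square
integrable and bounded; this gives `L¹` and `L²` respectively. -/
theorem memLp_mul_schwartz {c : ℝ → ℂ} (hc : Continuous c) {C : ℝ}
    (hC : ∀ v, ‖c v‖ ≤ C * ‖b v‖) (ξ : 𝓢(ℝ, ℂ)) :
    Integrable (fun v => c v * ξ v) ∧ MemLp (fun v => c v * ξ v) 2 volume := by
  have h1 : MemLp (fun v : ℝ => ‖ξ v‖ + ‖mulX ξ v‖) 2 volume :=
    (ξ.memLp 2 volume).norm.add ((mulX ξ).memLp 2 volume).norm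
  have hb := h.memLp_inv_mul.const_mul C
  have hle : ∀ v, ‖c v * ξ v‖ ≤ C * ((1 + |v|)⁻¹ * ‖b v‖) * (‖ξ v‖ + ‖mulX ξ v‖) := fun v => by
    have e : ‖ξ v‖ + ‖mulX ξ v‖ = (1 + |v|) * ‖ξ v‖ := by
      simp
      ring
    have hp : (1 + |v|) ≠ 0 := by positivity
    rw [norm_mul, e]
    calc ‖c v‖ * ‖ξ v‖ ≤ C * ‖b v‖ * ‖ξ v‖ := by gcongr; exact hC v
      _ = _ := by field_simp
  refine ⟨(hb.integrable_mul h1).mono' (hc.mul ξ.continuous).aestronglyMeasurable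
    (ae_of_all _ hle), ?_⟩
  refine (hb.mul_const (SchwartzMap.seminorm ℝ 0 0 ξ + SchwartzMap.seminorm ℝ 0 0 (mulX ξ))).mono'
    (hc.mul ξ.continuous).aestronglyMeasurable (ae_of_all _ fun v => (hle v).trans ?_)
  have h0 : 0 ≤ C * ((1 + |v|)⁻¹ * ‖b v‖) := by
    have : 0 ≤ C * ‖b v‖ := (norm_nonneg _).trans (hC v)
    have : 0 ≤ (1 + |v|)⁻¹ * (C * ‖b v‖) := by positivity
    linarith
  gcongr
  · exact ξ.norm_le_seminorm ℝ v
  · exact (mulX ξ).norm_le_seminorm ℝ v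

/-- For `|v| ≥ 1` the decay `C/|v|` of the transform of `g_t` supplies the missing factor `(1 +
|v|)⁻¹`. For `|v| ≤ 1` the multiplier is bounded and the transform itself is in `L²`. -/
theorem memLp_mul_fourierInv_gFun {c : ℝ → ℂ} (hc : Continuous c) {K : ℝ}
    (hK : ∀ v, ‖c v‖ ≤ K * ‖b v‖) {t σ : ℝ} (hσ : |σ| = 1) (ht : 0 < σ * t) :
    MemLp (fun v => c v * (𝓕⁻ ((memLp_gFun hσ ht).toLp _) : Lp ℂ 2 (volume : Measure ℝ)) v)
      2 volume := by
  set F := (𝓕⁻ ((memLp_gFun hσ ht).toLp _) : Lp ℂ 2 (volume : Measure ℝ)) with hF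
  obtain ⟨C, hC0, hC⟩ := exists_norm_fourierInv_gFun_le hσ ht
  obtain ⟨B, hB⟩ := (isCompact_Icc (a := (-1 : ℝ)) (b := 1)).exists_bound_of_continuousOn
    hc.continuousOn
  have hB0 : 0 ≤ B := (norm_nonneg _).trans (hB 0 (by simp))
  refine ((h.memLp_inv_mul.const_mul (2 * C * |K|)).add
    ((Lp.memLp F).norm.const_mul B)).mono'
    (hc.aestronglyMeasurable.mul (Lp.aestronglyMeasurable F)) ?_
  filter_upwards [hC] with v hv
  simp only [Pi.add_apply]
  rw [norm_mul]
  rcases le_total |v| 1 with h1 | h1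
  · have : ‖c v‖ ≤ B := hB v (abs_le.1 h1)
    have h2 : 0 ≤ 2 * C * |K| * ((1 + |v|)⁻¹ * ‖b v‖) := by positivity
    have : ‖c v‖ * ‖F v‖ ≤ B * ‖F v‖ := by gcongr
    linarith
  · have h2 : 0 ≤ B * ‖F v‖ := by positivity
    have h3 : ‖F v‖ ≤ 2 * C * (1 + |v|)⁻¹ := by
      rw [← div_eq_mul_inv, le_div_iff₀ (by positivity)]
      have := norm_nonneg (F v)
      nlinarith
    have h4 : ‖c v‖ ≤ |K| * ‖b v‖ := (hK v).trans (by gcongr; exact le_abs_self K)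
    calc _ ≤ (|K| * ‖b v‖) * (2 * C * (1 + |v|)⁻¹) := by gcongr
      _ = 2 * C * |K| * ((1 + |v|)⁻¹ * ‖b v‖) := by ring
      _ ≤ _ := by linarith

/-- `F⁻¹` of the product of the symbol with a transformed test function. -/
theorem fourierInv_mul_fourier (η : 𝓢(ℝ, ℂ)) (x : ℝ) :
    𝓕⁻ (fun v => b v * 𝓕 (η : ℝ → ℂ) v) x
      = ∫ z, (η (z + x) - deriv η (z + x)) * kernel b b' a z := by
  set η' : 𝓢(ℝ, ℂ) := SchwartzMap.derivCLM ℂ ℂ η with hη'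
  have hder : 𝓕 (η' : ℝ → ℂ) = fun v : ℝ => (2 * Real.pi * Complex.I * v) • 𝓕 (η : ℝ → ℂ) v :=
    Real.fourier_deriv η.integrable η.differentiable η'.integrable
  have hsub : 𝓕 ((η - η' : 𝓢(ℝ, ℂ)) : ℝ → ℂ)
      = fun v => 𝓕 (η : ℝ → ℂ) v - 𝓕 (η' : ℝ → ℂ) v := by
    rw [← SchwartzMap.fourier_coe, ← SchwartzMap.fourier_coe, ← SchwartzMap.fourier_coe]
    have := (FourierTransform.fourierCLM ℂ 𝓢(ℝ, ℂ)).map_sub η η'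
    exact congrArg DFunLike.coe this
  -- Write `b = (1 - 2πiv) · smoothed b`; the first factor turns `𝓕 η` into the transform of `η -
  -- η'`, and the second is moved to the kernel by duality.
  calc 𝓕⁻ (fun v => b v * 𝓕 (η : ℝ → ℂ) v) x
      = ∫ v, 𝓕 (translate x (η - η') : ℝ → ℂ) v * smoothed b v := by
        rw [Real.fourierInv_eq']
        congr 1
        ext v
        rw [fourier_translate]
        simp only [hsub, hder, smoothed, smul_eq_mul]
        have e : Complex.exp (↑(2 * Real.pi * inner ℝ v x) * Complex.I)
            = Complex.exp (2 * Real.pi * Complex.I * x * v) := by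
          congr 1
          simp
          ring
        rw [e]
        field_simp [one_sub_ne_zero v]
    _ = ∫ v, 𝓕 (translate x (η - η') : ℝ → ℂ) v * h.memLp_smoothed.toLp _ v := by
        apply integral_congr_ae
        filter_upwards [h.memLp_smoothed.coeFn_toLp] with v hv
        rw [hv]
    _ = ∫ z, translate x (η - η') z *
          (𝓕 (h.memLp_smoothed.toLp _) : Lp ℂ 2 (volume : Measure ℝ)) z :=
        (integral_mul_fourier_lp _ _).symm
    _ = _ := by
        apply integral_congr_ae
        filter_upwards [h.kernel_ae_eq] with z hz
        rw [← hz, translate_apply]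
        rfl

/-- Integrating `η - η'` over the half-line produces a boundary value, giving the term `σ w`, and an
integral of `η`, giving the integrated kernel after Fubini. This is the origin of the two terms of
`stepKernel`. -/
theorem integral_stepKernel_mul {t σ : ℝ} (hσ : |σ| = 1) (η : 𝓢(ℝ, ℂ)) :
    ∫ x in {x | 0 ≤ σ * (x - t)}, 𝓕⁻ (fun v => b v * 𝓕 (η : ℝ → ℂ) v) x
      = ∫ y, η y * stepKernel b b' a σ (y - t) := by
  set A := {x : ℝ | 0 ≤ σ * (x - t)} with hA
  have hAm : MeasurableSet A := measurableSet_side σ t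
  set η' : 𝓢(ℝ, ℂ) := SchwartzMap.derivCLM ℂ ℂ η with hη'
  set w : ℝ → ℂ := fun z => (kernel b b' a z : ℂ) with hw
  have hwi : Integrable w := h.integrable_kernel.ofReal
  have hwm : Measurable w := Complex.measurable_ofReal.comp h.measurable_kernel
  have e0 : ∀ x, 𝓕⁻ (fun v => b v * 𝓕 (η : ℝ → ℂ) v) x = ∫ z, (η - η') (z + x) * w z :=
    fun x => h.fourierInv_mul_fourier η x
  simp only [e0]
  rw [setIntegral_integral_comp_add_mul (η - η').integrable (η - η').continuous.measurable
    hwi hwm A]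
  have e1 : ∀ z, ∫ x in A, (η - η') (z + x) = σ * η (z + t) + ∫ x in A, η (z + x) := fun z => by
    have i1 := (η.integrable (μ := volume).comp_add_left z).integrableOn (s := A)
    have i2 := (η'.integrable (μ := volume).comp_add_left z).integrableOn (s := A)
    have := setIntegral_side_comp_add_deriv (t := t) hσ η z
    calc _ = (∫ x in A, η (z + x)) - ∫ x in A, η' (z + x) := integral_sub i1 i2
      _ = _ := by
        rw [show (∫ x in A, η' (z + x)) = _ from this]
        ring
  have i3 : Integrable fun z => σ * η (z + t) * w z := by
    have := ((hwi.mul_bdd (c := SchwartzMap.seminorm ℝ 0 0 (translate t η))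
      (translate t η).continuous.aestronglyMeasurable
      (ae_of_all _ fun x => (translate t η).norm_le_seminorm ℝ x))).const_mul (σ : ℂ)
    refine this.congr (ae_of_all _ fun z => ?_)
    simp only [translate_apply]
    ring
  have i4 : Integrable fun z => (∫ x in A, η (z + x)) * w z := by
    refine hwi.bdd_mul (c := ∫ x, ‖η x‖) ?_ (ae_of_all _ fun z => ?_)
    · have : StronglyMeasurable fun z => ∫ x in A, η (z + x) :=
        StronglyMeasurable.integral_prod_right' (ν := volume.restrict A)
          (f := fun p : ℝ × ℝ => η (p.1 + p.2))
          (η.continuous.comp (continuous_fst.add continuous_snd)).stronglyMeasurable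
      exact this.aestronglyMeasurable
    · refine (norm_integral_le_integral_norm _).trans ?_
      have i := (η.integrable (μ := volume).comp_add_left z).norm
      refine (setIntegral_le_integral i (ae_of_all _ fun _ => norm_nonneg _)).trans ?_
      rw [integral_add_left_eq_self (fun x => ‖η x‖) z]
  simp only [e1, add_mul]
  rw [integral_add i3 i4, integral_setIntegral_comp_add_mul η.integrable hwi hAm]
  have e2 : ∫ z, σ * η (z + t) * w z = ∫ y, σ * η y * w (y - t) := by
    rw [← integral_add_right_eq_self (fun y => σ * η y * w (y - t)) t]
    simp
  have i5 : Integrable fun y => σ * η y * w (y - t) := by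
    have := i3.comp_sub_right t
    simpa using this
  have e3 : ∀ y, ∫ z in {z | y - z ∈ A}, w z
      = ((∫ z in {z | 0 ≤ σ * (y - t - z)}, kernel b b' a z : ℝ) : ℂ) := fun y => by
    rw [← integral_complex_ofReal]
    have : {z | y - z ∈ A} = {z | 0 ≤ σ * (y - t - z)} := by
      ext z
      change 0 ≤ σ * (y - z - t) ↔ 0 ≤ σ * (y - t - z)
      rw [sub_right_comm]
    rw [this]
  have hσ0 : σ ≠ 0 := by rintro rfl; simp at hσ
  have i6 : Integrable fun y => η y *
      ((∫ z in {z | 0 ≤ σ * (y - t - z)}, kernel b b' a z : ℝ) : ℂ) := by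
    obtain ⟨M, hM, hb⟩ := h.exists_abs_setIntegral_kernel_le
    refine η.integrable.mul_bdd (c := M) ?_ (ae_of_all _ fun y => ?_)
    · have := h.continuous_setIntegral_kernel hσ0
      exact (Complex.continuous_ofReal.comp (this.comp
        (continuous_id.sub continuous_const))).aestronglyMeasurable
    · rw [Complex.norm_real]
      exact hb σ _
  rw [e2]
  simp only [e3]
  rw [← integral_add i5 i6]
  congr 1
  ext y
  simp only [stepKernel, hw]
  push_cast
  ring

theorem locallyIntegrable_stepKernel {t σ : ℝ} (hσ : σ ≠ 0) :
    LocallyIntegrable (fun x => (stepKernel b b' a σ (x - t) : ℂ)) volume := by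
  have h1 : LocallyIntegrable (fun x => (kernel b b' a (x - t) : ℂ)) volume :=
    (h.integrable_kernel.comp_sub_right t).ofReal.locallyIntegrable
  have h2 := (h.continuous_setIntegral_kernel hσ)
  have h3 : LocallyIntegrable (fun x => ((∫ z in {z | 0 ≤ σ * (x - t - z)}, kernel b b' a z : ℝ)
      : ℂ)) volume :=
    (Complex.continuous_ofReal.comp (h2.comp (continuous_id.sub continuous_const))).locallyIntegrable
  have := (h1.smul (σ : ℂ)).add h3
  refine this.congr (ae_of_all _ fun x => ?_)
  simp [stepKernel]

/-- Tested against `η`, the two terms combine into the pairing of `g_t` with the inverse transform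
of the derivative of `b · 𝓕 η`. That inverse transform carries a factor `x`, which cancels the `1/x`
of `g_t` and leaves the integral over a half-line. -/
theorem hClass_ae_eq {t σ : ℝ} (hσ : |σ| = 1) (ht : 0 < σ * t)
    (m₁ : MemLp (fun v => b v * (𝓕⁻ ((memLp_gFun hσ ht).toLp _) :
      Lp ℂ 2 (volume : Measure ℝ)) v) 2 volume)
    (m₂ : MemLp (fun v => b' v * (𝓕⁻ ((memLp_gFun hσ ht).toLp _) :
      Lp ℂ 2 (volume : Measure ℝ)) v) 2 volume) :
    (fun x : ℝ => (𝓕 (m₁.toLp _) : Lp ℂ 2 (volume : Measure ℝ)) x * (Complex.I * x)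
      - (2 * Real.pi : ℂ)⁻¹ * (𝓕 (m₂.toLp _) : Lp ℂ 2 (volume : Measure ℝ)) x) =ᵐ[volume]
      fun x => Complex.I * stepKernel b b' a σ (x - t) := by
  have hσ0 : σ ≠ 0 := by rintro rfl; simp at hσ
  set F := (𝓕⁻ ((memLp_gFun hσ ht).toLp _) : Lp ℂ 2 (volume : Measure ℝ)) with hF
  set H₁ := (𝓕 (m₁.toLp _) : Lp ℂ 2 (volume : Measure ℝ)) with hH₁
  set H₂ := (𝓕 (m₂.toLp _) : Lp ℂ 2 (volume : Measure ℝ)) with hH₂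
  have l1 : LocallyIntegrable (fun x : ℝ => H₁ x * (Complex.I * x)) volume :=
    ((Lp.memLp H₁).locallyIntegrable (by norm_num)).mul_continuous
      (g := fun x : ℝ => (Complex.I * x : ℂ)) (by fun_prop)
  have l2 : LocallyIntegrable (fun x : ℝ => (2 * Real.pi : ℂ)⁻¹ * H₂ x) volume :=
    ((Lp.memLp H₂).locallyIntegrable (by norm_num)).smul ((2 * Real.pi : ℂ)⁻¹)
  refine ae_eq_of_forall_schwartz (l1.sub l2)
    ((h.locallyIntegrable_stepKernel hσ0).smul Complex.I) fun η _ => ?_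
  set ξ : 𝓢(ℝ, ℂ) := 𝓕 η with hξ
  have hξc : (ξ : ℝ → ℂ) = 𝓕 (η : ℝ → ℂ) := SchwartzMap.fourier_coe η
  set ξ' : 𝓢(ℝ, ℂ) := 𝓕 (mulX η) with hξ'
  have hξc' : (ξ' : ℝ → ℂ) = 𝓕 (mulX η : ℝ → ℂ) := SchwartzMap.fourier_coe _
  obtain ⟨C, hC0, hC⟩ := h.exists_norm_deriv_le
  set D : ℝ → ℂ := fun v => b v * ξ v with hD
  set D' : ℝ → ℂ := fun v => b' v * ξ v + b v * (-2 * Real.pi * Complex.I * ξ' v) with hD'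
  have hder : ∀ v, HasDerivAt D (D' v) v := fun v => by
    have := hasDerivAt_fourier_schwartz η v
    rw [← hξc, ← hξc'] at this
    exact (h.hasDerivAt v).mul this
  have hb : ∀ v, ‖b v‖ ≤ 1 * ‖b v‖ := fun v => by simp
  obtain ⟨iD, mD⟩ := h.memLp_mul_schwartz h.continuous hb ξ
  obtain ⟨iD1, mD1⟩ := h.memLp_mul_schwartz h.continuous_deriv hC ξ
  obtain ⟨iD2, mD2⟩ := h.memLp_mul_schwartz h.continuous hb
    ((-2 * Real.pi * Complex.I : ℂ) • ξ')
  have iD' : Integrable D' := iD1.add iD2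
  have mD' : MemLp D' 2 volume := mD1.add mD2
  have hderiv : deriv D = D' := funext fun v => (hder v).deriv
  have four : ∀ x, 𝓕⁻ D' x = -(2 * Real.pi * Complex.I * x) * 𝓕⁻ D x := fun x => by
    have := Real.fourier_deriv iD (fun v => (hder v).differentiableAt)
      (by rw [hderiv]; exact iD')
    rw [hderiv] at this
    have h2 := congrFun this (-x)
    rw [Real.fourierInv_eq_fourier_neg, Real.fourierInv_eq_fourier_neg, h2]
    simp only [smul_eq_mul, hD]
    push_cast
    ring
  have a1 : ∫ x, η x * (H₁ x * (Complex.I * x)) = Complex.I * ∫ v, ξ' v * (b v * F v) := by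
    calc _ = Complex.I * ∫ x, mulX η x * H₁ x := by
          rw [← integral_const_mul]
          congr 1
          ext x
          simp
          ring
      _ = _ := by
          rw [hH₁, integral_mul_fourier_lp, hξc']
          congr 1
          apply integral_congr_ae
          filter_upwards [m₁.coeFn_toLp] with v hv
          rw [hv]
  have a2 : ∫ x, η x * ((2 * Real.pi : ℂ)⁻¹ * H₂ x)
      = (2 * Real.pi : ℂ)⁻¹ * ∫ v, ξ v * (b' v * F v) := by
    calc _ = (2 * Real.pi : ℂ)⁻¹ * ∫ x, η x * H₂ x := by
          rw [← integral_const_mul]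
          congr 1
          ext x
          ring
      _ = _ := by
          rw [hH₂, integral_mul_fourier_lp, hξc]
          congr 1
          apply integral_congr_ae
          filter_upwards [m₂.coeFn_toLp] with v hv
          rw [hv]
  have i1 : Integrable fun v => ξ' v * (b v * F v) := (ξ'.memLp 2 volume).integrable_mul m₁
  have i2 : Integrable fun v => ξ v * (b' v * F v) := (ξ.memLp 2 volume).integrable_mul m₂
  -- The product rule: `ix` acting on the first term differentiates `𝓕 η`, the second term
  -- differentiates `b`, and the constants match those of `D'`.
  have a3 : Complex.I * (∫ v, ξ' v * (b v * F v)) - (2 * Real.pi : ℂ)⁻¹ * ∫ v, ξ v * (b' v * F v)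
      = -(2 * Real.pi : ℂ)⁻¹ * ∫ v, D' v * F v := by
    rw [← integral_const_mul, ← integral_const_mul, ← integral_const_mul,
      ← integral_sub (i1.const_mul _) (i2.const_mul _)]
    congr 1
    ext v
    have hpi : (Real.pi : ℂ) ≠ 0 := Complex.ofReal_ne_zero.2 Real.pi_ne_zero
    simp only [hD']
    field_simp
    ring
  have a4 : ∫ v, D' v * F v = -(2 * Real.pi * Complex.I) *
      ∫ x in {x | 0 ≤ σ * (x - t)}, 𝓕⁻ D x := by
    rw [hF, integral_fourierInv_lp_mul iD' mD', ← integral_indicator (measurableSet_side σ t),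
      ← integral_const_mul]
    apply integral_congr_ae
    filter_upwards [(memLp_gFun hσ ht).coeFn_toLp] with x hx
    rw [hx, four, gFun_eq_indicator hσ ht]
    by_cases hxA : x ∈ {x | 0 ≤ σ * (x - t)}
    · rw [Set.indicator_of_mem hxA, Set.indicator_of_mem hxA]
      have hx0 : (x : ℂ) ≠ 0 := by
        have := abs_le_of_mem_side hσ ht hxA
        intro h0
        rw [Complex.ofReal_eq_zero.1 h0, abs_zero] at this
        rw [abs_nonpos_iff.1 this] at ht
        simp at ht
      push_cast
      field_simp
    · rw [Set.indicator_of_notMem hxA, Set.indicator_of_notMem hxA]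
      simp
  have a5 := h.integral_stepKernel_mul (t := t) hσ η
  have j1 : Integrable fun x : ℝ => η x * (H₁ x * (Complex.I * x)) := by
    have := (((mulX η).memLp 2 volume).integrable_mul (Lp.memLp H₁)).const_mul Complex.I
    refine this.congr (ae_of_all _ fun x => ?_)
    simp
    ring
  have j2 : Integrable fun x : ℝ => η x * ((2 * Real.pi : ℂ)⁻¹ * H₂ x) := by
    have := ((η.memLp 2 volume).integrable_mul (Lp.memLp H₂)).const_mul (2 * Real.pi : ℂ)⁻¹
    refine this.congr (ae_of_all _ fun x => ?_)
    simp
    ring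
  have hDc : D = fun v => b v * 𝓕 (η : ℝ → ℂ) v := by rw [hD, hξc]
  calc _ = ∫ x : ℝ, (η x * (H₁ x * (Complex.I * x)) - η x * ((2 * Real.pi : ℂ)⁻¹ * H₂ x)) := by
        congr 1
        ext x
        ring
    _ = Complex.I * ∫ x in {x | 0 ≤ σ * (x - t)}, 𝓕⁻ D x := by
        rw [integral_sub j1 j2, a1, a2, a3, a4]
        have hpi : (Real.pi : ℂ) ≠ 0 := Complex.ofReal_ne_zero.2 Real.pi_ne_zero
        field_simp
    _ = _ := by
        rw [hDc, a5, ← integral_const_mul]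
        congr 1
        ext x
        ring

end IsDeconvSymbol

end LevyDonsker
end

noncomputable section

namespace LevyDonsker
open scoped SchwartzMap ENNReal ContDiff ComplexConjugate

/-! ### The Lévy exponent -/

/-- The Fourier transform of the signed measure `x ν(dx)`. -/
def weightedCharFun (ν : Measure ℝ) (u : ℝ) : ℂ :=
  ∫ x : ℝ, Complex.exp (Complex.I * u * x) * (x : ℂ) ∂ν

theorem norm_exp_I_mul_mul (u x : ℝ) : ‖Complex.exp (Complex.I * u * x)‖ = 1 := by
  rw [show Complex.I * u * x = ((u * x : ℝ) : ℂ) * Complex.I by push_cast; ring,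
    Complex.norm_exp_ofReal_mul_I]

theorem hasDerivAt_exp_I_mul_mul (u x : ℝ) :
    HasDerivAt (fun u : ℝ => Complex.exp (Complex.I * u * x))
      (Complex.I * (Complex.exp (Complex.I * u * x) * x)) u := by
  have h1 : HasDerivAt (fun u : ℝ => (Complex.I * u * x : ℂ)) (Complex.I * x) u := by
    have := (((hasDerivAt_id u).ofReal_comp).const_mul Complex.I).mul_const (x : ℂ)
    simpa using this
  refine h1.cexp.congr_deriv ?_
  ring

theorem norm_exp_I_mul_mul_sub_one_le (u x : ℝ) :
    ‖Complex.exp (Complex.I * u * x) - 1‖ ≤ |u| * |x| := by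
  have := Real.norm_exp_I_mul_ofReal_sub_one_le (x := u * x)
  rw [Real.norm_eq_abs, abs_mul] at this
  push_cast at this
  rwa [← mul_assoc] at this

theorem levyExponent_neg (ν : Measure ℝ) (γ u : ℝ) : levyExponent γ ν (-u) = conj (levyExponent γ ν u) := by
  rw [levyExponent, levyExponent, map_add, ← integral_conj]
  congr 1
  · simp
  · congr 1
    ext x
    simp only [map_sub, map_one, ← Complex.exp_conj, map_mul, Complex.conj_I, Complex.conj_ofReal]
    congr 2
    push_cast
    ring

section

variable {ν : Measure ℝ} (h1 : Integrable (fun x : ℝ => x) ν)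
include h1

theorem integrable_exp_sub_one (u : ℝ) :
    Integrable (fun x : ℝ => Complex.exp (Complex.I * u * x) - 1) ν :=
  (h1.abs.const_mul |u|).mono' (by fun_prop)
    (ae_of_all _ fun x => norm_exp_I_mul_mul_sub_one_le u x)

theorem hasDerivAt_levyExponent (γ u : ℝ) :
    HasDerivAt (levyExponent γ ν) (Complex.I * (γ + weightedCharFun ν u)) u := by
  have hd : HasDerivAt (fun u : ℝ => ∫ x, (Complex.exp (Complex.I * u * x) - 1) ∂ν)
      (∫ x : ℝ, Complex.I * (Complex.exp (Complex.I * u * x) * x) ∂ν) u := by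
    refine (hasDerivAt_integral_of_dominated_loc_of_deriv_le (s := Set.univ) (bound := fun x => |x|)
      Filter.univ_mem (Eventually.of_forall fun v => by fun_prop) (integrable_exp_sub_one h1 u)
      (by fun_prop) (ae_of_all _ fun x v _ => ?_) h1.abs
      (ae_of_all _ fun x v _ => (hasDerivAt_exp_I_mul_mul v x).sub_const 1)).2
    rw [norm_mul, norm_mul, norm_exp_I_mul_mul]
    simp
  have h2 : HasDerivAt (fun u : ℝ => (Complex.I * γ * u : ℂ)) (Complex.I * γ) u := by
    have := ((hasDerivAt_id u).ofReal_comp).const_mul (Complex.I * γ)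
    simpa using this
  refine (h2.add hd).congr_deriv ?_
  rw [integral_const_mul, weightedCharFun]
  ring

theorem continuous_weightedCharFun : Continuous (weightedCharFun ν) := by
  refine continuous_of_dominated (bound := fun x => |x|) (fun u => by fun_prop)
    (fun u => ae_of_all _ fun x => ?_) h1.abs (ae_of_all _ fun x => by fun_prop)
  rw [norm_mul, norm_exp_I_mul_mul]
  simp

theorem norm_levyExponent_le (γ u : ℝ) :
    ‖levyExponent γ ν u‖ ≤ (|γ| + ∫ x, |x| ∂ν) * |u| := by
  rw [levyExponent, add_mul]
  refine (norm_add_le _ _).trans (add_le_add (by simp) ?_)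
  rw [mul_comm (∫ x, |x| ∂ν), ← integral_const_mul]
  exact norm_integral_le_of_norm_le (h1.abs.const_mul |u|)
    (ae_of_all _ fun x => norm_exp_I_mul_mul_sub_one_le u x)

/-- The drift and the odd part of the integrand cancel, leaving `2cos(ux) - 2`, which is of second
order. -/
theorem norm_levyExponent_add_neg_le (h2 : Integrable (fun x : ℝ => x ^ 2) ν) (γ u : ℝ) :
    ‖levyExponent γ ν u + levyExponent γ ν (-u)‖ ≤ (∫ x, x ^ 2 ∂ν) * u ^ 2 := by
  have e : levyExponent γ ν u + levyExponent γ ν (-u)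
      = ∫ x, ((Complex.exp (Complex.I * u * x) - 1)
        + (Complex.exp (Complex.I * ((-u : ℝ) : ℂ) * x) - 1)) ∂ν := by
    rw [integral_add (integrable_exp_sub_one h1 u) (integrable_exp_sub_one h1 (-u)),
      levyExponent, levyExponent]
    push_cast
    ring
  rw [e, mul_comm (∫ x, x ^ 2 ∂ν), ← integral_const_mul]
  refine norm_integral_le_of_norm_le (h2.const_mul _) (ae_of_all _ fun x => ?_)
  have e2 : (Complex.exp (Complex.I * u * x) - 1)
        + (Complex.exp (Complex.I * ((-u : ℝ) : ℂ) * x) - 1)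
      = ((2 * Real.cos (u * x) - 2 : ℝ) : ℂ) := by
    have := Complex.two_cos (u * x)
    push_cast
    rw [this]
    ring_nf
  rw [e2, Complex.norm_real, Real.norm_eq_abs, abs_le, ← mul_pow]
  have := Real.one_sub_sq_div_two_le_cos (x := u * x)
  have := Real.cos_le_one (u * x)
  constructor <;> nlinarith [sq_nonneg (u * x)]

theorem hasDerivAt_levyCharFun (Δ γ u : ℝ) :
    HasDerivAt (levyCharFun Δ γ ν)
      (Complex.I * (Δ * (γ + weightedCharFun ν u)) * levyCharFun Δ γ ν u) u := by
  refine ((hasDerivAt_levyExponent h1 γ u).const_mul (Δ : ℂ)).cexp.congr_deriv ?_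
  rw [levyCharFun]
  ring

end

theorem levyCharFun_ne_zero (Δ γ : ℝ) (ν : Measure ℝ) (u : ℝ) : levyCharFun Δ γ ν u ≠ 0 :=
  Complex.exp_ne_zero _

/-! ### The deconvolution symbol of the Lévy model -/

/-- `v ↦ φ⁻¹(-2πv)`. -/
def levySymbol (Δ γ : ℝ) (ν : Measure ℝ) (v : ℝ) : ℂ :=
  (levyCharFun Δ γ ν (-(2 * Real.pi * v)))⁻¹

/-- The derivative of `levySymbol`. -/
def levySymbolDeriv (Δ γ : ℝ) (ν : Measure ℝ) (v : ℝ) : ℂ :=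
  2 * Real.pi * Complex.I * (Δ * (γ + weightedCharFun ν (-(2 * Real.pi * v))))
    * levySymbol Δ γ ν v

namespace RegularityCondition

variable {Δ γ ε : ℝ} {ν : Measure ℝ} (h : RegularityCondition Δ γ ν ε)
include h

theorem integrable_id : Integrable (fun x : ℝ => x) ν := by
  refine h.moment.mono' (by fun_prop) (ae_of_all _ fun x => ?_)
  exact le_max_left _ _

theorem integrable_sq (hε : 0 < ε) : Integrable (fun x : ℝ => x ^ 2) ν := by
  refine h.moment.mono' (by fun_prop) (ae_of_all _ fun x => ?_)
  rw [Real.norm_eq_abs, abs_pow]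
  rcases le_total |x| 1 with hx | hx
  · refine le_trans ?_ (le_max_left _ _)
    nlinarith [abs_nonneg x]
  · refine le_trans ?_ (le_max_right _ _)
    rw [← Real.rpow_natCast]
    exact Real.rpow_le_rpow_of_exponent_le hx (by norm_num; linarith)

/-- From `φ' = iΔ(γ + F[xν]) φ`, the logarithmic derivative of the symbol is `2πi(γΔ + Δ
F[xν](-2πv))`. The constant part identifies `a = γΔ`, and the rest decays by condition (b). Lowering
`ε` to at most `1/2` only weakens condition (c) and keeps `2ε ≤ 1`. -/
theorem isDeconvSymbol (hε : 0 < ε) :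
    IsDeconvSymbol (levySymbol Δ γ ν) (levySymbolDeriv Δ γ ν) (γ * Δ) (min ε (1 / 2)) where
  hasDerivAt v := by
    have h1 : HasDerivAt (fun v : ℝ => -(2 * Real.pi * v)) (-(2 * Real.pi)) v := by
      have := ((hasDerivAt_id v).const_mul (2 * Real.pi)).neg
      rw [mul_one] at this
      exact this
    have h2 := (hasDerivAt_levyCharFun h.integrable_id Δ γ (-(2 * Real.pi * v))).scomp v h1
    refine (h2.inv (levyCharFun_ne_zero Δ γ ν _)).congr_deriv ?_
    have := levyCharFun_ne_zero Δ γ ν (-(2 * Real.pi * v))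
    simp only [levySymbolDeriv, levySymbol, Function.comp_apply, Complex.real_smul]
    field_simp
    push_cast
    ring
  continuous_deriv := by
    have h1 := continuous_weightedCharFun h.integrable_id
    have h2 : Continuous (levyCharFun Δ γ ν) :=
      continuous_iff_continuousAt.2 fun u =>
        (hasDerivAt_levyCharFun h.integrable_id Δ γ u).continuousAt
    have h3 : Continuous (levySymbol Δ γ ν) :=
      (h2.comp (by fun_prop : Continuous fun v : ℝ => -(2 * Real.pi * v))).inv₀
        fun v => levyCharFun_ne_zero Δ γ ν _
    have h4 := h1.comp (by fun_prop : Continuous fun v : ℝ => -(2 * Real.pi * v))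
    exact (continuous_const.mul (continuous_const.mul (continuous_const.add h4))).mul h3
  bound := by
    obtain ⟨C, hC⟩ := h.fourier_decay
    refine ⟨2 * Real.pi * |Δ| * |C|, fun v => ?_⟩
    have e : levySymbolDeriv Δ γ ν v
        - 2 * Real.pi * Complex.I * ((γ * Δ : ℝ) : ℂ) * levySymbol Δ γ ν v
        = 2 * Real.pi * Complex.I * (Δ * weightedCharFun ν (-(2 * Real.pi * v)))
          * levySymbol Δ γ ν v := by
      rw [levySymbolDeriv]
      push_cast
      ring
    have hk : ‖weightedCharFun ν (-(2 * Real.pi * v))‖ ≤ |C| * (1 + |v|)⁻¹ := by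
      have h1 := hC (-(2 * Real.pi * v))
      have h2 : (1 + |-(2 * Real.pi * v)|)⁻¹ ≤ (1 + |v|)⁻¹ := by
        apply inv_anti₀ (by positivity)
        rw [abs_neg, abs_mul, abs_of_pos (by positivity : 0 < 2 * Real.pi)]
        have := Real.pi_gt_three
        nlinarith [abs_nonneg v]
      calc _ ≤ C * (1 + |-(2 * Real.pi * v)|)⁻¹ := h1
        _ ≤ |C| * (1 + |-(2 * Real.pi * v)|)⁻¹ := by gcongr; exact le_abs_self C
        _ ≤ _ := by gcongr
    have e3 : ‖(Δ * weightedCharFun ν (-(2 * Real.pi * v)) : ℂ)‖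
        = |Δ| * ‖weightedCharFun ν (-(2 * Real.pi * v))‖ := by
      rw [norm_mul, Complex.norm_real, Real.norm_eq_abs]
    rw [e, norm_mul, norm_mul, e3]
    have e2 : ‖(2 * Real.pi * Complex.I : ℂ)‖ = 2 * Real.pi := by
      simp [abs_of_pos Real.pi_pos]
    rw [e2]
    calc _ ≤ 2 * Real.pi * (|Δ| * (|C| * (1 + |v|)⁻¹)) * ‖levySymbol Δ γ ν v‖ := by gcongr
      _ = _ := by ring
  memLp := by
    have hc : Continuous (levyCharFun Δ γ ν) :=
      continuous_iff_continuousAt.2 fun u =>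
        (hasDerivAt_levyCharFun h.integrable_id Δ γ u).continuousAt
    have hs : Continuous (levySymbol Δ γ ν) :=
      (hc.comp (by fun_prop : Continuous fun v : ℝ => -(2 * Real.pi * v))).inv₀
        fun v => levyCharFun_ne_zero Δ γ ν _
    have hr : ∀ s : ℝ, Continuous fun v : ℝ => (1 + |v|) ^ s := fun s =>
      (by fun_prop : Continuous fun v : ℝ => 1 + |v|).rpow_const
        (fun v => Or.inl (by positivity))
    have h1 := (memLp_two_iff_integrable_sq_norm h.inv_charFun.1).1 h.inv_charFun
    have h2 := h1.comp_mul_left' (R := -(2 * Real.pi)) (by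
      have := Real.pi_pos
      linarith)
    have hm := ((hr (-1 + min ε (1 / 2))).mul hs.norm).aestronglyMeasurable (μ := volume)
    refine (memLp_two_iff_integrable_sq hm).2 ?_
    refine (h2.const_mul ((2 * Real.pi) ^ 2)).mono'
      (((hr _).mul hs.norm).pow 2).aestronglyMeasurable (ae_of_all _ fun v => ?_)
    have hp : 0 < 1 + |v| := by positivity
    have hpi := Real.pi_gt_three
    have e : -(2 * Real.pi) * v = -(2 * Real.pi * v) := by ring
    rw [Real.norm_of_nonneg (by positivity), ← mul_pow, e, norm_mul, Complex.norm_real,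
      Real.norm_of_nonneg (by positivity), ← mul_assoc]
    have e2 : |-(2 * Real.pi * v)| = 2 * Real.pi * |v| := by
      rw [abs_neg, abs_mul, abs_of_pos (by positivity : 0 < 2 * Real.pi)]
    rw [e2]
    -- The cost of the substitution `u = -2πv` in the weight: `1 + 2π|v| ≤ 2π(1 + |v|)`, and the
    -- exponent is at least `-1`, so a factor `2π` suffices.
    have key : (1 + |v|) ^ (-1 + min ε (1 / 2))
        ≤ 2 * Real.pi * (1 + 2 * Real.pi * |v|) ^ (-1 + ε) := by
      have hm : min ε (1 / 2) ≤ 1 / 2 := min_le_right _ _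
      have hm' : min ε (1 / 2) ≤ ε := min_le_left _ _
      have hm0 : 0 < min ε (1 / 2) := lt_min hε (by norm_num)
      have hpos : 0 < 1 + 2 * Real.pi * |v| := by positivity
      have hle : 1 + 2 * Real.pi * |v| ≤ 2 * Real.pi * (1 + |v|) := by nlinarith [abs_nonneg v]
      have h1 : (2 * Real.pi * (1 + |v|)) ^ (-1 + min ε (1 / 2))
          ≤ (1 + 2 * Real.pi * |v|) ^ (-1 + min ε (1 / 2)) :=
        Real.rpow_le_rpow_of_nonpos hpos hle (by linarith)
      rw [Real.mul_rpow (by positivity) hp.le] at h1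
      have h2 : (2 * Real.pi)⁻¹ ≤ (2 * Real.pi) ^ (-1 + min ε (1 / 2)) := by
        rw [← Real.rpow_neg_one]
        exact Real.rpow_le_rpow_of_exponent_le (by linarith) (by linarith)
      have h3 : (1 + 2 * Real.pi * |v|) ^ (-1 + min ε (1 / 2))
          ≤ (1 + 2 * Real.pi * |v|) ^ (-1 + ε) := by
        apply Real.rpow_le_rpow_of_exponent_le _ (by linarith)
        have : 0 ≤ 2 * Real.pi * |v| := by positivity
        linarith
      have h4 : 0 ≤ (1 + |v|) ^ (-1 + min ε (1 / 2)) := by positivity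
      calc _ = 2 * Real.pi * ((2 * Real.pi)⁻¹ * (1 + |v|) ^ (-1 + min ε (1 / 2))) := by
            field_simp
        _ ≤ 2 * Real.pi * ((2 * Real.pi) ^ (-1 + min ε (1 / 2))
            * (1 + |v|) ^ (-1 + min ε (1 / 2))) := by gcongr
        _ ≤ 2 * Real.pi * (1 + 2 * Real.pi * |v|) ^ (-1 + ε) := by
            gcongr
            exact h1.trans h3
    change ((1 + |v|) ^ (-1 + min ε (1 / 2)) * ‖(levyCharFun Δ γ ν (-(2 * Real.pi * v)))⁻¹‖) ^ 2
      ≤ _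
    gcongr
  symm v := by
    simp only [levySymbol, levyCharFun, map_inv₀, ← Complex.exp_conj, map_mul, Complex.conj_ofReal,
      ← levyExponent_neg]
    congr 5
    ring
  pos := lt_min hε (by norm_num)
  le_half := min_le_right _ _

end RegularityCondition

end LevyDonsker
end

noncomputable section

namespace LevyDonsker
open scoped SchwartzMap ENNReal ContDiff ComplexConjugate

/-! ### The law of the increments -/

/-- `2 - 2cos y ≥ (4/π²) y²` for `|y| ≤ π`, so truncated second moments are controlled by the
second-order behaviour of the characteristic function at zero. -/
theorem integrable_sq_of_charFun_le {P : Measure ℝ} [IsProbabilityMeasure P] {K δ : ℝ}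
    (hδ : 0 < δ) (hK : ∀ u, 0 < u → u ≤ δ → 2 - 2 * (charFun P u).re ≤ K * u ^ 2) :
    Integrable (fun x : ℝ => x ^ 2) P := by
  have hcos : ∀ u, Integrable (fun x => Real.cos (u * x)) P := fun u =>
    (integrable_const (1 : ℝ)).mono' (by fun_prop) (ae_of_all _ fun x => Real.abs_cos_le_one _)
  have hre : ∀ u, (charFun P u).re = ∫ x, Real.cos (u * x) ∂P := fun u => by
    rw [charFun_apply_real]
    have hi : Integrable (fun x : ℝ => Complex.exp (u * x * Complex.I)) P := by
      refine (integrable_const (1 : ℝ)).mono' (by fun_prop) (ae_of_all _ fun x => ?_)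
      rw [← Complex.ofReal_mul, Complex.norm_exp_ofReal_mul_I]
    have := integral_re hi
    simp only [RCLike.re_to_complex] at this
    rw [← this]
    congr 1
    ext x
    rw [← Complex.ofReal_mul, Complex.exp_ofReal_mul_I_re]
  have hpi := Real.pi_pos
  refine (aecover_Icc (μ := P) (a := fun n : ℕ => -(n : ℝ)) (b := fun n : ℕ => (n : ℝ))
    (tendsto_neg_atTop_atBot.comp tendsto_natCast_atTop_atTop)
    tendsto_natCast_atTop_atTop).integrable_of_integral_bounded_of_nonneg_ae
    (Real.pi ^ 2 / 4 * K) (fun n => ?_) (ae_of_all _ fun x => sq_nonneg x) ?_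
  · exact (by fun_prop : Continuous fun x : ℝ => x ^ 2).continuousOn.integrableOn_compact
      isCompact_Icc
  · have hev : ∀ᶠ n : ℕ in atTop, Real.pi / δ ≤ n ∧ 0 < (n : ℝ) :=
      (tendsto_natCast_atTop_atTop.eventually_ge_atTop _).and
        (tendsto_natCast_atTop_atTop.eventually_gt_atTop _)
    filter_upwards [hev] with n hn
    obtain ⟨hn1, hn0⟩ := hn
    -- The largest frequency for which `|ux| ≤ π` on all of `[-n, n]`; the powers of `u` cancel in
    -- the end, so the bound is uniform in `n`.
    set u := Real.pi / n with hu
    have hu0 : 0 < u := by positivity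
    have huδ : u ≤ δ := by
      rw [hu, div_le_iff₀ hn0]
      rwa [div_le_iff₀ hδ, mul_comm] at hn1
    have hmain := hK u hu0 huδ
    rw [hre] at hmain
    have i1 : Integrable (fun x => Real.pi ^ 2 / (4 * u ^ 2) * (2 - 2 * Real.cos (u * x))) P :=
      ((integrable_const _).sub ((hcos u).const_mul 2)).const_mul _
    calc ∫ x in Set.Icc (-(n : ℝ)) n, x ^ 2 ∂P
        ≤ ∫ x in Set.Icc (-(n : ℝ)) n, Real.pi ^ 2 / (4 * u ^ 2) * (2 - 2 * Real.cos (u * x)) ∂P := by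
          refine setIntegral_mono_on ?_ i1.integrableOn measurableSet_Icc fun x hx => ?_
          · exact (by fun_prop : Continuous fun x : ℝ => x ^ 2).continuousOn.integrableOn_compact
              isCompact_Icc
          · have hx' : |u * x| ≤ Real.pi := by
              rw [abs_mul, abs_of_pos hu0, hu, div_mul_eq_mul_div, div_le_iff₀ hn0]
              gcongr
              exact abs_le.2 hx
            have := Real.cos_le_one_sub_mul_cos_sq hx'
            have h4 : 4 / Real.pi ^ 2 * (u * x) ^ 2 ≤ 2 - 2 * Real.cos (u * x) := by
              have : 4 / Real.pi ^ 2 * (u * x) ^ 2 = 2 * (2 / Real.pi ^ 2 * (u * x) ^ 2) := by ring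
              linarith
            calc x ^ 2 = Real.pi ^ 2 / (4 * u ^ 2) * (4 / Real.pi ^ 2 * (u * x) ^ 2) := by
                  field_simp
              _ ≤ _ := by gcongr
      _ ≤ ∫ x, Real.pi ^ 2 / (4 * u ^ 2) * (2 - 2 * Real.cos (u * x)) ∂P := by
          refine setIntegral_le_integral i1 (ae_of_all _ fun x => ?_)
          have := Real.cos_le_one (u * x)
          have h2 : 0 ≤ 2 - 2 * Real.cos (u * x) := by linarith
          exact mul_nonneg (by positivity) h2
      _ = Real.pi ^ 2 / (4 * u ^ 2) * (2 - 2 * ∫ x, Real.cos (u * x) ∂P) := by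
          rw [integral_const_mul, integral_sub (integrable_const _) ((hcos u).const_mul 2),
            integral_const_mul]
          simp
      _ ≤ Real.pi ^ 2 / (4 * u ^ 2) * (K * u ^ 2) := by gcongr
      _ = _ := by field_simp

/-- Expand `2 - φ(u) - φ(-u)` to second order in the exponents `z = Δψ(u)` and `z' = Δψ(-u)`. The
Taylor remainders are `O(u²)` because `z, z' = O(u)`, and so is `z + z'`. The range `(L + 1)⁻¹`
ensures `|z| ≤ 1`. -/
theorem IsIncrementLaw.integrable_sq {Δ γ : ℝ} {ν P : Measure ℝ} (hP : IsIncrementLaw Δ γ ν P)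
    (h1 : Integrable (fun x : ℝ => x) ν) (h2 : Integrable (fun x : ℝ => x ^ 2) ν) :
    Integrable (fun x : ℝ => x ^ 2) P := by
  have := hP.isProbabilityMeasure
  set L := |Δ| * (|γ| + ∫ x, |x| ∂ν) with hL
  have hL0 : 0 ≤ L := by
    have : 0 ≤ ∫ x, |x| ∂ν := integral_nonneg fun x => abs_nonneg x
    positivity
  set Q := |Δ| * ∫ x, x ^ 2 ∂ν with hQ
  refine integrable_sq_of_charFun_le (δ := (L + 1)⁻¹) (K := 2 * L ^ 2 + Q) (by positivity)
    fun u hu0 hu => ?_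
  have hz : ∀ u : ℝ, ‖(Δ : ℂ) * levyExponent γ ν u‖ ≤ L * |u| := fun u => by
    rw [norm_mul, Complex.norm_real, Real.norm_eq_abs, hL, mul_assoc]
    gcongr
    exact norm_levyExponent_le h1 γ u
  have hzz : ‖(Δ : ℂ) * levyExponent γ ν u + Δ * levyExponent γ ν (-u)‖ ≤ Q * u ^ 2 := by
    rw [← mul_add, norm_mul, Complex.norm_real, Real.norm_eq_abs, hQ, mul_assoc]
    gcongr
    exact norm_levyExponent_add_neg_le h1 h2 γ u
  have hu1 : L * |u| ≤ 1 := by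
    rw [abs_of_pos hu0]
    calc L * u ≤ (L + 1) * (L + 1)⁻¹ := by gcongr; linarith
      _ = 1 := mul_inv_cancel₀ (by positivity)
  set z := (Δ : ℂ) * levyExponent γ ν u with hzdef
  set z' := (Δ : ℂ) * levyExponent γ ν (-u) with hzdef'
  have b1 : ‖Complex.exp z - 1 - z‖ ≤ (L * |u|) ^ 2 :=
    (Complex.norm_exp_sub_one_sub_id_le ((hz u).trans hu1)).trans (by gcongr; exact hz u)
  have hz' : ‖z'‖ ≤ L * |u| := by
    have := hz (-u)
    rwa [abs_neg] at this
  have b2 : ‖Complex.exp z' - 1 - z'‖ ≤ (L * |u|) ^ 2 :=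
    (Complex.norm_exp_sub_one_sub_id_le (hz'.trans hu1)).trans (by gcongr)
  have e : (2 - 2 * (charFun P u).re) = ‖((2 - 2 * (charFun P u).re : ℝ) : ℂ)‖ := by
    rw [Complex.norm_real, Real.norm_of_nonneg]
    have := Complex.re_le_norm (charFun P u)
    have := norm_charFun_le_one (μ := P) u
    linarith
  have e2 : ((2 - 2 * (charFun P u).re : ℝ) : ℂ)
      = -((Complex.exp z - 1 - z) + (Complex.exp z' - 1 - z') + (z + z')) := by
    have h3 : charFun P u + conj (charFun P u) = ((2 * (charFun P u).re : ℝ) : ℂ) :=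
      Complex.add_conj _
    rw [Complex.ofReal_sub, ← h3, ← charFun_neg, hP.charFun_eq, hP.charFun_eq, levyCharFun,
      levyCharFun]
    simp only [← hzdef, ← hzdef']
    push_cast
    ring
  rw [e, e2, norm_neg]
  calc _ ≤ (L * |u|) ^ 2 + (L * |u|) ^ 2 + Q * u ^ 2 :=
        (norm_add_le _ _).trans (add_le_add ((norm_add_le _ _).trans (add_le_add b1 b2)) hzz)
    _ = _ := by
        rw [mul_pow, sq_abs]
        ring


theorem charFun_withDensity_sub {μ : Measure ℝ} {f : ℝ → ℝ} (hf : Integrable f μ) (u : ℝ) :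
    charFun (μ.withDensity fun x => ENNReal.ofReal (f x)) u
      - charFun (μ.withDensity fun x => ENNReal.ofReal (-f x)) u
      = ∫ x : ℝ, Complex.exp (Complex.I * u * x) * (f x : ℂ) ∂μ := by
  have hc : Continuous fun x : ℝ => Complex.exp (u * x * Complex.I) := by fun_prop
  have hi : ∀ g : ℝ → ℝ, Integrable g μ →
      Integrable (fun x : ℝ => (ENNReal.ofReal (g x)).toReal • Complex.exp (u * x * Complex.I)) μ :=
    fun g hg => by
      refine (hg.abs).mono' (f := fun x : ℝ =>
        (ENNReal.ofReal (g x)).toReal • Complex.exp (u * x * Complex.I))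
        (AEStronglyMeasurable.smul
          (hg.1.aemeasurable.ennreal_ofReal.ennreal_toReal.aestronglyMeasurable)
          hc.aestronglyMeasurable) (ae_of_all _ fun x => ?_)
      rw [norm_smul, ← Complex.ofReal_mul, Complex.norm_exp_ofReal_mul_I, mul_one,
        ENNReal.toReal_ofReal', Real.norm_eq_abs, abs_of_nonneg (le_max_right _ _)]
      exact max_le (le_abs_self _) (abs_nonneg _)
  rw [charFun_apply_real, charFun_apply_real,
    integral_withDensity_eq_integral_toReal_smul₀ hf.1.aemeasurable.ennreal_ofReal
      (ae_of_all _ fun x => ENNReal.ofReal_lt_top),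
    integral_withDensity_eq_integral_toReal_smul₀ (f := fun x => ENNReal.ofReal (-f x))
      (AEMeasurable.ennreal_ofReal hf.neg.1.aemeasurable)
      (ae_of_all _ fun x => ENNReal.ofReal_lt_top),
    ← integral_sub (hi f hf) (hi (fun x => -f x) hf.neg)]
  congr 1
  ext x
  rw [← sub_smul, ENNReal.toReal_ofReal', ENNReal.toReal_ofReal', max_zero_sub_eq_self,
    Complex.real_smul, mul_comm]
  congr 2
  ring

theorem charFun_add (M N : Measure ℝ) [IsFiniteMeasure M] [IsFiniteMeasure N] (u : ℝ) :
    charFun (M + N) u = charFun M u + charFun N u := by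
  have hi : ∀ M : Measure ℝ, IsFiniteMeasure M →
      Integrable (fun x : ℝ => Complex.exp (u * x * Complex.I)) M := fun M _ => by
    refine (integrable_const (1 : ℝ)).mono' (by fun_prop) (ae_of_all _ fun x => ?_)
    rw [← Complex.ofReal_mul, Complex.norm_exp_ofReal_mul_I]
  rw [charFun_apply_real, charFun_apply_real, charFun_apply_real,
    integral_add_measure (hi M inferInstance) (hi N inferInstance)]

/-- Turns the equality of signed measures in condition (b) into one of Fourier transforms, by moving
negative parts across to obtain an equality of finite positive measures. -/
theorem integral_exp_mul_eq_of_withDensityᵥ_eq {μ ρ : Measure ℝ} {f g : ℝ → ℝ}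
    (hf : Integrable f μ) (hg : Integrable g ρ) (h : μ.withDensityᵥ f = ρ.withDensityᵥ g) (u : ℝ) :
    ∫ x : ℝ, Complex.exp (Complex.I * u * x) * (f x : ℂ) ∂μ
      = ∫ x : ℝ, Complex.exp (Complex.I * u * x) * (g x : ℂ) ∂ρ := by
  have := isFiniteMeasure_withDensity_ofReal hf.2
  have := isFiniteMeasure_withDensity_ofReal hf.neg.2
  have := isFiniteMeasure_withDensity_ofReal hg.2
  have := isFiniteMeasure_withDensity_ofReal hg.neg.2
  rw [withDensityᵥ_eq_withDensity_pos_part_sub_withDensity_neg_part hf,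
    withDensityᵥ_eq_withDensity_pos_part_sub_withDensity_neg_part hg, sub_eq_sub_iff_add_eq_add,
    ← Measure.toSignedMeasure_add, ← Measure.toSignedMeasure_add,
    Measure.toSignedMeasure_eq_toSignedMeasure_iff] at h
  have h' := congrArg (fun M => charFun M u) h
  rw [charFun_add, charFun_add, ← sub_eq_sub_iff_add_eq_add,
    charFun_withDensity_sub hf, charFun_withDensity_sub hg] at h'
  exact h'

/-- Convolution with a probability averages translates, and Lebesgue measure is translation
invariant, so the density bound survives. -/
theorem conv_le_smul_volume {M P : Measure ℝ} [IsProbabilityMeasure P] [SFinite M] {c : ℝ≥0∞}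
    (hM : M ≤ c • volume) : P.conv M ≤ c • (volume : Measure ℝ) := by
  refine Measure.le_iff.2 fun s hs => ?_
  rw [← lintegral_indicator_one hs, Measure.lintegral_conv (measurable_one.indicator hs)]
  calc ∫⁻ x, ∫⁻ y, s.indicator 1 (x + y) ∂M ∂P
      ≤ ∫⁻ x, (c • volume : Measure ℝ) s ∂P := by
        refine lintegral_mono fun x => ?_
        calc ∫⁻ y, s.indicator 1 (x + y) ∂M
            ≤ ∫⁻ y, s.indicator 1 (x + y) ∂(c • volume : Measure ℝ) :=
              lintegral_mono' hM le_rfl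
          _ = (c • volume : Measure ℝ) s := by
              rw [lintegral_smul_measure, lintegral_add_left_eq_self (fun y => s.indicator 1 y),
                lintegral_indicator_one hs]
              simp
    _ = _ := by simp

/-- Away from the drift point the law of the increments has a density bounded by
`c / |x - a|`. -/
theorem IsIncrementLaw.exists_withDensity_le {Δ γ ε : ℝ} {ν P : Measure ℝ}
    (hP : IsIncrementLaw Δ γ ν P) (h : RegularityCondition Δ γ ν ε) (hε : 0 < ε) :
    ∃ c : ℝ, 0 ≤ c ∧ P.withDensity (fun x => ‖x - γ * Δ‖ₑ) ≤ ENNReal.ofReal c • volume := by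
  have := hP.isProbabilityMeasure
  have h1 := h.integrable_id
  have hP2 := hP.integrable_sq h1 (h.integrable_sq hε)
  obtain ⟨k, hkm, hki, ⟨C, hC⟩, hk⟩ := h.bounded_density
  have hC0 : 0 ≤ C := (abs_nonneg _).trans (hC 0)
  have hPm : MemLp (id : ℝ → ℝ) 2 P := (memLp_two_iff_integrable_sq (by fun_prop)).2 hP2
  have hP1 : Integrable (fun x : ℝ => x) P := hPm.integrable one_le_two
  have hPa : Integrable (fun x : ℝ => x - γ * Δ) P := hP1.sub (integrable_const _)
  set K : ℝ → ℝ := fun x => Δ * k x with hK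
  have hKi : Integrable K := hki.const_mul Δ
  -- The equation `φ' = iΔ(γ + F[xν]) φ` written as the Fourier side of `(x - γΔ) P = P * (Δ x ν)`,
  -- where `Δ x ν` has the bounded density `K`.
  have key : ∀ u : ℝ, ∫ x : ℝ, Complex.exp (Complex.I * u * x) * ((x - γ * Δ : ℝ) : ℂ) ∂P
      = charFun P u * ∫ x : ℝ, Complex.exp (Complex.I * u * x) * (K x : ℂ) := fun u => by
    have d1 : deriv (charFun P) u = Complex.I * ∫ x : ℝ, x * Complex.exp (u * x * Complex.I) ∂P := by
      have := iteratedDeriv_charFun (μ := P) (n := 1) (t := u) (by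
        exact_mod_cast hPm.mono_exponent one_le_two)
      simpa using this
    have d2 : deriv (charFun P) u
        = Complex.I * (Δ * (γ + weightedCharFun ν u)) * levyCharFun Δ γ ν u := by
      rw [show charFun P = levyCharFun Δ γ ν from funext hP.charFun_eq]
      exact (hasDerivAt_levyCharFun h1 Δ γ u).deriv
    have d3 : weightedCharFun ν u = ∫ x : ℝ, Complex.exp (Complex.I * u * x) * (k x : ℂ) :=
      integral_exp_mul_eq_of_withDensityᵥ_eq h1 hki hk u
    have e1 : ∫ x : ℝ, Complex.exp (Complex.I * u * x) * (K x : ℂ) = Δ * weightedCharFun ν u := by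
      rw [d3, ← integral_const_mul]
      congr 1
      ext x
      rw [hK]
      push_cast
      ring
    have i0 : Integrable (fun x : ℝ => Complex.exp (u * x * Complex.I)) P := by
      refine (integrable_const (1 : ℝ)).mono' (by fun_prop) (ae_of_all _ fun x => ?_)
      rw [← Complex.ofReal_mul, Complex.norm_exp_ofReal_mul_I]
    have i1 : Integrable (fun x : ℝ => (x : ℂ) * Complex.exp (u * x * Complex.I)) P := by
      refine hP1.abs.mono' (f := fun x : ℝ => (x : ℂ) * Complex.exp (u * x * Complex.I))
        (by fun_prop) (ae_of_all _ fun x => ?_)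
      rw [norm_mul, ← Complex.ofReal_mul, Complex.norm_exp_ofReal_mul_I, mul_one,
        Complex.norm_real, Real.norm_eq_abs]
    have e2 : ∫ x : ℝ, Complex.exp (Complex.I * u * x) * ((x - γ * Δ : ℝ) : ℂ) ∂P
        = (∫ x : ℝ, x * Complex.exp (u * x * Complex.I) ∂P) - γ * Δ * charFun P u := by
      rw [charFun_apply_real, ← integral_const_mul, ← integral_sub i1 (i0.const_mul _)]
      congr 1
      ext x
      rw [show Complex.I * u * x = u * x * Complex.I by ring]
      push_cast
      ring
    rw [e2, e1, hP.charFun_eq]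
    have := d1.symm.trans d2
    have h3 : ∫ x : ℝ, x * Complex.exp (u * x * Complex.I) ∂P
        = (Δ * (γ + weightedCharFun ν u)) * levyCharFun Δ γ ν u := by
      apply mul_left_cancel₀ Complex.I_ne_zero
      rw [this]
      ring
    rw [h3]
    ring
  have f1 := isFiniteMeasure_withDensity_ofReal hPa.2
  have f2 := isFiniteMeasure_withDensity_ofReal hPa.neg.2
  have f3 := isFiniteMeasure_withDensity_ofReal hKi.2
  have f4 := isFiniteMeasure_withDensity_ofReal hKi.neg.2
  simp only [Pi.neg_apply] at f2 f4
  set Ap := P.withDensity fun x => ENNReal.ofReal (x - γ * Δ) with hAp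
  set Am := P.withDensity fun x => ENNReal.ofReal (-(x - γ * Δ)) with hAm
  set Kp := (volume : Measure ℝ).withDensity fun x => ENNReal.ofReal (K x) with hKp
  set Km := (volume : Measure ℝ).withDensity fun x => ENNReal.ofReal (-K x) with hKm
  -- The same convolution identity with the negative parts moved across, so that both sides are
  -- finite positive measures determined by their characteristic functions.
  have hmeas : Ap + P.conv Km = P.conv Kp + Am := by
    refine Measure.ext_of_charFun (funext fun u => ?_)
    rw [charFun_add, charFun_add,
      ← sub_eq_sub_iff_add_eq_add, charFun_conv, charFun_conv, ← mul_sub,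
      charFun_withDensity_sub hPa, charFun_withDensity_sub hKi]
    exact key u
  set c := ENNReal.ofReal (|Δ| * C) with hc
  have hKb : ∀ f : ℝ → ℝ, (∀ x, f x ≤ |Δ| * C) →
      (volume : Measure ℝ).withDensity (fun x => ENNReal.ofReal (f x)) ≤ c • volume := fun f hf => by
    rw [← withDensity_const]
    exact withDensity_mono (ae_of_all _ fun x => ENNReal.ofReal_le_ofReal (hf x))
  have hKabs : ∀ x, |K x| ≤ |Δ| * C := fun x => by
    rw [hK, abs_mul]
    gcongr
    exact hC x
  have bp : P.conv Kp ≤ c • volume :=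
    conv_le_smul_volume (hKb _ fun x => (le_abs_self _).trans (hKabs x))
  have bm : P.conv Km ≤ c • volume :=
    conv_le_smul_volume (hKb _ fun x => (neg_le_abs _).trans (hKabs x))
  have zp : ∀ s, MeasurableSet s → s ⊆ Set.Iic (γ * Δ) → Ap s = 0 := fun s hs hsub => by
    rw [hAp, withDensity_apply _ hs, setLIntegral_congr_fun (g := fun _ => 0) hs fun x hx =>
      ENNReal.ofReal_of_nonpos (sub_nonpos.2 (hsub hx))]
    simp
  have zm : ∀ s, MeasurableSet s → s ⊆ Set.Ici (γ * Δ) → Am s = 0 := fun s hs hsub => by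
    rw [hAm, withDensity_apply _ hs, setLIntegral_congr_fun (g := fun _ => 0) hs fun x hx =>
      ENNReal.ofReal_of_nonpos (neg_nonpos.2 (sub_nonneg.2 (hsub hx)))]
    simp
  refine ⟨|Δ| * C, by positivity, Measure.le_iff.2 fun s hs => ?_⟩
  have hsplit : P.withDensity (fun x => ‖x - γ * Δ‖ₑ) = Ap + Am := by
    rw [hAp, hAm, ← withDensity_add_left (by fun_prop)]
    congr 1
    ext x
    rw [Pi.add_apply]
    rcases le_total 0 (x - γ * Δ) with h | h
    · rw [ENNReal.ofReal_of_nonpos (neg_nonpos.2 h), add_zero, Real.enorm_of_nonneg h]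
    · rw [ENNReal.ofReal_of_nonpos h, zero_add, ← Real.enorm_of_nonneg (neg_nonneg.2 h), enorm_neg]
  have m1 : MeasurableSet (s ∩ Set.Ioi (γ * Δ)) := hs.inter measurableSet_Ioi
  have m2 : MeasurableSet (s \ Set.Ioi (γ * Δ)) := hs.diff measurableSet_Ioi
  have s1 : s ∩ Set.Ioi (γ * Δ) ⊆ Set.Ici (γ * Δ) := fun x hx => Set.mem_Ici.2 (le_of_lt hx.2)
  have s2 : s \ Set.Ioi (γ * Δ) ⊆ Set.Iic (γ * Δ) := fun x hx => Set.mem_Iic.2 (not_lt.1 hx.2)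
  -- To the right of `γΔ` the negative part `Am` vanishes, so there `Ap` is at most the convolution
  -- with `Kp`; the left side is symmetric.
  have c1 : Ap (s ∩ Set.Ioi (γ * Δ)) ≤ (c • volume : Measure ℝ) (s ∩ Set.Ioi (γ * Δ)) := by
    have := congrArg (fun M : Measure ℝ => M (s ∩ Set.Ioi (γ * Δ))) hmeas
    simp only [Measure.add_apply, zm _ m1 s1, add_zero] at this
    exact (le_self_add.trans this.le).trans (bp _)
  have c2 : Am (s \ Set.Ioi (γ * Δ)) ≤ (c • volume : Measure ℝ) (s \ Set.Ioi (γ * Δ)) := by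
    have := congrArg (fun M : Measure ℝ => M (s \ Set.Ioi (γ * Δ))) hmeas
    simp only [Measure.add_apply, zp _ m2 s2, zero_add] at this
    exact (le_add_self.trans this.ge).trans (bm _)
  rw [hsplit, Measure.add_apply, ← measure_inter_add_sdiff (μ := Ap) s measurableSet_Ioi,
    ← measure_inter_add_sdiff (μ := Am) s measurableSet_Ioi (t := Set.Ioi (γ * Δ)),
    ← measure_inter_add_sdiff (μ := c • volume) s (measurableSet_Ioi (a := γ * Δ)), zp _ m2 s2,
    zm _ m1 s1, add_zero, zero_add]
  exact add_le_add c1 c2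

/-- On this set `|x - γΔ| ≥ δ`, so dividing the bounded density of `|x - γΔ| P` costs `1/δ`. The
constant `c` is uniform in `δ`, which matters when `δ` grows with `|t|`. -/
theorem IsIncrementLaw.exists_restrict_le {Δ γ ε : ℝ} {ν P : Measure ℝ}
    (hP : IsIncrementLaw Δ γ ν P) (h : RegularityCondition Δ γ ν ε) (hε : 0 < ε) :
    ∃ c : ℝ, 0 ≤ c ∧ ∀ δ > 0,
      P.restrict {x | δ ≤ |x - γ * Δ|} ≤ ENNReal.ofReal (c / δ) • volume := by
  obtain ⟨c, hc, hle⟩ := hP.exists_withDensity_le h hε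
  refine ⟨c, hc, fun δ hδ => Measure.le_iff.2 fun s hs => ?_⟩
  have hm : MeasurableSet {x : ℝ | δ ≤ |x - γ * Δ|} :=
    measurableSet_le measurable_const (by fun_prop)
  rw [Measure.restrict_apply hs]
  have h1 : ENNReal.ofReal δ * P (s ∩ {x | δ ≤ |x - γ * Δ|}) ≤ ENNReal.ofReal c * volume s := by
    calc ENNReal.ofReal δ * P (s ∩ {x | δ ≤ |x - γ * Δ|})
        = ∫⁻ x in s ∩ {x | δ ≤ |x - γ * Δ|}, ENNReal.ofReal δ ∂P := by
          rw [setLIntegral_const]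
      _ ≤ ∫⁻ x in s ∩ {x | δ ≤ |x - γ * Δ|}, ‖x - γ * Δ‖ₑ ∂P := by
          refine setLIntegral_mono (by fun_prop) fun x hx => ?_
          rw [← ofReal_norm]
          exact ENNReal.ofReal_le_ofReal hx.2
      _ = P.withDensity (fun x => ‖x - γ * Δ‖ₑ) (s ∩ {x | δ ≤ |x - γ * Δ|}) := by
          rw [withDensity_apply _ (hs.inter hm)]
      _ ≤ (ENNReal.ofReal c • volume : Measure ℝ) (s ∩ {x | δ ≤ |x - γ * Δ|}) := hle _
      _ ≤ (ENNReal.ofReal c • volume : Measure ℝ) s := measure_mono Set.inter_subset_left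
      _ = _ := by simp
  rw [Measure.smul_apply, smul_eq_mul, ENNReal.ofReal_div_of_pos hδ]
  rw [mul_comm, ← ENNReal.le_div_iff_mul_le (Or.inl (by simpa using hδ))
    (Or.inl ENNReal.ofReal_ne_top)] at h1
  refine h1.trans (le_of_eq ?_)
  rw [div_eq_mul_inv, div_eq_mul_inv]
  ring

/-- Applied at `γΔ + t`, the only point where `h_t` may be singular, it shows that this point is
irrelevant for `L²(P)`. An atom at `γΔ` is possible, and there `h_t` is continuous. -/
theorem IsIncrementLaw.measure_singleton {Δ γ ε : ℝ} {ν P : Measure ℝ}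
    (hP : IsIncrementLaw Δ γ ν P) (h : RegularityCondition Δ γ ν ε) (hε : 0 < ε) {x : ℝ}
    (hx : x ≠ γ * Δ) : P {x} = 0 := by
  obtain ⟨c, hc, hle⟩ := hP.exists_restrict_le h hε
  have h1 := hle |x - γ * Δ| (abs_pos.2 (sub_ne_zero.2 hx)) {x}
  rw [Measure.restrict_apply (measurableSet_singleton x), Set.inter_eq_left.2 (by simp)] at h1
  simpa using h1

end LevyDonsker
end

noncomputable section

namespace LevyDonsker
open scoped SchwartzMap ENNReal ContDiff ComplexConjugate

/-! ### The influence functions -/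

theorem memLp_comp_mul_left {g : ℝ → ℂ} (hg : MemLp g 2 volume) {c : ℝ} (hc : c ≠ 0) :
    MemLp (fun u => g (c * u)) 2 volume := by
  have h := Real.map_volume_mul_left hc
  have h2 : MemLp g 2 (Measure.map (c * ·) volume) := by
    rw [h]
    exact hg.smul_measure ENNReal.ofReal_ne_top
  exact h2.comp_of_map (by fun_prop)

/-- Averages see only the Lebesgue class, so they converge to the value of any representative
continuous at the point. This makes `preciseRep` computable at a possible atom of `P`. -/
theorem tendsto_ballAverage {f g : ℝ → ℂ} (hfg : f =ᵐ[volume] g)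
    (hg : LocallyIntegrable g volume) {x : ℝ} (hx : ContinuousAt g x) :
    Tendsto (ballAverage f x) (𝓝[>] (0 : ℝ)) (𝓝 (g x)) := by
  rw [Metric.tendsto_nhdsWithin_nhds]
  intro η hη
  obtain ⟨δ, hδ, hgδ⟩ := Metric.continuousAt_iff.1 hx (η / 2) (by positivity)
  refine ⟨δ, hδ, fun r hr hrδ => ?_⟩
  have hr0 : 0 < r := hr
  rw [Real.dist_eq, sub_zero, abs_of_pos hr0] at hrδ
  have e : ballAverage f x r = ⨍ y in Metric.closedBall x r, g y :=
    average_congr (ae_restrict_of_ae hfg)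
  rw [e]
  refine lt_of_le_of_lt ?_ (half_lt_self hη)
  refine Convex.set_average_mem (convex_closedBall (g x) (η / 2)) Metric.isClosed_closedBall
    ?_ ?_ ?_ (hg.integrableOn_isCompact (isCompact_closedBall x r))
  · exact (Metric.measure_closedBall_pos volume x hr0).ne'
  · exact measure_closedBall_lt_top.ne
  · refine (ae_restrict_iff' measurableSet_closedBall).2 (ae_of_all _ fun y hy => ?_)
    exact (hgδ (lt_of_le_of_lt hy hrδ)).le

theorem fourierInvL2_eq {f g : ℝ → ℂ} (e : (fun v => f (2 * Real.pi * v)) = g)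
    (hg : MemLp g 2 volume) :
    fourierInvL2 f = fun x => (𝓕 (hg.toLp g) : Lp ℂ 2 (volume : Measure ℝ)) x := by
  subst e
  rw [fourierInvL2, dif_pos hg]

theorem fourierL2_gFun_eq {t σ : ℝ} (hσ : |σ| = 1) (ht : 0 < σ * t) (v : ℝ) :
    fourierL2 (gFun t) (2 * Real.pi * v)
      = (𝓕⁻ ((memLp_gFun hσ ht).toLp _) : Lp ℂ 2 (volume : Measure ℝ)) v := by
  rw [fourierL2, dif_pos (memLp_gFun hσ ht)]
  congr 1
  have := Real.pi_pos
  field_simp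

theorem deriv_inv_levyCharFun {ν : Measure ℝ} (h1 : Integrable (fun x : ℝ => x) ν)
    (Δ γ v : ℝ) : deriv (fun v : ℝ => (levyCharFun Δ γ ν v)⁻¹) (-(2 * Real.pi * v))
      = -(2 * Real.pi : ℂ)⁻¹ * levySymbolDeriv Δ γ ν v := by
  have hne := levyCharFun_ne_zero Δ γ ν (-(2 * Real.pi * v))
  have h2 := ((hasDerivAt_levyCharFun h1 Δ γ (-(2 * Real.pi * v))).inv hne).deriv
  rw [show (fun v : ℝ => (levyCharFun Δ γ ν v)⁻¹) = (levyCharFun Δ γ ν)⁻¹ from rfl, h2,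
    levySymbolDeriv,
    levySymbol]
  have hpi : (Real.pi : ℂ) ≠ 0 := by exact_mod_cast Real.pi_ne_zero
  field_simp

section

variable {Δ γ ε : ℝ} {ν : Measure ℝ} (h : RegularityCondition Δ γ ν ε) (hε : 0 < ε)
  {t σ : ℝ} (hσ : |σ| = 1) (ht : 0 < σ * t)
include h hε hσ ht

theorem RegularityCondition.memLp_mult₁_comp : MemLp (fun v => levySymbol Δ γ ν v *
    (𝓕⁻ ((memLp_gFun hσ ht).toLp _) : Lp ℂ 2 (volume : Measure ℝ)) v) 2 volume :=
  (h.isDeconvSymbol hε).memLp_mul_fourierInv_gFun (h.isDeconvSymbol hε).continuous (K := 1)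
    (fun v => by rw [one_mul]) hσ ht

theorem RegularityCondition.memLp_mult₂_comp : MemLp (fun v => levySymbolDeriv Δ γ ν v *
    (𝓕⁻ ((memLp_gFun hσ ht).toLp _) : Lp ℂ 2 (volume : Measure ℝ)) v) 2 volume := by
  obtain ⟨C, hC0, hC⟩ := (h.isDeconvSymbol hε).exists_norm_deriv_le
  exact (h.isDeconvSymbol hε).memLp_mul_fourierInv_gFun (h.isDeconvSymbol hε).continuous_deriv
    hC hσ ht

/-- The passage `u = 2πv` between the two Fourier conventions. The factor `-(2π)⁻¹` in front of
`levySymbolDeriv` is the chain rule for `v ↦ φ⁻¹(-2πv)`. -/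
theorem RegularityCondition.hClass_ae_eq_stepKernel : hClass Δ γ ν t =ᵐ[volume] fun x =>
    Complex.I * stepKernel (levySymbol Δ γ ν) (levySymbolDeriv Δ γ ν) (γ * Δ) σ (x - t) := by
  have m₁ := h.memLp_mult₁_comp hε hσ ht
  have m₂ := h.memLp_mult₂_comp hε hσ ht
  have e₁ : (fun v => mult₁ Δ γ ν t (2 * Real.pi * v)) = fun v => levySymbol Δ γ ν v *
      (𝓕⁻ ((memLp_gFun hσ ht).toLp _) : Lp ℂ 2 (volume : Measure ℝ)) v := by
    ext v
    rw [mult₁, fourierL2_gFun_eq hσ ht, levySymbol]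
  have e₂ : (fun v => mult₂ Δ γ ν t (2 * Real.pi * v)) = (-(2 * Real.pi : ℂ)⁻¹) • fun v =>
      levySymbolDeriv Δ γ ν v *
      (𝓕⁻ ((memLp_gFun hσ ht).toLp _) : Lp ℂ 2 (volume : Measure ℝ)) v := by
    ext v
    rw [mult₂, fourierL2_gFun_eq hσ ht, deriv_inv_levyCharFun h.integrable_id, Pi.smul_apply,
      smul_eq_mul, mul_assoc]
  have hsm : 𝓕 ((m₂.const_smul (-(2 * Real.pi : ℂ)⁻¹)).toLp _)
      = (-(2 * Real.pi : ℂ)⁻¹) • (𝓕 (m₂.toLp _) : Lp ℂ 2 (volume : Measure ℝ)) := by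
    rw [MemLp.toLp_const_smul, FourierTransform.fourier_smul]
  refine EventuallyEq.trans ?_ ((h.isDeconvSymbol hε).hClass_ae_eq hσ ht m₁ m₂)
  filter_upwards [Lp.coeFn_smul (-(2 * Real.pi : ℂ)⁻¹)
    (𝓕 (m₂.toLp _) : Lp ℂ 2 (volume : Measure ℝ))] with x hx
  rw [hClass, fourierInvL2_eq e₁ m₁, fourierInvL2_eq e₂ (m₂.const_smul _), hsm]
  beta_reduce
  rw [hx, Pi.smul_apply, smul_eq_mul]
  ring

theorem RegularityCondition.tendsto_ballAverage_hClass {x : ℝ} (hx : x ≠ γ * Δ + t) :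
    Tendsto (ballAverage (hClass Δ γ ν t) x) (𝓝[>] (0 : ℝ)) (𝓝 (Complex.I *
      stepKernel (levySymbol Δ γ ν) (levySymbolDeriv Δ γ ν) (γ * Δ) σ (x - t))) := by
  have hσ0 : σ ≠ 0 := by rintro rfl; simp at hσ
  refine tendsto_ballAverage (h.hClass_ae_eq_stepKernel hε hσ ht)
    (((h.isDeconvSymbol hε).locallyIntegrable_stepKernel hσ0).smul Complex.I) ?_
  have h1 : ContinuousAt (stepKernel (levySymbol Δ γ ν) (levySymbolDeriv Δ γ ν) (γ * Δ) σ)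
      (x - t) := (h.isDeconvSymbol hε).continuousAt_stepKernel hσ0
        (fun e => hx (by rw [← e]; ring))
  exact continuousAt_const.mul (Complex.continuous_ofReal.continuousAt.comp
    (ContinuousAt.comp (f := fun x => x - t) h1 (by fun_prop)))

theorem RegularityCondition.hFun_eq {x : ℝ} (hx : x ≠ γ * Δ + t) :
    hFun Δ γ ν t x = Complex.I *
      stepKernel (levySymbol Δ γ ν) (levySymbolDeriv Δ γ ν) (γ * Δ) σ (x - t) :=
  (h.tendsto_ballAverage_hClass hε hσ ht hx).limUnder_eq

end

section

variable {b b' : ℝ → ℂ} {a ε : ℝ} (h : IsDeconvSymbol b b' a ε)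
include h

/-- Away from `a` the law is dominated by Lebesgue measure and the kernel is in `L²(dx)`. Within
`|t|/2` of `a`, where `P` may be singular, the argument `x - t` stays `|t|/2` away from `a` and the
kernel is bounded. -/
theorem IsDeconvSymbol.memLp_stepKernel_comp_sub {P : Measure ℝ} [IsProbabilityMeasure P] {c : ℝ}
    (hP : ∀ δ > 0, P.restrict {x | δ ≤ |x - a|} ≤ ENNReal.ofReal (c / δ) • volume)
    {t σ : ℝ} (hσ : σ ≠ 0) (ht : t ≠ 0) :
    MemLp (fun x => stepKernel b b' a σ (x - t)) 2 P := by
  have ht' : 0 < |t| / 2 := by positivity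
  obtain ⟨M, hM0, hM⟩ := h.exists_abs_setIntegral_kernel_le
  obtain ⟨C, -, hC⟩ := exists_norm_fourier_remainder_le b b' a
  have hs : MeasurableSet {x : ℝ | |t| / 2 ≤ |x - a|} :=
    measurableSet_le measurable_const (by fun_prop)
  have m1 : MemLp (fun x => kernel b b' a (x - t)) 2 P := by
    have e : (fun x => kernel b b' a (x - t))
        = {x : ℝ | |t| / 2 ≤ |x - a|}.indicator (fun x => kernel b b' a (x - t))
          + {x : ℝ | |t| / 2 ≤ |x - a|}ᶜ.indicator (fun x => kernel b b' a (x - t)) :=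
      (Set.indicator_self_add_compl _ _).symm
    rw [e]
    refine MemLp.add ?_ ?_
    · rw [memLp_indicator_iff_restrict hs]
      refine MemLp.mono_measure (hP _ ht') (MemLp.smul_measure ?_ ENNReal.ofReal_ne_top)
      exact h.memLp_kernel.comp_measurePreserving (measurePreserving_sub_right volume t)
    · refine MemLp.of_bound ((h.measurable_kernel.comp (measurable_id.sub_const t)).indicator
        hs.compl).aestronglyMeasurable (|C| / (|t| / 2)) (ae_of_all _ fun x => ?_)
      by_cases hx : x ∈ {x : ℝ | |t| / 2 ≤ |x - a|}ᶜ
      · rw [Set.indicator_of_mem hx]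
        have hx' : |x - a| < |t| / 2 := not_le.1 hx
        have h2 : |t| / 2 ≤ |x - t - a| := by
          have : |t| ≤ |x - a| + |x - t - a| := by
            calc |t| = |(x - a) - (x - t - a)| := by congr 1; ring
              _ ≤ _ := abs_sub _ _
          linarith
        rw [kernel, norm_div, Real.norm_eq_abs, Real.norm_eq_abs]
        exact div_le_div₀ (abs_nonneg C)
          ((Complex.abs_re_le_norm _).trans ((hC _).trans (le_abs_self C))) ht' h2
      · rw [Set.indicator_of_notMem hx, norm_zero]
        positivity
  have m2 : MemLp (fun x => ∫ z in {z | 0 ≤ σ * (x - t - z)}, kernel b b' a z) 2 P := by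
    refine MemLp.of_bound ?_ M (ae_of_all _ fun x => hM σ (x - t))
    exact ((h.continuous_setIntegral_kernel hσ).comp (by fun_prop :
      Continuous fun x : ℝ => x - t)).aestronglyMeasurable
  exact (m1.const_mul σ).add m2

end

/-- The real function `-i h_t`. -/
def influence (Δ γ : ℝ) (ν : Measure ℝ) (t x : ℝ) : ℝ :=
  stepKernel (levySymbol Δ γ ν) (levySymbolDeriv Δ γ ν) (γ * Δ) (SignType.sign t) (x - t)

theorem abs_sign_eq_one {t : ℝ} (ht : t ≠ 0) : |((SignType.sign t : SignType) : ℝ)| = 1 := by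
  rcases lt_or_gt_of_ne ht with h | h
  · simp [sign_neg h]
  · simp [sign_pos h]

theorem sign_mul_pos {t : ℝ} (ht : t ≠ 0) : 0 < ((SignType.sign t : SignType) : ℝ) * t := by
  rw [sign_mul_self]
  exact abs_pos.2 ht

section

variable {Δ γ ε : ℝ} {ν P : Measure ℝ} (hP : IsIncrementLaw Δ γ ν P)
  (h : RegularityCondition Δ γ ν ε) (hε : 0 < ε)
include hP h hε

theorem IsIncrementLaw.hFun_ae_eq {t : ℝ} (ht : t ≠ 0) :
    hFun Δ γ ν t =ᵐ[P] fun x => Complex.I * influence Δ γ ν t x := by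
  have h0 : P {γ * Δ + t} = 0 := hP.measure_singleton h hε (by simpa using ht)
  filter_upwards [compl_mem_ae_iff.2 h0] with x hx
  exact h.hFun_eq hε (abs_sign_eq_one ht) (sign_mul_pos ht) hx

theorem IsIncrementLaw.memLp_influence {t : ℝ} (ht : t ≠ 0) :
    MemLp (influence Δ γ ν t) 2 P := by
  have := hP.isProbabilityMeasure
  obtain ⟨c, hc, hle⟩ := hP.exists_restrict_le h hε
  exact (h.isDeconvSymbol hε).memLp_stepKernel_comp_sub hle
    (abs_ne_zero.1 (by rw [abs_sign_eq_one ht]; exact one_ne_zero)) ht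

theorem IsIncrementLaw.hWellDefined {t : ℝ} (ht : t ≠ 0) : HWellDefined Δ γ ν P t where
  memLp_g := memLp_gFun (abs_sign_eq_one ht) (sign_mul_pos ht)
  memLp_mult₁ := by
    have h1 := memLp_comp_mul_left (c := (2 * Real.pi)⁻¹)
      (h.memLp_mult₁_comp hε (abs_sign_eq_one ht) (sign_mul_pos ht))
      (inv_ne_zero (by have := Real.pi_pos; positivity))
    convert h1 using 2 with u
    rw [← fourierL2_gFun_eq (abs_sign_eq_one ht) (sign_mul_pos ht), mul_inv_cancel_left₀ (by have := Real.pi_pos; positivity), levySymbol,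
      mul_inv_cancel_left₀ (by have := Real.pi_pos; positivity), mult₁]
  memLp_mult₂ := by
    have h1 := (memLp_comp_mul_left (c := (2 * Real.pi)⁻¹)
      (h.memLp_mult₂_comp hε (abs_sign_eq_one ht) (sign_mul_pos ht))
      (inv_ne_zero (by have := Real.pi_pos; positivity))).const_mul (-(2 * Real.pi : ℂ)⁻¹)
    convert h1 using 2 with u
    rw [← fourierL2_gFun_eq (abs_sign_eq_one ht) (sign_mul_pos ht), mul_inv_cancel_left₀ (by have := Real.pi_pos; positivity),
      ← mul_assoc, ← deriv_inv_levyCharFun h.integrable_id,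
      mul_inv_cancel_left₀ (by have := Real.pi_pos; positivity), mult₂]
  tendsto := by
    have h0 : P {γ * Δ + t} = 0 := hP.measure_singleton h hε (by simpa using ht)
    filter_upwards [compl_mem_ae_iff.2 h0] with x hx
    rw [h.hFun_eq hε (abs_sign_eq_one ht) (sign_mul_pos ht) hx]
    exact h.tendsto_ballAverage_hClass hε (abs_sign_eq_one ht) (sign_mul_pos ht) hx
  memLp := by
    refine MemLp.ae_eq (hP.hFun_ae_eq h hε ht).symm ?_
    exact (hP.memLp_influence h hε ht).ofReal.const_mul Complex.I

/-- The two factors `i` of `h_t` and `h_s` cancel the `i⁻²` in the normalisation, so the covariance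
is a real Gram matrix in `L²(P)`. -/
theorem IsIncrementLaw.covSigma_eq {s t : ℝ} (hs : s ≠ 0) (ht : t ≠ 0) :
    covSigma Δ γ ν P t s
      = (((Δ ^ 2)⁻¹ * ∫ x, influence Δ γ ν t x * influence Δ γ ν s x ∂P : ℝ) : ℂ) := by
  have e : ∫ x, hFun Δ γ ν t x * hFun Δ γ ν s x ∂P
      = -((∫ x, influence Δ γ ν t x * influence Δ γ ν s x ∂P : ℝ) : ℂ) := by
    rw [← integral_complex_ofReal, ← integral_neg]
    refine integral_congr_ae ?_
    filter_upwards [hP.hFun_ae_eq h hε ht, hP.hFun_ae_eq h hε hs] with x hx hx'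
    rw [hx, hx']
    push_cast
    linear_combination (influence Δ γ ν t x * influence Δ γ ν s x : ℂ) * Complex.I_sq
  rw [covSigma, e, mul_pow, Complex.I_sq]
  push_cast
  rw [neg_one_mul, inv_neg, neg_mul_neg]

end

end LevyDonsker
end

noncomputable section

namespace LevyDonsker
open scoped SchwartzMap ENNReal ContDiff ComplexConjugate

/-! ### Moduli in `L²(P)` -/

theorem add_sq_le_two_mul (x y : ℝ) : (x + y) ^ 2 ≤ 2 * (x ^ 2 + y ^ 2) := by
  nlinarith [sq_nonneg (x - y)]

theorem sq_rpow_half_le {x M h : ℝ} (hh : 0 ≤ h) (hx : |x| ≤ M * h ^ (1 / 2 : ℝ)) :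
    x ^ 2 ≤ M ^ 2 * h := by
  have h1 : |x| ^ 2 ≤ (M * h ^ (1 / 2 : ℝ)) ^ 2 := pow_le_pow_left₀ (abs_nonneg x) hx 2
  rwa [sq_abs, mul_pow, ← Real.rpow_natCast (h ^ (1 / 2 : ℝ)), ← Real.rpow_mul hh,
    show (1 / 2 : ℝ) * ((2 : ℕ) : ℝ) = 1 by norm_num, Real.rpow_one] at h1

theorem setIntegral_le_of_restrict_le {P : Measure ℝ} {s : Set ℝ} {c : ℝ} (hc : 0 ≤ c)
    (hP : P.restrict s ≤ ENNReal.ofReal c • volume) {f : ℝ → ℝ} (hf : Integrable f volume)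
    (h0 : ∀ x, 0 ≤ f x) : IntegrableOn f s P ∧ ∫ x in s, f x ∂P ≤ c * ∫ x, f x := by
  have hi : Integrable f (ENNReal.ofReal c • volume) := hf.smul_measure ENNReal.ofReal_ne_top
  refine ⟨hi.mono_measure hP, ?_⟩
  calc ∫ x in s, f x ∂P ≤ ∫ x, f x ∂(ENNReal.ofReal c • volume : Measure ℝ) :=
        integral_mono_measure hP (ae_of_all _ h0) hi
    _ = c * ∫ x, f x := by
        rw [integral_smul_measure, ENNReal.toReal_ofReal hc, smul_eq_mul]

theorem setIntegral_le_of_forall_le {P : Measure ℝ} [IsProbabilityMeasure P] {s : Set ℝ}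
    (hs : MeasurableSet s) {f : ℝ → ℝ} {C : ℝ} (h0 : ∀ x, 0 ≤ f x)
    (hf : ∀ x ∈ s, f x ≤ C) : ∫ x in s, f x ∂P ≤ C * P.real s := by
  have h1 : ∫ x in s, f x ∂P ≤ ∫ x in s, C ∂P := by
    refine integral_mono_of_nonneg (ae_of_all _ h0) (integrable_const C) ?_
    exact (ae_restrict_iff' hs).2 (ae_of_all _ hf)
  rwa [setIntegral_const, smul_eq_mul, mul_comm] at h1

section

variable {b b' : ℝ → ℂ} {a ε : ℝ} (h : IsDeconvSymbol b b' a ε) {P : Measure ℝ}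
  [IsProbabilityMeasure P] {c : ℝ} (hc : 0 ≤ c)
  (hP : ∀ δ > 0, P.restrict {x | δ ≤ |x - a|} ≤ ENNReal.ofReal (c / δ) • volume)
include h hc hP

/-- Split at distance `ζ/2` from `a`. Inside, both shifted arguments are at distance at least `ζ/2`
from `a` and the Hölder bound is pointwise. Outside, `P` has bounded density and the `L²(dx)`
modulus of the kernel applies. As `2ε ≤ 1` and `|t - s| ≤ 1`, the exponent `2ε` is the weakest one.
-/
theorem IsDeconvSymbol.exists_integral_stepKernel_sub_sq_le {ζ : ℝ} (hζ : 0 < ζ) :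
    ∃ M, 0 ≤ M ∧ ∀ σ : ℝ, |σ| = 1 → ∀ s t : ℝ, ζ ≤ σ * s → ζ ≤ σ * t → |t - s| ≤ 1 →
      ∫ x, (stepKernel b b' a σ (x - t) - stepKernel b b' a σ (x - s)) ^ 2 ∂P
        ≤ M * |t - s| ^ (2 * ε) := by
  obtain ⟨M₁, hM₁0, hM₁⟩ := h.exists_stepKernel_sub_le (δ := ζ / 2) (by positivity)
  obtain ⟨M₂, hM₂0, hM₂⟩ := h.exists_integral_kernel_sub_sq_le
  obtain ⟨M₃, hM₃0, hM₃⟩ := h.exists_setIntegral_kernel_sub_le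
  refine ⟨M₁ ^ 2 + 2 * (c / (ζ / 2) * M₂ + M₃ ^ 2), by positivity, fun σ hσ s t hs ht hst => ?_⟩
  have hσ0 : σ ≠ 0 := by rintro rfl; simp at hσ
  have hbig : ∀ {t : ℝ}, ζ ≤ σ * t → ζ ≤ |t| := fun {t} ht => by
    have := ht.trans (le_abs_self _)
    rwa [abs_mul, hσ, one_mul] at this
  have ht0 : t ≠ 0 := fun e => by have := hbig ht; rw [e, abs_zero] at this; linarith
  have hs0 : s ≠ 0 := fun e => by have := hbig hs; rw [e, abs_zero] at this; linarith
  have hd : |t - s| ≤ |t - s| ^ (2 * ε) := by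
    rcases (abs_nonneg (t - s)).eq_or_lt with h0 | h0
    · rw [← h0]
      exact Real.rpow_nonneg le_rfl _
    · calc |t - s| = |t - s| ^ (1 : ℝ) := (Real.rpow_one _).symm
        _ ≤ _ := Real.rpow_le_rpow_of_exponent_ge h0 hst (by linarith [h.le_half])
  set A := {x : ℝ | ζ / 2 ≤ |x - a|} with hA
  have hAm : MeasurableSet A := measurableSet_le measurable_const (by fun_prop)
  set F : ℝ → ℝ := fun x => (stepKernel b b' a σ (x - t) - stepKernel b b' a σ (x - s)) ^ 2 with hF
  have hFi : Integrable F P := ((h.memLp_stepKernel_comp_sub hP hσ0 ht0).sub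
    (h.memLp_stepKernel_comp_sub hP hσ0 hs0)).integrable_sq
  have far : ∀ {t : ℝ}, ζ ≤ σ * t → ∀ x ∈ Aᶜ, ζ / 2 ≤ |x - t - a| := fun {t} ht x hx => by
    have hx' : |x - a| < ζ / 2 := not_le.1 hx
    have : |t| ≤ |x - a| + |x - t - a| := by
      calc |t| = |(x - a) - (x - t - a)| := by congr 1; ring
        _ ≤ _ := abs_sub _ _
    linarith [hbig ht]
  have near : ∫ x in Aᶜ, F x ∂P ≤ M₁ ^ 2 * |t - s| := by
    refine (setIntegral_le_of_forall_le (C := M₁ ^ 2 * |t - s|) hAm.compl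
      (fun x => sq_nonneg _) fun x hx => ?_).trans
      (mul_le_of_le_one_right (by positivity) measureReal_le_one)
    refine sq_rpow_half_le (abs_nonneg _) ?_
    have := hM₁ σ hσ (x - t) (x - s) (far ht x hx) (far hs x hx)
    rwa [show x - t - (x - s) = -(t - s) by ring, abs_neg] at this
  have hKi : Integrable fun x => (kernel b b' a (x - t) - kernel b b' a (x - s)) ^ 2 :=
    ((h.memLp_kernel.comp_measurePreserving (measurePreserving_sub_right volume t)).sub
      (h.memLp_kernel.comp_measurePreserving (measurePreserving_sub_right volume s))).integrable_sq
  obtain ⟨hKi', hKle⟩ := setIntegral_le_of_restrict_le (by positivity) (hP (ζ / 2) (by positivity))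
    hKi fun x => sq_nonneg _
  have hfar : ∫ x in A, F x ∂P ≤ 2 * (c / (ζ / 2) * (M₂ * |t - s| ^ (2 * ε)) + M₃ ^ 2 * |t - s|) := by
    calc ∫ x in A, F x ∂P
        ≤ ∫ x in A, 2 * ((kernel b b' a (x - t) - kernel b b' a (x - s)) ^ 2
            + M₃ ^ 2 * |t - s|) ∂P := by
          refine integral_mono hFi.integrableOn ((hKi'.add (integrable_const _)).const_mul 2)
            fun x => ?_
          set T := fun y : ℝ => ∫ z in {z | 0 ≤ σ * (y - z)}, kernel b b' a z with hT
          have e : F x = (σ * (kernel b b' a (x - t) - kernel b b' a (x - s))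
              + (T (x - t) - T (x - s))) ^ 2 := by
            simp only [hF, stepKernel, hT]
            ring
          rw [e]
          refine (add_sq_le_two_mul _ _).trans ?_
          have hσ2 : σ ^ 2 = 1 := by rw [← sq_abs, hσ, one_pow]
          rw [mul_pow, hσ2, one_mul]
          gcongr
          refine sq_rpow_half_le (abs_nonneg _) ?_
          have := hM₃ σ hσ0 (x - t) (x - s)
          rwa [show x - t - (x - s) = -(t - s) by ring, abs_neg] at this
      _ = 2 * ((∫ x in A, (kernel b b' a (x - t) - kernel b b' a (x - s)) ^ 2 ∂P)
            + P.real A * (M₃ ^ 2 * |t - s|)) := by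
          rw [integral_const_mul, integral_add hKi' (integrable_const _), setIntegral_const,
            smul_eq_mul]
      _ ≤ _ := by
          refine mul_le_mul_of_nonneg_left (add_le_add (hKle.trans ?_)
            (mul_le_of_le_one_left (by positivity) measureReal_le_one)) zero_le_two
          gcongr
          exact hM₂ s t
  rw [← integral_add_compl hAm hFi]
  calc _ ≤ 2 * (c / (ζ / 2) * (M₂ * |t - s| ^ (2 * ε)) + M₃ ^ 2 * |t - s| ^ (2 * ε))
        + M₁ ^ 2 * |t - s| ^ (2 * ε) :=
        add_le_add (hfar.trans (by gcongr)) (near.trans (by gcongr))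
    _ = _ := by ring

/-- Split at distance `|t|/2` from `a`. Inside, the step kernel is evaluated on its decaying side at
distance at least `|t|/2`. Outside, the density of `P` is `O(1/|t|)`, and so is the mass of the
region by Markov's inequality. -/
theorem IsDeconvSymbol.exists_integral_stepKernel_sq_le (hPi : Integrable (fun x : ℝ => x) P)
    {ζ : ℝ} (hζ : 0 < ζ) :
    ∃ M, 0 ≤ M ∧ ∀ σ : ℝ, |σ| = 1 → ∀ t : ℝ, ζ ≤ σ * t →
      ∫ x, stepKernel b b' a σ (x - t) ^ 2 ∂P ≤ M * |t|⁻¹ ^ (1 / 2 : ℝ) := by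
  obtain ⟨M₁, hM₁0, hM₁⟩ := h.exists_stepKernel_le (δ := ζ / 2) (by positivity)
  obtain ⟨M₂, hM₂0, hM₂⟩ := h.exists_abs_setIntegral_kernel_le
  set Q := ∫ z, kernel b b' a z ^ 2 with hQ
  have hQ0 : 0 ≤ Q := integral_nonneg fun z => sq_nonneg _
  set E := ∫ x, |x - a| ∂P with hE
  have hE0 : 0 ≤ E := integral_nonneg fun z => abs_nonneg _
  have hPa : Integrable (fun x => |x - a|) P := (hPi.sub (integrable_const a)).abs
  refine ⟨M₁ ^ 2 * (2 : ℝ) ^ (1 / 2 : ℝ)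
    + 2 * (2 * c * Q + M₂ ^ 2 * (2 * E)) * ζ⁻¹ ^ (1 / 2 : ℝ),
    by positivity, fun σ hσ t ht => ?_⟩
  have hσ0 : σ ≠ 0 := by rintro rfl; simp at hσ
  have htabs : σ * t = |t| := by
    rw [← abs_of_nonneg (hζ.le.trans ht), abs_mul, hσ, one_mul]
  have htζ : ζ ≤ |t| := htabs ▸ ht
  have htp : 0 < |t| := hζ.trans_le htζ
  have ht0 : t ≠ 0 := abs_pos.1 htp
  set A := {x : ℝ | |t| / 2 ≤ |x - a|} with hA
  have hAm : MeasurableSet A := measurableSet_le measurable_const (by fun_prop)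
  set F : ℝ → ℝ := fun x => stepKernel b b' a σ (x - t) ^ 2 with hF
  have hFi : Integrable F P := (h.memLp_stepKernel_comp_sub hP hσ0 ht0).integrable_sq
  have near : ∫ x in Aᶜ, F x ∂P ≤ M₁ ^ 2 * (2 * |t|⁻¹) ^ (1 / 2 : ℝ) := by
    refine (setIntegral_le_of_forall_le (C := M₁ ^ 2 * (2 * |t|⁻¹) ^ (1 / 2 : ℝ)) hAm.compl
      (fun x => sq_nonneg _) fun x hx => ?_).trans
      (mul_le_of_le_one_right (by positivity) measureReal_le_one)
    have hx' : |x - a| < |t| / 2 := not_le.1 hx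
    have h1 : |t| / 2 ≤ |x - t - a| := by
      have : |t| ≤ |x - a| + |x - t - a| := by
        calc |t| = |(x - a) - (x - t - a)| := by congr 1; ring
          _ ≤ _ := abs_sub _ _
      linarith
    -- The shift by `t` dominates `x - a`, so `x - t` lies on the side of `a` where the half-line
    -- integral tends to zero rather than to the total integral of the kernel.
    have h2 : σ * (x - t - a) ≤ 0 := by
      have : σ * (x - a) ≤ |x - a| := by
        have := le_abs_self (σ * (x - a))
        rwa [abs_mul, hσ, one_mul] at this
      have e : σ * (x - t - a) = σ * (x - a) - σ * t := by ring
      rw [e, htabs]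
      linarith
    have h3 := hM₁ σ hσ (x - t) (by linarith) h2
    have h4 : |x - t - a| ^ (-(1 / 4) : ℝ) ≤ (2 * |t|⁻¹) ^ (1 / 4 : ℝ) := by
      rw [Real.rpow_neg (abs_nonneg _), ← Real.inv_rpow (abs_nonneg _)]
      refine Real.rpow_le_rpow (by positivity) ?_ (by norm_num)
      calc |x - t - a|⁻¹ ≤ (|t| / 2)⁻¹ := inv_anti₀ (by positivity) h1
        _ = 2 * |t|⁻¹ := by rw [inv_div, div_eq_mul_inv]
    have h5 : |stepKernel b b' a σ (x - t)| ≤ M₁ * (2 * |t|⁻¹) ^ (1 / 4 : ℝ) :=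
      h3.trans (by gcongr)
    have h6 := pow_le_pow_left₀ (abs_nonneg _) h5 2
    rwa [sq_abs, mul_pow, ← Real.rpow_natCast ((2 * |t|⁻¹) ^ (1 / 4 : ℝ)),
      ← Real.rpow_mul (by positivity),
      show (1 / 4 : ℝ) * ((2 : ℕ) : ℝ) = 1 / 2 by norm_num] at h6
  have hKi : Integrable fun x => kernel b b' a (x - t) ^ 2 :=
    (h.memLp_kernel.comp_measurePreserving (measurePreserving_sub_right volume t)).integrable_sq
  obtain ⟨hKi', hKle⟩ := setIntegral_le_of_restrict_le (by positivity) (hP (|t| / 2) (by positivity))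
    hKi fun x => sq_nonneg _
  rw [integral_sub_right_eq_self (μ := volume) (fun x => kernel b b' a x ^ 2), ← hQ] at hKle
  have hPA : P.real A ≤ 2 * E * |t|⁻¹ := by
    have h1 : |t| / 2 * P.real A ≤ E :=
      mul_meas_ge_le_integral_of_nonneg (ae_of_all _ fun x => abs_nonneg _) hPa (|t| / 2)
    rw [← le_div_iff₀' (by positivity)] at h1
    refine h1.trans (le_of_eq ?_)
    field_simp
  have hfar : ∫ x in A, F x ∂P ≤ 2 * (2 * c * Q + M₂ ^ 2 * (2 * E)) * |t|⁻¹ := by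
    calc ∫ x in A, F x ∂P ≤ ∫ x in A, 2 * (kernel b b' a (x - t) ^ 2 + M₂ ^ 2) ∂P := by
          refine integral_mono hFi.integrableOn ((hKi'.add (integrable_const _)).const_mul 2)
            fun x => ?_
          simp only [hF, stepKernel]
          refine (add_sq_le_two_mul _ _).trans ?_
          have hσ2 : σ ^ 2 = 1 := by rw [← sq_abs, hσ, one_pow]
          rw [mul_pow, hσ2, one_mul]
          refine mul_le_mul_of_nonneg_left (add_le_add le_rfl ?_) zero_le_two
          rw [← sq_abs]
          exact pow_le_pow_left₀ (abs_nonneg _) (hM₂ σ (x - t)) 2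
      _ = 2 * ((∫ x in A, kernel b b' a (x - t) ^ 2 ∂P) + P.real A * M₂ ^ 2) := by
          rw [integral_const_mul, integral_add hKi' (integrable_const _), setIntegral_const,
            smul_eq_mul]
      _ ≤ 2 * (c / (|t| / 2) * Q + 2 * E * |t|⁻¹ * M₂ ^ 2) := by gcongr
      _ = _ := by field_simp
  have hinv : |t|⁻¹ ≤ ζ⁻¹ ^ (1 / 2 : ℝ) * |t|⁻¹ ^ (1 / 2 : ℝ) := by
    calc |t|⁻¹ = |t|⁻¹ ^ (1 / 2 : ℝ) * |t|⁻¹ ^ (1 / 2 : ℝ) := by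
          rw [← Real.rpow_add (by positivity)]
          norm_num
      _ ≤ _ := by gcongr
  rw [← integral_add_compl hAm hFi]
  calc _ ≤ 2 * (2 * c * Q + M₂ ^ 2 * (2 * E)) * (ζ⁻¹ ^ (1 / 2 : ℝ) * |t|⁻¹ ^ (1 / 2 : ℝ))
        + M₁ ^ 2 * (2 * |t|⁻¹) ^ (1 / 2 : ℝ) := add_le_add (hfar.trans (by gcongr)) near
    _ = _ := by
        rw [Real.mul_rpow (by norm_num) (by positivity)]
        ring

end

/-- The influence function in the coordinate `τ = 1 / t`, extended by zero to `t = ∞`. -/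
def invKernel (b b' : ℝ → ℂ) (a τ x : ℝ) : ℝ :=
  if τ = 0 then 0 else stepKernel b b' a (SignType.sign τ⁻¹) (x - τ⁻¹)

section

variable {b b' : ℝ → ℂ} {a ε : ℝ} (h : IsDeconvSymbol b b' a ε) {P : Measure ℝ}
  [IsProbabilityMeasure P] {c : ℝ} (hc : 0 ≤ c)
  (hP : ∀ δ > 0, P.restrict {x | δ ≤ |x - a|} ≤ ENNReal.ofReal (c / δ) • volume)
include h hP

theorem IsDeconvSymbol.memLp_invKernel (τ : ℝ) : MemLp (invKernel b b' a τ) 2 P := by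
  by_cases hτ : τ = 0
  · have : invKernel b b' a τ = fun _ => 0 := by ext x; rw [invKernel, if_pos hτ]
    rw [this]
    exact MemLp.zero'
  · have : invKernel b b' a τ = fun x => stepKernel b b' a (SignType.sign τ⁻¹) (x - τ⁻¹) := by
      ext x; rw [invKernel, if_neg hτ]
    rw [this]
    exact h.memLp_stepKernel_comp_sub hP
      (abs_ne_zero.1 (by rw [abs_sign_eq_one (inv_ne_zero hτ)]; exact one_ne_zero))
      (inv_ne_zero hτ)

include hc

/-- The map `τ ↦ 1/τ` is not Lipschitz near `0`, so two bounds compete. Close to `0` both functions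
are small by the decay at `t = ∞`; away from `0` the modulus in `t` is usable. The threshold `|t -
s|^{1/4}` balances them, at the price of the exponent `ε/4`. -/
theorem IsDeconvSymbol.exists_integral_invKernel_sub_sq_le (hPi : Integrable (fun x : ℝ => x) P)
    {ζ : ℝ} (hζ : 0 < ζ) :
    ∃ M, 0 ≤ M ∧ ∀ s t : ℝ, |s| ≤ ζ⁻¹ → |t| ≤ ζ⁻¹ →
      ∫ x, (invKernel b b' a t x - invKernel b b' a s x) ^ 2 ∂P ≤ M * |t - s| ^ (ε / 4) := by
  obtain ⟨M₁, hM₁0, hM₁⟩ := h.exists_integral_stepKernel_sub_sq_le hc hP hζ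
  obtain ⟨M₂, hM₂0, hM₂⟩ := h.exists_integral_stepKernel_sq_le hc hP hPi hζ
  have hζ' : 0 < ζ⁻¹ := inv_pos.2 hζ
  have hε := h.pos
  have hε' := h.le_half
  have hside : ∀ {t : ℝ}, |t| ≤ ζ⁻¹ → t ≠ 0 → ζ ≤ ((SignType.sign t⁻¹ : SignType) : ℝ) * t⁻¹ :=
    fun {t} ht ht0 => by
      rw [sign_mul_self, abs_inv, le_inv_comm₀ hζ (abs_pos.2 ht0)]
      exact ht
  have hsq : ∀ t : ℝ, |t| ≤ ζ⁻¹ → ∫ x, invKernel b b' a t x ^ 2 ∂P ≤ M₂ * |t| ^ (1 / 2 : ℝ) :=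
    fun t ht => by
      by_cases ht0 : t = 0
      · have : (fun x => invKernel b b' a t x ^ 2) = fun _ => 0 := by
          ext x; rw [invKernel, if_pos ht0]; norm_num
        rw [this, integral_zero]
        positivity
      · have := hM₂ _ (abs_sign_eq_one (inv_ne_zero ht0)) t⁻¹ (hside ht ht0)
        rw [abs_inv, inv_inv] at this
        simpa only [invKernel, if_neg ht0] using this
  have hsum : ∀ s t : ℝ, |s| ≤ ζ⁻¹ → |t| ≤ ζ⁻¹ →
      ∫ x, (invKernel b b' a t x - invKernel b b' a s x) ^ 2 ∂P
        ≤ 2 * (M₂ * |t| ^ (1 / 2 : ℝ) + M₂ * |s| ^ (1 / 2 : ℝ)) := fun s t hs ht => by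
    have i1 := (h.memLp_invKernel hP t).integrable_sq
    have i2 := (h.memLp_invKernel hP s).integrable_sq
    calc ∫ x, (invKernel b b' a t x - invKernel b b' a s x) ^ 2 ∂P
        ≤ ∫ x, 2 * (invKernel b b' a t x ^ 2 + invKernel b b' a s x ^ 2) ∂P := by
          refine integral_mono ((h.memLp_invKernel hP t).sub (h.memLp_invKernel hP s)).integrable_sq
            ((i1.add i2).const_mul 2) fun x => ?_
          have := add_sq_le_two_mul (invKernel b b' a t x) (-invKernel b b' a s x)
          rwa [← sub_eq_add_neg, neg_sq] at this
      _ = 2 * ((∫ x, invKernel b b' a t x ^ 2 ∂P) + ∫ x, invKernel b b' a s x ^ 2 ∂P) := by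
          rw [integral_const_mul, integral_add i1 i2]
      _ ≤ _ := by gcongr <;> exact hsq _ ‹_›
  refine ⟨M₁ + 8 * M₂ + 4 * M₂ * ζ⁻¹ ^ (1 / 2 : ℝ), by positivity, fun s t hs ht => ?_⟩
  rcases eq_or_ne t s with rfl | hne
  · simp only [sub_self, ne_eq, OfNat.ofNat_ne_zero, not_false_eq_true, zero_pow, integral_zero]
    positivity
  set d := |t - s| with hd
  have hd0 : 0 < d := abs_pos.2 (sub_ne_zero.2 hne)
  have hX : 0 ≤ d ^ (ε / 4) := by positivity
  rcases lt_or_ge 1 d with hd1 | hd1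
  · have h1 : 1 ≤ d ^ (ε / 4) := Real.one_le_rpow hd1.le (by positivity)
    calc _ ≤ 2 * (M₂ * |t| ^ (1 / 2 : ℝ) + M₂ * |s| ^ (1 / 2 : ℝ)) := hsum s t hs ht
      _ ≤ 2 * (M₂ * ζ⁻¹ ^ (1 / 2 : ℝ) + M₂ * ζ⁻¹ ^ (1 / 2 : ℝ)) := by gcongr
      _ = 4 * M₂ * ζ⁻¹ ^ (1 / 2 : ℝ) * 1 := by ring
      _ ≤ (M₁ + 8 * M₂ + 4 * M₂ * ζ⁻¹ ^ (1 / 2 : ℝ)) * d ^ (ε / 4) := by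
          gcongr
          linarith
  set r := d ^ (1 / 4 : ℝ) with hr
  have hr0 : 0 < r := by positivity
  have hr1 : r ≤ 1 := Real.rpow_le_one hd0.le hd1 (by norm_num)
  have hr4 : r ^ 4 = d := by
    rw [hr, ← Real.rpow_natCast, ← Real.rpow_mul hd0.le]
    norm_num
  have hdr : d ≤ r := by
    rw [← hr4]
    exact pow_le_of_le_one hr0.le hr1 (by norm_num)
  by_cases hmin : |s| < r ∨ |t| < r
  · have hst : |s| ≤ 2 * r ∧ |t| ≤ 2 * r := by
      have h1 : |t| ≤ |s| + d := by
        have := abs_sub_abs_le_abs_sub t s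
        linarith
      have h2 : |s| ≤ |t| + d := by
        have := abs_sub_abs_le_abs_sub s t
        rw [abs_sub_comm] at this
        linarith
      rcases hmin with h3 | h3 <;> constructor <;> linarith
    have h8 : r ^ (1 / 2 : ℝ) ≤ d ^ (ε / 4) := by
      rw [hr, ← Real.rpow_mul hd0.le]
      exact Real.rpow_le_rpow_of_exponent_ge hd0 hd1 (by linarith)
    have h2 : (2 * r) ^ (1 / 2 : ℝ) ≤ 2 * d ^ (ε / 4) := by
      rw [Real.mul_rpow (by norm_num) hr0.le]
      gcongr
      calc (2 : ℝ) ^ (1 / 2 : ℝ) ≤ 2 ^ (1 : ℝ) :=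
            Real.rpow_le_rpow_of_exponent_le (by norm_num) (by norm_num)
        _ = 2 := Real.rpow_one 2
    calc _ ≤ 2 * (M₂ * |t| ^ (1 / 2 : ℝ) + M₂ * |s| ^ (1 / 2 : ℝ)) := hsum s t hs ht
      _ ≤ 2 * (M₂ * (2 * r) ^ (1 / 2 : ℝ) + M₂ * (2 * r) ^ (1 / 2 : ℝ)) := by
          gcongr
          exacts [hst.2, hst.1]
      _ ≤ 2 * (M₂ * (2 * d ^ (ε / 4)) + M₂ * (2 * d ^ (ε / 4))) := by gcongr
      _ = 8 * M₂ * d ^ (ε / 4) := by ring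
      _ ≤ _ := by
          gcongr
          have : 0 ≤ 4 * M₂ * ζ⁻¹ ^ (1 / 2 : ℝ) := by positivity
          linarith
  · push Not at hmin
    obtain ⟨hs', ht'⟩ := hmin
    have hs0 : s ≠ 0 := abs_pos.1 (hr0.trans_le hs')
    have ht0 : t ≠ 0 := abs_pos.1 (hr0.trans_le ht')
    -- Opposite signs would force `|t - s| ≥ 2r`, contradicting `d ≤ r` with `r > 0`.
    have hsign : SignType.sign s⁻¹ = SignType.sign t⁻¹ := by
      rcases lt_or_gt_of_ne hs0 with h1 | h1 <;> rcases lt_or_gt_of_ne ht0 with h2 | h2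
      · rw [sign_neg (inv_lt_zero.2 h1), sign_neg (inv_lt_zero.2 h2)]
      · exfalso
        rw [abs_of_neg h1] at hs'
        rw [abs_of_pos h2] at ht'
        have := le_abs_self (t - s)
        linarith
      · exfalso
        rw [abs_of_pos h1] at hs'
        rw [abs_of_neg h2] at ht'
        have := neg_le_abs (t - s)
        linarith
      · rw [sign_pos (inv_pos.2 h1), sign_pos (inv_pos.2 h2)]
    -- `|1/t - 1/s| = d / (|s||t|) ≤ d / r² = d^{1/2}`, which is at most one, as the modulus in `t`
    -- requires.
    have hinv : |t⁻¹ - s⁻¹| ≤ d ^ (1 / 2 : ℝ) := by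
      rw [inv_sub_inv ht0 hs0, abs_div, abs_mul, abs_sub_comm s t, ← hd,
        div_le_iff₀ (by positivity)]
      calc d = d ^ (1 / 2 : ℝ) * (r * r) := by
            rw [hr, ← Real.rpow_add hd0, ← Real.rpow_add hd0]
            norm_num
        _ ≤ _ := by gcongr
    have hle : d ^ (1 / 2 : ℝ) ≤ 1 := Real.rpow_le_one hd0.le hd1 (by norm_num)
    have hmain := hM₁ _ (abs_sign_eq_one (inv_ne_zero ht0)) s⁻¹ t⁻¹
      (by rw [← hsign]; exact hside hs hs0) (hside ht ht0) (hinv.trans hle)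
    have e : ∀ x, (invKernel b b' a t x - invKernel b b' a s x) ^ 2
        = (stepKernel b b' a (SignType.sign t⁻¹ : SignType) (x - t⁻¹)
          - stepKernel b b' a (SignType.sign t⁻¹ : SignType) (x - s⁻¹)) ^ 2 := fun x => by
      rw [invKernel, invKernel, if_neg ht0, if_neg hs0, hsign]
    simp only [e]
    refine hmain.trans ?_
    calc M₁ * |t⁻¹ - s⁻¹| ^ (2 * ε) ≤ M₁ * (d ^ (1 / 2 : ℝ)) ^ (2 * ε) := by gcongr
      _ = M₁ * d ^ ε := by
          rw [← Real.rpow_mul hd0.le]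
          congr 2
          ring
      _ ≤ M₁ * d ^ (ε / 4) := by
          gcongr 1
          exact Real.rpow_le_rpow_of_exponent_ge hd0 hd1 (by linarith)
      _ ≤ _ := by
          gcongr
          have : 0 ≤ 4 * M₂ * ζ⁻¹ ^ (1 / 2 : ℝ) := by positivity
          linarith

end

end LevyDonsker
end

noncomputable section

namespace LevyDonsker
open scoped ENNReal

/-! ### Gaussian processes with a prescribed `L²` covariance -/

section

variable {Ω : Type*} [MeasurableSpace Ω] {μ : Measure Ω}

theorem inner_eq_integral_mul (f g : Lp ℝ 2 μ) : inner ℝ f g = ∫ ω, f ω * g ω ∂μ := by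
  rw [L2.inner_def]
  congr 1
  ext ω
  simp [mul_comm]

theorem norm_sq_eq_integral_sq (g : Lp ℝ 2 μ) : ‖g‖ ^ 2 = ∫ ω, g ω ^ 2 ∂μ := by
  rw [← real_inner_self_eq_norm_sq, inner_eq_integral_mul]
  simp only [sq]

theorem charFun_map_of_hasGaussianLaw {X : Ω → ℝ} (hX : HasGaussianLaw X μ)
    (h0 : ∫ ω, X ω ∂μ = 0) (u : ℝ) :
    charFun (μ.map X) u = Complex.exp (-((∫ ω, X ω ^ 2 ∂μ : ℝ) * u ^ 2 / 2)) := by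
  rw [hX.map_eq_gaussianReal, charFun_gaussianReal, h0, variance_of_integral_eq_zero hX.aemeasurable h0,
    Real.coe_toNNReal _ (integral_nonneg fun ω => sq_nonneg _)]
  simp

section

variable {ι : Type*} {X : ι → Ω → ℝ} (hX : ∀ i, HasLaw (X i) (gaussianReal 0 1) μ)
  (hind : iIndepFun X μ)
include hX hind

theorem hasGaussianLaw_sum_mul (c : ι → ℝ) (s : Finset ι) :
    HasGaussianLaw (fun ω => ∑ i ∈ s, c i * X i ω) μ := by
  have h1 : iIndepFun (fun (i : s) ω => c i * X i ω) μ :=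
    (hind.precomp Subtype.val_injective).comp (fun (i : s) x => c i * x) fun i => by fun_prop
  have h2 : ∀ i : s, HasGaussianLaw (fun ω => c i * X i ω) μ := fun i =>
    (hX i).hasGaussianLaw.fun_smul (c i)
  exact (iIndepFun.hasGaussianLaw_fun_sum h2 h1).congr
    (ae_of_all _ fun ω => Finset.sum_coe_sort s fun i => c i * X i ω)

theorem orthonormal_toLp_of_iid :
    Orthonormal ℝ fun i => ((hX i).hasGaussianLaw.memLp_two.toLp (X i) : Lp ℝ 2 μ) := by
  have hm : ∀ i, MemLp (X i) 2 μ := fun i => (hX i).hasGaussianLaw.memLp_two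
  have h0 : ∀ i, ∫ ω, X i ω ∂μ = 0 := fun i => by
    rw [(hX i).integral_eq, integral_id_gaussianReal]
  classical
  rw [orthonormal_iff_ite]
  intro i j
  have e : inner ℝ ((hm i).toLp (X i)) ((hm j).toLp (X j)) = ∫ ω, X i ω * X j ω ∂μ := by
    rw [inner_eq_integral_mul]
    refine integral_congr_ae ?_
    filter_upwards [(hm i).coeFn_toLp, (hm j).coeFn_toLp] with ω h1 h2
    rw [h1, h2]
  rw [e]
  split_ifs with hij
  · subst hij
    have h1 := (hX i).variance_eq
    rw [variance_of_integral_eq_zero (hX i).aemeasurable (h0 i), variance_id_gaussianReal] at h1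
    simpa [sq] using h1
  · rw [(hind.indepFun hij).integral_fun_mul_eq_mul_integral (hm i).1 (hm j).1, h0, zero_mul]

end

variable [IsProbabilityMeasure μ]

theorem abs_integral_abs_le_norm (g : Lp ℝ 2 μ) : ∫ ω, |g ω| ∂μ ≤ ‖g‖ := by
  have hm : MemLp (fun ω => |g ω|) 2 μ := (Lp.memLp g).abs
  have h1 := variance_nonneg (fun ω => |g ω|) μ
  rw [variance_eq_sub hm] at h1
  refine abs_le_of_sq_le_sq' ?_ (norm_nonneg g) |>.2
  rw [norm_sq_eq_integral_sq]
  simp only [Pi.pow_apply, sq_abs] at h1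
  linarith

/-- Lipschitz in the `L²` norm since `|e^{iux} - e^{iuy}| ≤ 2|u||x - y|`. It carries Gaussianity
from finite combinations to `L²` limits. -/
theorem continuous_charFun_map_lp (u : ℝ) :
    Continuous fun g : Lp ℝ 2 μ => charFun (μ.map g) u := by
  have e : ∀ g : Lp ℝ 2 μ, charFun (μ.map g) u = ∫ ω, Complex.exp (u * g ω * Complex.I) ∂μ :=
    fun g => by
      rw [charFun_apply_real, integral_map (Lp.aestronglyMeasurable g).aemeasurable (by fun_prop)]
  have hi : ∀ g : Lp ℝ 2 μ, Integrable (fun ω => Complex.exp (u * g ω * Complex.I)) μ := fun g => by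
    have hm := (Lp.aestronglyMeasurable g).aemeasurable
    refine (integrable_const (1 : ℝ)).mono' (AEMeasurable.aestronglyMeasurable (by fun_prop))
      (ae_of_all _ fun x => ?_)
    rw [← Complex.ofReal_mul, Complex.norm_exp_ofReal_mul_I]
  simp only [e]
  refine (LipschitzWith.of_dist_le_mul (K := 2 * ‖u‖₊) fun f g => ?_).continuous
  rw [dist_eq_norm, dist_eq_norm, ← integral_sub (hi f) (hi g)]
  calc _ ≤ ∫ ω, 2 * |u| * |(f - g : Lp ℝ 2 μ) ω| ∂μ := by
        refine norm_integral_le_of_norm_le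
          (((Lp.memLp (f - g)).integrable one_le_two).abs.const_mul _) ?_
        filter_upwards [Lp.coeFn_sub f g] with ω hω
        rw [hω, Pi.sub_apply, mul_assoc 2, ← abs_mul, mul_sub]
        have := norm_exp_I_sub_exp_I_le (u * f ω) (u * g ω) zero_le_one le_rfl
        rw [Real.rpow_one] at this
        rwa [show (u : ℂ) * f ω * Complex.I = Complex.I * ((u * f ω : ℝ) : ℂ) by push_cast; ring,
          show (u : ℂ) * g ω * Complex.I = Complex.I * ((u * g ω : ℝ) : ℂ) by push_cast; ring]
    _ = 2 * |u| * ∫ ω, |(f - g : Lp ℝ 2 μ) ω| ∂μ := integral_const_mul _ _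
    _ ≤ 2 * |u| * ‖f - g‖ := by gcongr; exact abs_integral_abs_le_norm _

end

/-- Every `L²` family of functions has a centered Gaussian process with the same Gram matrix. -/
theorem exists_isGaussianProcess {α : Type} [MeasurableSpace α] (P : Measure α) {T : Type*}
    (f : T → α → ℝ) (hf : ∀ t, MemLp (f t) 2 P) :
    ∃ (Ω : Type) (_ : MeasurableSpace Ω) (μ : Measure Ω) (_ : IsProbabilityMeasure μ)
      (G : T → Ω → ℝ), IsGaussianProcess G μ ∧ (∀ t, ∫ ω, G t ω ∂μ = 0) ∧
        ∀ s t, ∫ ω, G s ω * G t ω ∂μ = ∫ x, f s x * f t x ∂P := by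
  obtain ⟨w, b, -⟩ := exists_hilbertBasis ℝ (Lp ℝ 2 P)
  obtain ⟨Ω, mΩ, μ, X, hXm, hX, hind, hμ⟩ := exists_iid w (gaussianReal 0 1)
  have hm : ∀ i, MemLp (X i) 2 μ := fun i => (hX i).hasGaussianLaw.memLp_two
  have hon := orthonormal_toLp_of_iid hX hind
  -- The isonormal process: expand in an orthonormal basis and replace the basis vectors by
  -- independent standard normals. Since `W` is an isometry, it preserves Gram matrices.
  set W : Lp ℝ 2 P →ₗᵢ[ℝ] Lp ℝ 2 μ :=
    hon.orthogonalFamily.linearIsometry.comp b.repr.toLinearIsometry with hW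
  have hWb : ∀ i, W (b i) = (hm i).toLp (X i) := fun i => by
    classical
    change hon.orthogonalFamily.linearIsometry (b.repr (b i)) = _
    rw [b.repr_self]
    refine (hon.orthogonalFamily.linearIsometry_apply_single (1 : ℝ)).trans ?_
    rw [LinearIsometry.toSpanSingleton_apply, one_smul]
  have hX0 : ∀ i, ∫ ω, X i ω ∂μ = 0 := fun i => by
    rw [(hX i).integral_eq, integral_id_gaussianReal]
  have hsum : ∀ (c : w → ℝ) (s : Finset w),
      (W (∑ i ∈ s, c i • b i) : Lp ℝ 2 μ) =ᵐ[μ] fun ω => ∑ i ∈ s, c i * X i ω := fun c s => by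
    classical
    induction s using Finset.induction_on with
    | empty =>
      simp only [Finset.sum_empty, map_zero]
      exact Lp.coeFn_zero _ _ _
    | insert i s hi ih =>
      rw [Finset.sum_insert hi, map_add, map_smul, hWb]
      filter_upwards [Lp.coeFn_add (c i • (hm i).toLp (X i)) (W (∑ i ∈ s, c i • b i)), ih,
        Lp.coeFn_smul (c i) ((hm i).toLp (X i)), (hm i).coeFn_toLp] with ω h1 h2 h3 h4
      rw [h1, Pi.add_apply, h2, h3, Pi.smul_apply, h4, Finset.sum_insert hi, smul_eq_mul]
  -- For finite combinations of basis vectors this is a sum of independent normals. Both sides are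
  -- continuous in `g` and the span is dense.
  have hchar : ∀ (u : ℝ) (g : Lp ℝ 2 P),
      charFun (μ.map (W g)) u = Complex.exp (-((‖g‖ ^ 2 : ℝ) * u ^ 2 / 2)) := fun u g => by
    have hclosed : IsClosed {g : Lp ℝ 2 P |
        charFun (μ.map (W g)) u = Complex.exp (-((‖g‖ ^ 2 : ℝ) * u ^ 2 / 2))} :=
      isClosed_eq ((continuous_charFun_map_lp u).comp W.continuous) (by fun_prop)
    have hspan : ∀ g ∈ Submodule.span ℝ (Set.range b),
        charFun (μ.map (W g)) u = Complex.exp (-((‖g‖ ^ 2 : ℝ) * u ^ 2 / 2)) := fun g hg => by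
      obtain ⟨c, rfl⟩ := (Finsupp.mem_span_range_iff_exists_finsupp).1 hg
      rw [Finsupp.sum, ← W.norm_map, norm_sq_eq_integral_sq]
      have hae := hsum c c.support
      rw [charFun_map_of_hasGaussianLaw
        ((hasGaussianLaw_sum_mul hX hind c c.support).congr hae.symm) ?_]
      rw [integral_congr_ae hae, integral_finsetSum]
      · simp [integral_const_mul, hX0]
      · exact fun i _ => ((hm i).integrable one_le_two).const_mul _
    have hall : g ∈ closure (Submodule.span ℝ (Set.range b) : Set (Lp ℝ 2 P)) := by
      rw [← Submodule.topologicalClosure_coe, b.dense_span]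
      trivial
    exact closure_minimal hspan hclosed hall
  have hlaw : ∀ g : Lp ℝ 2 P, μ.map (W g) = gaussianReal 0 (‖g‖₊ ^ 2) := fun g => by
    have : IsProbabilityMeasure (μ.map (W g)) :=
      Measure.isProbabilityMeasure_map (Lp.aestronglyMeasurable _).aemeasurable
    refine Measure.ext_of_charFun (funext fun u => ?_)
    rw [hchar, charFun_gaussianReal]
    simp
  set F : T → Lp ℝ 2 P := fun t => (hf t).toLp (f t) with hF
  refine ⟨Ω, mΩ, μ, hμ, fun t => W (F t), ⟨fun I => ⟨?_⟩⟩, fun t => ?_, fun s t => ?_⟩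
  · have hmeas : AEMeasurable (fun ω => I.restrict fun t => W (F t) ω) μ :=
      aemeasurable_pi_lambda _ fun i => (Lp.aestronglyMeasurable _).aemeasurable
    refine isGaussian_of_map_eq_gaussianReal fun L => ?_
    rw [AEMeasurable.map_map_of_aemeasurable (by fun_prop) hmeas]
    classical
    -- A linear functional of finitely many coordinates is again some `W g`, so every
    -- one-dimensional projection is Gaussian, hence so is the vector.
    set g : Lp ℝ 2 P := ∑ i : I, L (fun j => if i = j then 1 else 0) • F i with hg
    refine ⟨0, ‖g‖₊ ^ 2, ?_⟩
    rw [← hlaw g]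
    refine Measure.map_congr ?_
    have hs : ∀ s : Finset I, (W (∑ i ∈ s, L (fun j => if i = j then 1 else 0) • F i) : Lp ℝ 2 μ)
        =ᵐ[μ] fun ω => ∑ i ∈ s, L (fun j => if i = j then 1 else 0) * W (F i) ω := fun s => by
      induction s using Finset.induction_on with
      | empty =>
        simp only [Finset.sum_empty, map_zero]
        exact Lp.coeFn_zero _ _ _
      | insert i s hi ih =>
        rw [Finset.sum_insert hi, map_add, map_smul]
        filter_upwards [Lp.coeFn_add (L (fun j => if i = j then 1 else 0) • W (F i))
          (W (∑ i ∈ s, L (fun j => if i = j then 1 else 0) • F i)), ih,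
          Lp.coeFn_smul (L (fun j => if i = j then 1 else 0)) (W (F i))] with ω h1 h2 h3
        rw [h1, Pi.add_apply, h2, h3, Pi.smul_apply, Finset.sum_insert hi, smul_eq_mul]
    filter_upwards [hs Finset.univ] with ω hω
    rw [hg, hω, Function.comp_apply]
    have := LinearMap.pi_apply_eq_sum_univ (L : (I → ℝ) →ₗ[ℝ] ℝ) (I.restrict fun t => W (F t) ω)
    refine this.trans (Finset.sum_congr rfl fun i _ => ?_)
    rw [smul_eq_mul, mul_comm]
    rfl
  · have h1 := integral_map (μ := μ) (φ := W (F t)) (Lp.aestronglyMeasurable _).aemeasurable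
      (f := fun x : ℝ => x) (by fun_prop)
    rw [← h1, hlaw, integral_id_gaussianReal]
  · rw [← inner_eq_integral_mul, W.inner_map_map, inner_eq_integral_mul]
    refine integral_congr_ae ?_
    filter_upwards [(hf s).coeFn_toLp, (hf t).coeFn_toLp] with x h1 h2
    rw [h1, h2]

end LevyDonsker
end

noncomputable section

namespace LevyDonsker
open scoped ENNReal NNReal

/-! ### Continuous modifications -/

/-- The value of `y` at the left dyadic neighbour of `t` of level `n`. -/
def dyadicStep (y : ℝ → ℝ) (n : ℕ) (t : ℝ) : ℝ := y (⌊(2 : ℝ) ^ n * t⌋₊ / 2 ^ n)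

theorem floor_div_mem_Icc {n : ℕ} {t : ℝ} (ht : t ∈ Set.Icc (0 : ℝ) 1) :
    (⌊(2 : ℝ) ^ n * t⌋₊ / 2 ^ n : ℝ) ∈ Set.Icc (0 : ℝ) 1 := by
  refine ⟨by positivity, (div_le_one (by positivity)).2 ?_⟩
  exact (Nat.floor_le (mul_nonneg (by positivity) ht.1)).trans
    (mul_le_of_le_one_right (by positivity) ht.2)

theorem abs_floor_div_sub_le (n : ℕ) {t : ℝ} (ht : t ∈ Set.Icc (0 : ℝ) 1) :
    |t - ⌊(2 : ℝ) ^ n * t⌋₊ / 2 ^ n| ≤ (1 / 2) ^ n := by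
  have h0 : (0 : ℝ) < 2 ^ n := by positivity
  have h1 := Nat.floor_le (mul_nonneg h0.le ht.1)
  have h2 := Nat.lt_floor_add_one ((2 : ℝ) ^ n * t)
  have e : t - ⌊(2 : ℝ) ^ n * t⌋₊ / 2 ^ n = (2 ^ n * t - ⌊(2 : ℝ) ^ n * t⌋₊) * (1 / 2) ^ n := by
    rw [one_div, inv_pow]
    field_simp
  rw [e, abs_mul, abs_of_nonneg (sub_nonneg.2 h1), abs_of_nonneg (by positivity)]
  exact mul_le_of_le_one_left (by positivity) (by linarith)

section

variable {y : ℝ → ℝ} {K ρ : ℝ} (hK : 0 ≤ K) (hρ0 : 0 ≤ ρ) (hρ : ρ < 1)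
  (hy : ∀ n k : ℕ, k < 2 ^ n → |y ((k + 1) / 2 ^ n) - y (k / 2 ^ n)| ≤ K * ρ ^ n)
include hK hρ0 hρ hy

/-- With `k` the level `n` index, the level `n + 1` index is `2k` or `2k + 1`, so refining moves by
at most one dyadic step. -/
theorem abs_dyadicStep_succ_sub_le (n : ℕ) {t : ℝ} (ht : t ∈ Set.Icc (0 : ℝ) 1) :
    |dyadicStep y n t - dyadicStep y (n + 1) t| ≤ K * ρ ^ n := by
  set k := ⌊(2 : ℝ) ^ n * t⌋₊ with hk
  set l := ⌊(2 : ℝ) ^ (n + 1) * t⌋₊ with hl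
  have h0 : (0 : ℝ) ≤ 2 ^ n * t := mul_nonneg (by positivity) ht.1
  have e2 : (2 : ℝ) ^ (n + 1) * t = 2 * (2 ^ n * t) := by ring
  have h1 : 2 * k ≤ l := by
    rw [hl, Nat.le_floor_iff (by rw [e2]; positivity), e2]
    push_cast
    have := Nat.floor_le h0
    linarith
  have h2 : l < 2 * k + 2 := by
    rw [hl, Nat.floor_lt (by rw [e2]; positivity), e2]
    push_cast
    have := Nat.lt_floor_add_one ((2 : ℝ) ^ n * t)
    linarith
  have hl2 : l ≤ 2 ^ (n + 1) := by
    have : (l : ℝ) ≤ 2 ^ (n + 1) := (Nat.floor_le (by rw [e2]; positivity)).trans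
      (mul_le_of_le_one_right (by positivity) ht.2)
    exact_mod_cast this
  have ek : (k / 2 ^ n : ℝ) = ((2 * k : ℕ) : ℝ) / 2 ^ (n + 1) := by
    push_cast
    rw [pow_succ]
    field_simp
  rw [dyadicStep, dyadicStep, ← hk, ← hl, ek]
  rcases (by omega : l = 2 * k ∨ l = 2 * k + 1) with h | h
  · rw [h, sub_self, abs_zero]
    positivity
  · rw [h, abs_sub_comm]
    refine le_trans ?_ ((hy (n + 1) (2 * k) (by omega)).trans ?_)
    · push_cast
      exact le_rfl
    · rw [pow_succ]
      exact mul_le_mul_of_nonneg_left (mul_le_of_le_one_right (by positivity) hρ.le) hK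

theorem exists_tendsto_dyadicStep {t : ℝ} (ht : t ∈ Set.Icc (0 : ℝ) 1) :
    ∃ z, Tendsto (fun n => dyadicStep y n t) atTop (𝓝 z) :=
  cauchySeq_tendsto_of_complete (cauchySeq_of_le_geometric ρ K hρ fun n => by
    rw [Real.dist_eq]
    exact abs_dyadicStep_succ_sub_le hK hρ0 hρ hy n ht)

/-- Chaining: points closer than `2⁻ⁿ` have level `n` neighbours that are equal or adjacent, and
each point is within a geometric tail of its own approximations. -/
theorem continuousOn_of_tendsto_dyadicStep {z : ℝ → ℝ}
    (hz : ∀ t ∈ Set.Icc (0 : ℝ) 1, Tendsto (fun n => dyadicStep y n t) atTop (𝓝 (z t))) :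
    ContinuousOn z (Set.Icc 0 1) := by
  have hstep : ∀ n : ℕ, ∀ s ∈ Set.Icc (0 : ℝ) 1, ∀ t ∈ Set.Icc (0 : ℝ) 1, s ≤ t →
      t - s < (1 / 2) ^ n → |dyadicStep y n t - dyadicStep y n s| ≤ K * ρ ^ n :=
    fun n s hs t ht hst h => by
      have hp : (0 : ℝ) < 2 ^ n := by positivity
      set k := ⌊(2 : ℝ) ^ n * s⌋₊ with hk
      set l := ⌊(2 : ℝ) ^ n * t⌋₊ with hl
      have h0 : (0 : ℝ) ≤ 2 ^ n * t := mul_nonneg hp.le ht.1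
      have h1 : k ≤ l := Nat.floor_mono (by gcongr)
      have hts : 2 ^ n * t < 2 ^ n * s + 1 := by
        have : 2 ^ n * (t - s) < 2 ^ n * (1 / 2) ^ n := by gcongr
        rw [← mul_pow, mul_one_div_cancel two_ne_zero, one_pow] at this
        linarith
      have h2 : l < k + 2 := by
        rw [hl, Nat.floor_lt h0]
        push_cast
        have := Nat.lt_floor_add_one ((2 : ℝ) ^ n * s)
        linarith
      have hl2 : l ≤ 2 ^ n := by
        have : (l : ℝ) ≤ 2 ^ n := (Nat.floor_le h0).trans
          (mul_le_of_le_one_right hp.le ht.2)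
        exact_mod_cast this
      rw [dyadicStep, dyadicStep, ← hk, ← hl]
      rcases (by omega : l = k ∨ l = k + 1) with h | h
      · rw [h, sub_self, abs_zero]
        positivity
      · rw [h]
        refine le_trans ?_ (hy n k (by omega))
        push_cast
        exact le_rfl
  have hlim : ∀ n : ℕ, ∀ t ∈ Set.Icc (0 : ℝ) 1,
      |dyadicStep y n t - z t| ≤ K * ρ ^ n / (1 - ρ) := fun n t ht => by
    rw [← Real.dist_eq]
    refine dist_le_of_le_geometric_of_tendsto ρ K hρ (fun n => ?_) (hz t ht) n
    rw [Real.dist_eq]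
    exact abs_dyadicStep_succ_sub_le hK hρ0 hρ hy n ht
  have htend : Tendsto (fun n : ℕ => 2 * (K * ρ ^ n / (1 - ρ)) + K * ρ ^ n) atTop (𝓝 0) := by
    have h1 := (tendsto_pow_atTop_nhds_zero_of_lt_one hρ0 hρ).const_mul K
    have h2 := (((h1.div_const (1 - ρ)).const_mul 2).add h1)
    simpa using h2
  rw [Metric.continuousOn_iff]
  intro s hs η hη
  obtain ⟨n, hn⟩ := (htend.eventually_lt_const hη).exists
  refine ⟨(1 / 2) ^ n, by positivity, fun t ht hd => ?_⟩
  rw [Real.dist_eq] at hd ⊢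
  have h1 : |dyadicStep y n t - dyadicStep y n s| ≤ K * ρ ^ n := by
    rcases le_total s t with h | h
    · exact hstep n s hs t ht h ((le_abs_self _).trans_lt hd)
    · rw [abs_sub_comm]
      rw [abs_sub_comm] at hd
      exact hstep n t ht s hs h ((le_abs_self _).trans_lt hd)
  have h2 := hlim n t ht
  have h3 := hlim n s hs
  calc |z t - z s| = |-(dyadicStep y n t - z t) + (dyadicStep y n t - dyadicStep y n s)
        + (dyadicStep y n s - z s)| := by congr 1; ring
    _ ≤ |dyadicStep y n t - z t| + |dyadicStep y n t - dyadicStep y n s|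
        + |dyadicStep y n s - z s| := by
      refine (abs_add_le _ _).trans (add_le_add_left ((abs_add_le _ _).trans ?_) _)
      rw [abs_neg]
    _ < η := by linarith

end

/-- Summable `p`-th moments make the series of `p`-th powers almost surely finite, so its terms tend
to zero. -/
theorem ae_tendsto_of_tsum_lintegral_ne_top {Ω : Type*} [MeasurableSpace Ω] {μ : Measure Ω}
    {f : ℕ → Ω → ℝ} (hf : ∀ n, Measurable (f n)) {p : ℕ} (hp : p ≠ 0)
    (h : ∑' n, ∫⁻ ω, ‖f n ω‖ₑ ^ p ∂μ ≠ ⊤) :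
    ∀ᵐ ω ∂μ, Tendsto (fun n => f n ω) atTop (𝓝 0) := by
  rw [← lintegral_tsum fun n => by fun_prop] at h
  filter_upwards [ae_lt_top (by fun_prop) h] with ω hω
  have h1 := ENNReal.tendsto_atTop_zero_of_tsum_ne_top hω.ne
  have h2 : Tendsto (fun n => (‖f n ω‖ₑ ^ p) ^ (p⁻¹ : ℝ)) atTop (𝓝 0) := by
    have := (ENNReal.continuous_rpow_const (y := (p : ℝ)⁻¹)).tendsto 0 |>.comp h1
    rwa [ENNReal.zero_rpow_of_pos (by positivity)] at this
  have e : ∀ n, (‖f n ω‖ₑ ^ p) ^ (p⁻¹ : ℝ) = ‖f n ω‖ₑ := fun n => by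
    rw [← ENNReal.rpow_natCast, ← ENNReal.rpow_mul, mul_inv_cancel₀ (by exact_mod_cast hp),
      ENNReal.rpow_one]
  simp only [e] at h2
  rw [tendsto_zero_iff_norm_tendsto_zero]
  have h3 := (ENNReal.tendsto_toReal ENNReal.zero_ne_top).comp h2
  simpa [Function.comp_def] using h3

/-- Kolmogorov's criterion on the unit interval. -/
theorem exists_continuousOn_modification_of_measurable {Ω : Type*} [MeasurableSpace Ω]
    {μ : Measure Ω} {Y : ℝ → Ω → ℝ} (hY : ∀ t, Measurable (Y t)) {p : ℕ} (hp : p ≠ 0) {C : ℝ≥0∞}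
    (hC : C ≠ ⊤) (h : ∀ s ∈ Set.Icc (0 : ℝ) 1, ∀ t ∈ Set.Icc (0 : ℝ) 1,
      ∫⁻ ω, ‖Y t ω - Y s ω‖ₑ ^ p ∂μ ≤ C * ENNReal.ofReal (|t - s| ^ 3)) :
    ∃ Z : ℝ → Ω → ℝ, (∀ t ∈ Set.Icc (0 : ℝ) 1, Measurable (Z t)) ∧
      (∀ t ∈ Set.Icc (0 : ℝ) 1, Z t =ᵐ[μ] Y t) ∧
      ∀ ω, ContinuousOn (fun t => Z t ω) (Set.Icc 0 1) := by
  set D : ℕ → ℕ → Ω → ℝ := fun n k ω => Y ((k + 1) / 2 ^ n) ω - Y (k / 2 ^ n) ω with hD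
  have hDm : ∀ n k, Measurable (D n k) := fun n k => (hY _).sub (hY _)
  -- The weight `2ⁿ` provides the geometric rate below. Level `n` contributes `2ⁿ` increments of
  -- expected size `2⁻³ⁿ` with weight `2ⁿ`, a total of order `2⁻ⁿ`; this is why the hypothesis has
  -- exponent `3`.
  set S : Ω → ℝ≥0∞ := fun ω => ∑' n : ℕ, ∑ k ∈ Finset.range (2 ^ n), 2 ^ n * ‖D n k ω‖ₑ ^ p with hS
  have hSm : Measurable S := by
    refine Measurable.tsum fun n => Finset.measurable_sum _ fun k _ => ?_
    have := hDm n k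
    fun_prop
  have hgeo : ∑' n : ℕ, C * (2⁻¹ : ℝ≥0∞) ^ n ≠ ⊤ := by
    rw [ENNReal.tsum_mul_left, ENNReal.tsum_geometric]
    refine ENNReal.mul_ne_top hC ?_
    rw [ENNReal.one_sub_inv_two, inv_inv]
    exact ENNReal.ofNat_ne_top
  have hhalf : ∀ n : ℕ, ENNReal.ofReal ((1 / 2 : ℝ) ^ n) = (2⁻¹ : ℝ≥0∞) ^ n := fun n => by
    rw [ENNReal.ofReal_pow (by norm_num), one_div, ENNReal.ofReal_inv_of_pos two_pos,
      ENNReal.ofReal_ofNat]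
  have hDle : ∀ n k : ℕ, k < 2 ^ n →
      ∫⁻ ω, ‖D n k ω‖ₑ ^ p ∂μ ≤ C * ((2⁻¹ : ℝ≥0∞) ^ n) ^ 3 := fun n k hk => by
    have hp0 : (0 : ℝ) < 2 ^ n := by positivity
    have hk' : (k : ℝ) + 1 ≤ 2 ^ n := by exact_mod_cast hk
    refine (h (k / 2 ^ n) ⟨by positivity, (div_le_one hp0).2 (by linarith)⟩
      ((k + 1) / 2 ^ n) ⟨by positivity, (div_le_one hp0).2 hk'⟩).trans (le_of_eq ?_)
    rw [← sub_div, add_sub_cancel_left, abs_of_pos (by positivity), ENNReal.ofReal_pow (by positivity),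
      ← hhalf, one_div_pow]
  have hSint : ∫⁻ ω, S ω ∂μ ≠ ⊤ := by
    refine ne_top_of_le_ne_top hgeo ?_
    rw [lintegral_tsum fun n => by
      refine (Finset.measurable_sum _ fun k _ => ?_).aemeasurable
      have := hDm n k
      fun_prop]
    refine ENNReal.tsum_le_tsum fun n => ?_
    rw [lintegral_finsetSum _ fun k _ => by have := hDm n k; fun_prop]
    calc ∑ k ∈ Finset.range (2 ^ n), ∫⁻ ω, 2 ^ n * ‖D n k ω‖ₑ ^ p ∂μ
        ≤ ∑ k ∈ Finset.range (2 ^ n), 2 ^ n * (C * ((2⁻¹ : ℝ≥0∞) ^ n) ^ 3) := by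
          refine Finset.sum_le_sum fun k hk => ?_
          rw [lintegral_const_mul _ (by have := hDm n k; fun_prop)]
          gcongr
          exact hDle n k (Finset.mem_range.1 hk)
      _ = 2 ^ n * (2 ^ n * (C * ((2⁻¹ : ℝ≥0∞) ^ n) ^ 3)) := by
          rw [Finset.sum_const, Finset.card_range, nsmul_eq_mul]
          push_cast
          rfl
      _ = (2 ^ n * (2⁻¹ : ℝ≥0∞) ^ n) * (2 ^ n * (2⁻¹ : ℝ≥0∞) ^ n) * (C * (2⁻¹ : ℝ≥0∞) ^ n) := by
          ring
      _ = C * (2⁻¹ : ℝ≥0∞) ^ n := by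
          rw [← mul_pow, ENNReal.mul_inv_cancel two_ne_zero ENNReal.ofNat_ne_top, one_pow, one_mul,
            one_mul]
  set A : Set Ω := {ω | S ω < ⊤} with hA
  have hAm : MeasurableSet A := measurableSet_lt hSm measurable_const
  have hAae : ∀ᵐ ω ∂μ, ω ∈ A := ae_lt_top hSm hSint
  -- Finiteness of `S` bounds `2ⁿ |D|^p`; taking `p`-th roots gives increments of order `ρⁿ` with `ρ
  -- = 2^{-1/p}`.
  set ρ : ℝ := (1 / 2) ^ (p⁻¹ : ℝ) with hρ
  have hp' : (0 : ℝ) < (p : ℝ)⁻¹ := by positivity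
  have hρ0 : 0 ≤ ρ := by positivity
  have hρ1 : ρ < 1 := Real.rpow_lt_one (by norm_num) (by norm_num) hp'
  have hinc : ∀ ω ∈ A, ∃ K, 0 ≤ K ∧ ∀ n k : ℕ, k < 2 ^ n →
      |Y ((k + 1) / 2 ^ n) ω - Y (k / 2 ^ n) ω| ≤ K * ρ ^ n := fun ω hω => by
    refine ⟨(S ω).toReal ^ (p⁻¹ : ℝ), by positivity, fun n k hk => ?_⟩
    have h1 : 2 ^ n * ‖D n k ω‖ₑ ^ p ≤ S ω :=
      (Finset.single_le_sum (f := fun k => 2 ^ n * ‖D n k ω‖ₑ ^ p) (fun _ _ => zero_le)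
        (Finset.mem_range.2 hk)).trans (ENNReal.le_tsum n)
    have h2 : 2 ^ n * |D n k ω| ^ p ≤ (S ω).toReal := by
      have := ENNReal.toReal_mono (ne_of_lt hω) h1
      simpa [ENNReal.toReal_mul, ENNReal.toReal_pow] using this
    have h3 : |D n k ω| ^ p ≤ (S ω).toReal * (1 / 2) ^ n := by
      rw [one_div_pow, mul_one_div, le_div_iff₀ (by positivity), mul_comm]
      exact h2
    have h4 := Real.rpow_le_rpow (by positivity) h3 hp'.le
    rw [← Real.rpow_natCast, ← Real.rpow_mul (abs_nonneg _),
      mul_inv_cancel₀ (by exact_mod_cast hp), Real.rpow_one, Real.mul_rpow (by positivity)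
      (by positivity), ← Real.rpow_natCast, ← Real.rpow_mul (by norm_num), mul_comm (n : ℝ),
      Real.rpow_mul (by norm_num), Real.rpow_natCast] at h4
    exact h4
  have hlim : ∀ ω ∈ A, ∀ t ∈ Set.Icc (0 : ℝ) 1, Tendsto (fun n => dyadicStep (fun t => Y t ω) n t)
      atTop (𝓝 (limUnder atTop fun n => dyadicStep (fun t => Y t ω) n t)) := fun ω hω t ht => by
    obtain ⟨K, hK, hinc⟩ := hinc ω hω
    exact tendsto_nhds_limUnder (exists_tendsto_dyadicStep hK hρ0 hρ1 hinc ht)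
  classical
  -- On the null exceptional set the path is identically zero, so paths are continuous for every
  -- `ω`.
  refine ⟨fun t => A.indicator fun ω => limUnder atTop fun n => dyadicStep (fun t => Y t ω) n t,
    fun t ht => ?_, fun t ht => ?_, fun ω => ?_⟩
  · refine measurable_of_tendsto_metrizable
      (f := fun n => A.indicator fun ω => dyadicStep (fun t => Y t ω) n t)
      (fun n => (hY _).indicator hAm) ?_
    rw [tendsto_pi_nhds]
    intro ω
    by_cases hω : ω ∈ A
    · simp only [Set.indicator_of_mem hω]
      exact hlim ω hω t ht
    · simp only [Set.indicator_of_notMem hω]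
      exact tendsto_const_nhds
  · have h1 : ∀ᵐ ω ∂μ, Tendsto (fun n => Y t ω - dyadicStep (fun t => Y t ω) n t) atTop (𝓝 0) := by
      refine ae_tendsto_of_tsum_lintegral_ne_top
        (f := fun n ω => Y t ω - dyadicStep (fun t => Y t ω) n t)
        (fun n => (hY t).sub (hY _)) hp (ne_top_of_le_ne_top hgeo ?_)
      refine ENNReal.tsum_le_tsum fun n => ?_
      refine (h _ (floor_div_mem_Icc ht) t ht).trans ?_
      rw [← hhalf]
      gcongr
      have h1 := abs_floor_div_sub_le n ht
      have h2 : ((1 / 2 : ℝ) ^ n) ≤ 1 := pow_le_one₀ (by norm_num) (by norm_num)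
      refine (pow_le_of_le_one (abs_nonneg _) (h1.trans h2) (by norm_num)).trans h1
    filter_upwards [h1, hAae] with ω h2 hω
    rw [Set.indicator_of_mem hω]
    have h3 := (tendsto_const_nhds (x := Y t ω)).sub h2
    simp only [sub_sub_cancel, sub_zero] at h3
    exact tendsto_nhds_unique (hlim ω hω t ht) h3
  · by_cases hω : ω ∈ A
    · obtain ⟨K, hK, hinc'⟩ := hinc ω hω
      simp only [Set.indicator_of_mem hω]
      exact continuousOn_of_tendsto_dyadicStep hK hρ0 hρ1 hinc' (hlim ω hω)
    · simp only [Set.indicator_of_notMem hω]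
      exact continuousOn_const

theorem exists_continuousOn_modification {Ω : Type*} [MeasurableSpace Ω]
    {μ : Measure Ω} {Y : ℝ → Ω → ℝ} (hY : ∀ t, AEMeasurable (Y t) μ) {p : ℕ} (hp : p ≠ 0)
    {C : ℝ≥0∞} (hC : C ≠ ⊤) (h : ∀ s ∈ Set.Icc (0 : ℝ) 1, ∀ t ∈ Set.Icc (0 : ℝ) 1,
      ∫⁻ ω, ‖Y t ω - Y s ω‖ₑ ^ p ∂μ ≤ C * ENNReal.ofReal (|t - s| ^ 3)) :
    ∃ Z : ℝ → Ω → ℝ, (∀ t ∈ Set.Icc (0 : ℝ) 1, Measurable (Z t)) ∧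
      (∀ t ∈ Set.Icc (0 : ℝ) 1, Z t =ᵐ[μ] Y t) ∧
      ∀ ω, ContinuousOn (fun t => Z t ω) (Set.Icc 0 1) := by
  obtain ⟨Z, h1, h2, h3⟩ := exists_continuousOn_modification_of_measurable
    (Y := fun t => (hY t).mk) (μ := μ) (fun t => (hY t).measurable_mk) hp hC fun s hs t ht => by
      refine le_trans (le_of_eq (lintegral_congr_ae ?_)) (h s hs t ht)
      filter_upwards [(hY s).ae_eq_mk, (hY t).ae_eq_mk] with ω e1 e2
      rw [e1, e2]
  exact ⟨Z, h1, fun t ht => (h2 t ht).trans (hY t).ae_eq_mk.symm, h3⟩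

end LevyDonsker
end

noncomputable section

namespace LevyDonsker
open scoped ENNReal NNReal

/-! ### Sample paths of Gaussian processes -/

theorem lintegral_pow_gaussianReal_ne_top (p : ℕ) :
    ∫⁻ x, ‖x‖ₑ ^ p ∂(gaussianReal 0 1) ≠ ⊤ := by
  rcases eq_or_ne p 0 with rfl | hp
  · simp
  have h1 : MemLp id p (gaussianReal 0 1) := by
    have := memLp_id_gaussianReal (μ := 0) (v := 1) (p : ℝ≥0)
    exact_mod_cast this
  have h2 := lintegral_rpow_enorm_lt_top_of_eLpNorm_lt_top (by exact_mod_cast hp)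
    (ENNReal.natCast_ne_top p) h1.2
  simpa using h2.ne

/-- A centered Gaussian variable has the law of its standard deviation times a standard normal, so
the moment of order `2m` scales as the `m`-th power of the variance. -/
theorem lintegral_pow_le_of_hasGaussianLaw {Ω : Type*} [MeasurableSpace Ω] {μ : Measure Ω}
    {X : Ω → ℝ} (hX : HasGaussianLaw X μ) (h0 : ∫ ω, X ω ∂μ = 0) {v : ℝ}
    (hv : ∫ ω, X ω ^ 2 ∂μ ≤ v) (m : ℕ) :
    ∫⁻ ω, ‖X ω‖ₑ ^ (2 * m) ∂μ
      ≤ (∫⁻ x, ‖x‖ₑ ^ (2 * m) ∂(gaussianReal 0 1)) * ENNReal.ofReal (v ^ m) := by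
  set V := ∫ ω, X ω ^ 2 ∂μ with hV
  have hV0 : 0 ≤ V := integral_nonneg fun ω => sq_nonneg _
  have hmap : μ.map X = (gaussianReal 0 1).map (√V * ·) := by
    rw [hX.map_eq_gaussianReal, h0, variance_of_integral_eq_zero hX.aemeasurable h0,
      gaussianReal_map_const_mul, mul_zero, mul_one]
    congr 1
    ext
    rw [Real.coe_toNNReal _ hV0, NNReal.coe_mk, Real.sq_sqrt hV0]
  calc ∫⁻ ω, ‖X ω‖ₑ ^ (2 * m) ∂μ = ∫⁻ x, ‖x‖ₑ ^ (2 * m) ∂(μ.map X) :=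
        (lintegral_map' (f := fun x : ℝ => ‖x‖ₑ ^ (2 * m)) (by fun_prop) hX.aemeasurable).symm
    _ = ∫⁻ x, ‖√V * x‖ₑ ^ (2 * m) ∂(gaussianReal 0 1) := by
        rw [hmap, lintegral_map (by fun_prop) (by fun_prop)]
    _ = ∫⁻ x, ‖√V‖ₑ ^ (2 * m) * ‖x‖ₑ ^ (2 * m) ∂(gaussianReal 0 1) := by
        simp only [enorm_mul, mul_pow]
    _ = (∫⁻ x, ‖x‖ₑ ^ (2 * m) ∂(gaussianReal 0 1)) * ENNReal.ofReal (V ^ m) := by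
        rw [lintegral_const_mul _ (by fun_prop), mul_comm, Real.enorm_of_nonneg (Real.sqrt_nonneg V),
          ← ENNReal.ofReal_pow (Real.sqrt_nonneg V), pow_mul, Real.sq_sqrt hV0]
    _ ≤ _ := by gcongr

theorem exists_continuousOn_modification_of_gaussian {Ω : Type*} [MeasurableSpace Ω]
    {μ : Measure Ω} {Y : ℝ → Ω → ℝ} (hY : IsGaussianProcess Y μ) (h0 : ∀ t, ∫ ω, Y t ω ∂μ = 0)
    {M β : ℝ} (hβ : 0 < β) (hM : 0 ≤ M)
    (h : ∀ s ∈ Set.Icc (0 : ℝ) 1, ∀ t ∈ Set.Icc (0 : ℝ) 1,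
      ∫ ω, (Y t ω - Y s ω) ^ 2 ∂μ ≤ M * |t - s| ^ β) :
    ∃ Z : ℝ → Ω → ℝ, (∀ t ∈ Set.Icc (0 : ℝ) 1, Measurable (Z t)) ∧
      (∀ t ∈ Set.Icc (0 : ℝ) 1, Z t =ᵐ[μ] Y t) ∧
      ∀ ω, ContinuousOn (fun t => Z t ω) (Set.Icc 0 1) := by
  -- High enough a moment that `m β > 3`, the exponent needed for chaining.
  obtain ⟨m, hm⟩ := exists_nat_gt (3 / β)
  have hm0 : 0 < m := by
    have : (0 : ℝ) < m := lt_of_le_of_lt (by positivity) hm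
    exact_mod_cast this
  rw [div_lt_iff₀ hβ] at hm
  refine exists_continuousOn_modification (p := 2 * m)
    (C := (∫⁻ x, ‖x‖ₑ ^ (2 * m) ∂(gaussianReal 0 1)) * ENNReal.ofReal (M ^ m))
    (fun t => hY.aemeasurable t) (by omega)
    (ENNReal.mul_ne_top (lintegral_pow_gaussianReal_ne_top _) ENNReal.ofReal_ne_top)
    fun s hs t ht => ?_
  rcases eq_or_ne t s with rfl | hne
  · simp [hm0.ne']
  have hd0 : 0 < |t - s| := abs_pos.2 (sub_ne_zero.2 hne)
  have hd1 : |t - s| ≤ 1 := abs_le.2 ⟨by linarith [ht.1, hs.2], by linarith [ht.2, hs.1]⟩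
  have hmean : ∫ ω, (Y t ω - Y s ω) ∂μ = 0 := by
    rw [integral_sub (hY.hasGaussianLaw_eval t).integrable (hY.hasGaussianLaw_eval s).integrable,
      h0, h0, sub_zero]
  refine (lintegral_pow_le_of_hasGaussianLaw hY.hasGaussianLaw_fun_sub hmean (h s hs t ht)
    m).trans ?_
  rw [mul_assoc, ← ENNReal.ofReal_mul (by positivity), mul_pow]
  gcongr
  rw [← Real.rpow_natCast, ← Real.rpow_mul hd0.le, ← Real.rpow_natCast]
  refine Real.rpow_le_rpow_of_exponent_ge hd0 hd1 ?_
  push_cast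
  linarith

/-- A process with continuous paths on a compact interval is almost surely uniformly continuous
for any continuous pseudometric whose null pairs carry almost surely equal values. -/
theorem ae_uniform_of_continuousOn {Ω : Type*} [MeasurableSpace Ω] {μ : Measure Ω}
    {Z : ℝ → Ω → ℝ} {H : Type*} [NormedAddCommGroup H] {z : ℝ → H}
    (hz : ContinuousOn z (Set.Icc 0 1)) (hZ : ∀ ω, ContinuousOn (fun t => Z t ω) (Set.Icc 0 1))
    (h0 : ∀ s ∈ Set.Icc (0 : ℝ) 1, ∀ t ∈ Set.Icc (0 : ℝ) 1, z s = z t → Z s =ᵐ[μ] Z t) :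
    ∀ᵐ ω ∂μ, ∀ η > 0, ∃ δ > 0, ∀ s ∈ Set.Icc (0 : ℝ) 1, ∀ t ∈ Set.Icc (0 : ℝ) 1,
      ‖z s - z t‖ < δ → |Z s ω - Z t ω| < η := by
  set I : Set ℝ := Set.Icc 0 1 with hI
  -- Pairs at distance zero. Almost sure equality is only available pair by pair, so it is imposed
  -- on a countable dense subset and extended to all of `N` by path continuity.
  set N : Set (ℝ × ℝ) := {p | p ∈ I ×ˢ I ∧ z p.1 = z p.2} with hN
  obtain ⟨D, hDc, hDd⟩ := TopologicalSpace.exists_countable_dense N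
  have hD : ∀ᵐ ω ∂μ, ∀ p ∈ D, Z p.1.1 ω = Z p.1.2 ω := by
    rw [ae_ball_iff hDc]
    exact fun p _ => h0 _ p.2.1.1 _ p.2.1.2 p.2.2
  have hcomp : IsCompact (I ×ˢ I) := isCompact_Icc.prod isCompact_Icc
  have c1 : ContinuousOn (fun p : ℝ × ℝ => ‖z p.1 - z p.2‖) (I ×ˢ I) :=
    ((hz.comp continuousOn_fst fun p hp => hp.1).sub
      (hz.comp continuousOn_snd fun p hp => hp.2)).norm
  filter_upwards [hD] with ω hω
  have c2 : ContinuousOn (fun p : ℝ × ℝ => Z p.1 ω - Z p.2 ω) (I ×ˢ I) :=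
    ((hZ ω).comp continuousOn_fst fun p hp => hp.1).sub
      ((hZ ω).comp continuousOn_snd fun p hp => hp.2)
  have hall : ∀ p : N, Z p.1.1 ω - Z p.1.2 ω = 0 := by
    have hc : Continuous fun p : N => Z p.1.1 ω - Z p.1.2 ω :=
      continuousOn_iff_continuous_domRestrict.1 (c2.mono fun p hp => hp.1)
    have hcl : IsClosed {p : N | Z p.1.1 ω - Z p.1.2 ω = 0} := isClosed_eq hc continuous_const
    intro p
    have hp : p ∈ closure D := hDd p
    exact closure_minimal (fun q hq => sub_eq_zero.2 (hω q hq)) hcl hp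
  intro η hη
  -- The compact set of pairs where the path oscillates by at least `η`. It avoids `N`, so the
  -- distance has a positive minimum on it, which is the required `δ`.
  set K : Set (ℝ × ℝ) := (I ×ˢ I) ∩ (fun p : ℝ × ℝ => |Z p.1 ω - Z p.2 ω|) ⁻¹' Set.Ici η with hK
  have hKc : IsCompact K :=
    hcomp.of_isClosed_subset (c2.abs.preimage_isClosed_of_isClosed hcomp.isClosed isClosed_Ici)
      Set.inter_subset_left
  rcases K.eq_empty_or_nonempty with hKe | hKne
  · refine ⟨1, one_pos, fun s hs t ht _ => ?_⟩
    by_contra hcon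
    have : (s, t) ∈ K := ⟨⟨hs, ht⟩, not_lt.1 hcon⟩
    rw [hKe] at this
    exact this
  · obtain ⟨p, hpK, hmin⟩ := hKc.exists_isMinOn hKne (c1.mono Set.inter_subset_left)
    refine ⟨‖z p.1 - z p.2‖, ?_, fun s hs t ht hst => ?_⟩
    · refine norm_pos_iff.2 fun he => ?_
      have h1 := hall ⟨p, hpK.1, sub_eq_zero.1 he⟩
      have h2 : η ≤ |Z p.1 ω - Z p.2 ω| := hpK.2
      rw [h1, abs_zero] at h2
      linarith
    · by_contra hcon
      have : (s, t) ∈ K := ⟨⟨hs, ht⟩, not_lt.1 hcon⟩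
      exact absurd (hmin this) (not_le.2 hst)

end LevyDonsker
end

noncomputable section

namespace LevyDonsker
open scoped ENNReal NNReal

/-! ### The limit process -/

theorem integral_sub_sq {Ω : Type*} [MeasurableSpace Ω] {μ : Measure Ω} {A B : Ω → ℝ}
    (hA : MemLp A 2 μ) (hB : MemLp B 2 μ) : ∫ ω, (A ω - B ω) ^ 2 ∂μ
      = (∫ ω, A ω * A ω ∂μ) - 2 * (∫ ω, A ω * B ω ∂μ) + ∫ ω, B ω * B ω ∂μ := by
  have i1 : Integrable (fun ω => A ω * A ω) μ := hA.integrable_mul hA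
  have i2 : Integrable (fun ω => A ω * B ω) μ := hA.integrable_mul hB
  have i3 : Integrable (fun ω => B ω * B ω) μ := hB.integrable_mul hB
  have i4 : Integrable (fun ω => A ω * A ω - 2 * (A ω * B ω)) μ := i1.sub (i2.const_mul 2)
  rw [← integral_const_mul, ← integral_sub i1 (i2.const_mul 2), ← integral_add i4 i3]
  congr 1
  ext ω
  ring

section

variable {Δ γ ε ζ : ℝ} {ν P : Measure ℝ} (hP : IsIncrementLaw Δ γ ν P)
  (h : RegularityCondition Δ γ ν ε) (hε : 0 < ε) (hζ : 0 < ζ)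
include hP h hε hζ

theorem IsIncrementLaw.exists_isLimitProcess :
    ∃ (Ω : Type) (_ : MeasurableSpace Ω) (μ : Measure Ω) (_ : IsProbabilityMeasure μ)
      (G : Idx ζ → Ω → ℝ), IsLimitProcess Δ γ ν P ζ μ G := by
  have hne : ∀ t : Idx ζ, (t : ℝ) ≠ 0 := fun t => abs_pos.1 (hζ.trans_le t.2)
  obtain ⟨Ω, mΩ, μ, hμ, G, h1, h2, h3⟩ := exists_isGaussianProcess P
    (fun (t : Idx ζ) x => Δ⁻¹ * influence Δ γ ν t x)
    fun t => (hP.memLp_influence h hε (hne t)).const_mul _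
  refine ⟨Ω, mΩ, μ, hμ, G, h1, h2, fun t s => ?_⟩
  rw [h3, hP.covSigma_eq h hε (hne s) (hne t), ← integral_const_mul]
  congr 2
  ext x
  rw [← inv_pow]
  ring

/-- Reparametrise by `1/t`, extend by zero at `t = ∞`, and take a continuous version on the
resulting compact interval. The intrinsic metric is unchanged by the passage to a version. -/
theorem IsIncrementLaw.exists_version (hΔ : 0 < Δ) {Ω : Type*} [MeasurableSpace Ω]
    {μ : Measure Ω} {G : Idx ζ → Ω → ℝ} (hG : IsLimitProcess Δ γ ν P ζ μ G) :
    ∃ G' : Idx ζ → Ω → ℝ, (∀ t, Measurable (G' t)) ∧ (∀ t, G' t =ᵐ[μ] G t) ∧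
      (∀ᵐ ω ∂μ, UniformContinuousFor (intrinsicDist μ G') (fun t => G' t ω)) ∧
      (∀ᵐ ω ∂μ, ∃ C : ℝ, ∀ t, |G' t ω| ≤ C) := by
  have := hP.isProbabilityMeasure
  have hne : ∀ t : Idx ζ, (t : ℝ) ≠ 0 := fun t => abs_pos.1 (hζ.trans_le t.2)
  have hdec := h.isDeconvSymbol hε
  obtain ⟨c₀, hc₀, hle⟩ := hP.exists_restrict_le h hε
  have hP1 : Integrable (fun x : ℝ => x) P :=
    ((memLp_two_iff_integrable_sq (by fun_prop)).2
      (hP.integrable_sq h.integrable_id (h.integrable_sq hε))).integrable one_le_two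
  obtain ⟨M, hM0, hM⟩ := hdec.exists_integral_invKernel_sub_sq_le hc₀ hle hP1 hζ
  set β := min ε (1 / 2) / 4 with hβ
  have hβ0 : 0 < β := by
    have := hdec.pos
    positivity
  -- Affine map of `[0, 1]` onto `[-1/ζ, 1/ζ]`, the range of `1/t` completed by the point `0`.
  set τ : ℝ → ℝ := fun u => ζ⁻¹ * (2 * u - 1) with hτ
  have hτle : ∀ u ∈ Set.Icc (0 : ℝ) 1, |τ u| ≤ ζ⁻¹ := fun u hu => by
    rw [hτ, abs_mul, abs_of_pos (inv_pos.2 hζ)]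
    exact mul_le_of_le_one_right (inv_nonneg.2 hζ.le)
      (abs_le.2 ⟨by linarith [hu.1], by linarith [hu.2]⟩)
  have hτsub : ∀ s t, |τ t - τ s| = 2 * ζ⁻¹ * |t - s| := fun s t => by
    rw [hτ, show ζ⁻¹ * (2 * t - 1) - ζ⁻¹ * (2 * s - 1) = 2 * ζ⁻¹ * (t - s) by ring, abs_mul,
      abs_of_pos (by positivity)]
  set f : ℝ → ℝ → ℝ := fun u =>
    invKernel (levySymbol Δ γ ν) (levySymbolDeriv Δ γ ν) (γ * Δ) (τ u) with hf
  have hfm : ∀ u, MemLp (f u) 2 P := fun u => hdec.memLp_invKernel hle (τ u)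
  have hfM : ∀ s ∈ Set.Icc (0 : ℝ) 1, ∀ t ∈ Set.Icc (0 : ℝ) 1,
      ∫ x, (f t x - f s x) ^ 2 ∂P ≤ M * (2 * ζ⁻¹) ^ β * |t - s| ^ β := fun s hs t ht => by
    refine (hM (τ s) (τ t) (hτle s hs) (hτle t ht)).trans (le_of_eq ?_)
    rw [hτsub, Real.mul_rpow (by positivity) (abs_nonneg _), mul_assoc]
  have hi : ∀ u, ∃ i : Idx ζ, u ∈ Set.Icc (0 : ℝ) 1 → τ u ≠ 0 → (i : ℝ) = (τ u)⁻¹ := fun u => by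
    by_cases hu : u ∈ Set.Icc (0 : ℝ) 1 ∧ τ u ≠ 0
    · refine ⟨⟨(τ u)⁻¹, ?_⟩, fun _ _ => rfl⟩
      rw [abs_inv, le_inv_comm₀ hζ (abs_pos.2 hu.2)]
      exact hτle u hu.1
    · exact ⟨⟨ζ, le_abs_self ζ⟩, fun h1 h2 => absurd ⟨h1, h2⟩ hu⟩
  choose i hi using hi
  -- At `τ u = 0` the chosen index is a default value; the factor `c u = 0` cancels it and puts the
  -- value `0` at `t = ∞`.
  set c : ℝ → ℝ := fun u => if τ u = 0 then 0 else 1 with hc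
  have hfeq : ∀ u ∈ Set.Icc (0 : ℝ) 1, f u = fun x => c u * influence Δ γ ν (i u) x :=
    fun u hu => by
      ext x
      simp only [hf, hc, invKernel, influence]
      split_ifs with h0
      · rw [zero_mul]
      · rw [one_mul, hi u hu h0]
  set Y : ℝ → Ω → ℝ := fun u ω => c u • G (i u) ω with hY
  have hYG : IsGaussianProcess Y μ := (hG.isGaussian.comp_right i).smul c
  have hYm : ∀ u, MemLp (Y u) 2 μ := fun u => (hYG.hasGaussianLaw_eval u).memLp_two
  have hY0 : ∀ u, ∫ ω, Y u ω ∂μ = 0 := fun u => by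
    simp only [hY, smul_eq_mul]
    rw [integral_const_mul, hG.centered, mul_zero]
  have hcov : ∀ s t : Idx ζ, ∫ ω, G s ω * G t ω ∂μ
      = (Δ ^ 2)⁻¹ * ∫ x, influence Δ γ ν s x * influence Δ γ ν t x ∂P := fun s t => by
    have := hG.covariance s t
    rw [hP.covSigma_eq h hε (hne t) (hne s)] at this
    exact_mod_cast this
  have hYcov : ∀ s ∈ Set.Icc (0 : ℝ) 1, ∀ t ∈ Set.Icc (0 : ℝ) 1,
      ∫ ω, Y s ω * Y t ω ∂μ = (Δ ^ 2)⁻¹ * ∫ x, f s x * f t x ∂P := fun s hs t ht => by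
    rw [hfeq s hs, hfeq t ht]
    have e1 : ∀ ω, Y s ω * Y t ω = c s * c t * (G (i s) ω * G (i t) ω) := fun ω => by
      simp only [hY, smul_eq_mul]
      ring
    have e2 : ∀ x, c s * influence Δ γ ν (i s) x * (c t * influence Δ γ ν (i t) x)
        = c s * c t * (influence Δ γ ν (i s) x * influence Δ γ ν (i t) x) := fun x => by ring
    simp only [e1, e2]
    rw [integral_const_mul, integral_const_mul, hcov]
    ring
  have hYsub : ∀ s ∈ Set.Icc (0 : ℝ) 1, ∀ t ∈ Set.Icc (0 : ℝ) 1,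
      ∫ ω, (Y t ω - Y s ω) ^ 2 ∂μ = (Δ ^ 2)⁻¹ * ∫ x, (f t x - f s x) ^ 2 ∂P :=
    fun s hs t ht => by
      rw [integral_sub_sq (hYm t) (hYm s), integral_sub_sq (hfm t) (hfm s), hYcov t ht t ht,
        hYcov t ht s hs, hYcov s hs s hs]
      ring
  have hYM : ∀ s ∈ Set.Icc (0 : ℝ) 1, ∀ t ∈ Set.Icc (0 : ℝ) 1,
      ∫ ω, (Y t ω - Y s ω) ^ 2 ∂μ ≤ (Δ ^ 2)⁻¹ * (M * (2 * ζ⁻¹) ^ β) * |t - s| ^ β :=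
    fun s hs t ht => by
      rw [hYsub s hs t ht, mul_assoc]
      gcongr
      exact hfM s hs t ht
  obtain ⟨Z, hZm, hZY, hZc⟩ := exists_continuousOn_modification_of_gaussian hYG hY0 hβ0
    (by positivity) hYM
  -- Realises the intrinsic pseudometric as a distance in `L²(P)`, which makes its continuity in `u`
  -- and its null pairs accessible.
  set z : ℝ → Lp ℝ 2 P := fun u => Δ⁻¹ • (hfm u).toLp (f u) with hz
  have hznorm : ∀ s ∈ Set.Icc (0 : ℝ) 1, ∀ t ∈ Set.Icc (0 : ℝ) 1,
      ‖z t - z s‖ ^ 2 = ∫ ω, (Y t ω - Y s ω) ^ 2 ∂μ := fun s hs t ht => by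
    rw [hYsub s hs t ht, hz]
    simp only
    rw [← smul_sub, norm_smul, mul_pow, norm_sq_eq_integral_sq, norm_inv, inv_pow,
      Real.norm_eq_abs, sq_abs]
    congr 1
    refine integral_congr_ae ?_
    filter_upwards [Lp.coeFn_sub ((hfm t).toLp (f t)) ((hfm s).toLp (f s)), (hfm t).coeFn_toLp,
      (hfm s).coeFn_toLp] with x h1 h2 h3
    rw [h1, Pi.sub_apply, h2, h3]
  have hzc : ContinuousOn z (Set.Icc 0 1) := by
    intro s hs
    rw [ContinuousWithinAt, tendsto_iff_norm_sub_tendsto_zero]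
    have hlim : Tendsto (fun t => √((Δ ^ 2)⁻¹ * (M * (2 * ζ⁻¹) ^ β) * |t - s| ^ β))
        (𝓝[Set.Icc 0 1] s) (𝓝 0) := by
      have hc : Continuous fun t : ℝ => √((Δ ^ 2)⁻¹ * (M * (2 * ζ⁻¹) ^ β) * |t - s| ^ β) :=
        Real.continuous_sqrt.comp (continuous_const.mul
          ((by fun_prop : Continuous fun t : ℝ => |t - s|).rpow_const fun _ => Or.inr hβ0.le))
      have := (hc.tendsto s).mono_left (nhdsWithin_le_nhds (s := Set.Icc 0 1))
      simpa [Real.zero_rpow hβ0.ne'] using this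
    refine squeeze_zero' (Eventually.of_forall fun _ => norm_nonneg _) ?_ hlim
    filter_upwards [self_mem_nhdsWithin] with t ht
    refine Real.le_sqrt_of_sq_le ?_
    rw [hznorm s hs t ht]
    exact hYM s hs t ht
  have hz0 : ∀ s ∈ Set.Icc (0 : ℝ) 1, ∀ t ∈ Set.Icc (0 : ℝ) 1, z s = z t → Z s =ᵐ[μ] Z t :=
    fun s hs t ht hst => by
      have h1 := hznorm t ht s hs
      have h5 : Integrable (fun ω => (Y s ω - Y t ω) ^ 2) μ :=
        ((hYm s).sub (hYm t)).integrable_sq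
      rw [hst, sub_self, norm_zero, zero_pow two_ne_zero, eq_comm,
        integral_eq_zero_iff_of_nonneg (fun ω => sq_nonneg _) h5] at h1
      filter_upwards [h1, hZY s hs, hZY t ht] with ω h2 h3 h4
      rw [h3, h4]
      exact sub_eq_zero.1 (pow_eq_zero_iff two_ne_zero |>.1 h2)
  -- The parameter in `[0, 1]` corresponding to `t`, that is, the solution of `τ u = 1/t`.
  set v : Idx ζ → ℝ := fun t => (ζ * (t : ℝ)⁻¹ + 1) / 2 with hv
  have hvI : ∀ t, v t ∈ Set.Icc (0 : ℝ) 1 := fun t => by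
    have h1 : |ζ * (t : ℝ)⁻¹| ≤ 1 := by
      rw [abs_mul, abs_inv, abs_of_pos hζ, ← div_eq_mul_inv,
        div_le_one (abs_pos.2 (hne t))]
      exact t.2
    rw [abs_le] at h1
    exact ⟨by simp only [hv]; linarith, by simp only [hv]; linarith⟩
  have hτv : ∀ t, τ (v t) = (t : ℝ)⁻¹ := fun t => by
    simp only [hτ, hv]
    field_simp
    ring
  have hYv : ∀ t, Y (v t) = G t := fun t => by
    have h1 : τ (v t) ≠ 0 := by rw [hτv]; exact inv_ne_zero (hne t)
    have h2 : i (v t) = t := Subtype.ext (by rw [hi _ (hvI t) h1, hτv, inv_inv])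
    ext ω
    simp only [hY, hc, if_neg h1, h2, one_smul]
  have hdist : ∀ s t, intrinsicDist μ (fun t => Z (v t)) s t = ‖z (v s) - z (v t)‖ := fun s t => by
    rw [intrinsicDist, ← Real.sqrt_sq (norm_nonneg (z (v s) - z (v t))), hznorm _ (hvI t) _ (hvI s)]
    congr 1
    refine integral_congr_ae ?_
    filter_upwards [hZY _ (hvI s), hZY _ (hvI t)] with ω h1 h2
    rw [h1, h2]
  refine ⟨fun t => Z (v t), fun t => hZm _ (hvI t), fun t => ?_, ?_, ae_of_all _ fun ω => ?_⟩
  · rw [← hYv t]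
    exact hZY _ (hvI t)
  · filter_upwards [ae_uniform_of_continuousOn hzc hZc hz0] with ω hω η hη
    obtain ⟨δ, hδ, hδ'⟩ := hω η hη
    refine ⟨δ, hδ, fun s t hst => hδ' _ (hvI s) _ (hvI t) ?_⟩
    rwa [hdist] at hst
  · obtain ⟨C, hC⟩ := isCompact_Icc.exists_bound_of_continuousOn (hZc ω)
    exact ⟨C, fun t => hC _ (hvI t)⟩

end

end LevyDonsker
end

theorem mainTheorem3 (Δ γ ζ : ℝ) (hΔ : 0 < Δ) (hζ : 0 < ζ)
    (ν P : Measure ℝ)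
    (hν : LevyDonsker.IsFiniteVariationLevyMeasure ν)
    (hP : LevyDonsker.IsIncrementLaw Δ γ ν P)
    (hreg : ∃ ε > 0, LevyDonsker.RegularityCondition Δ γ ν ε) :
    -- the covariance is well defined
    (∀ t : LevyDonsker.Idx ζ, LevyDonsker.HWellDefined Δ γ ν P t) ∧
    -- a centered Gaussian process with this covariance exists
    (∃ (Ω : Type) (_ : MeasurableSpace Ω) (μ : Measure Ω) (_ : IsProbabilityMeasure μ)
      (G : LevyDonsker.Idx ζ → Ω → ℝ), LevyDonsker.IsLimitProcess Δ γ ν P ζ μ G) ∧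
    -- every such process has a version with the asserted sample path properties
    (∀ (Ω : Type*) (_ : MeasurableSpace Ω) (μ : Measure Ω) (_ : IsProbabilityMeasure μ)
      (G : LevyDonsker.Idx ζ → Ω → ℝ), LevyDonsker.IsLimitProcess Δ γ ν P ζ μ G →
      ∃ G' : LevyDonsker.Idx ζ → Ω → ℝ,
        (∀ t, Measurable (G' t)) ∧
        (∀ t, G' t =ᵐ[μ] G t) ∧
        (∀ᵐ ω ∂μ, LevyDonsker.UniformContinuousFor (LevyDonsker.intrinsicDist μ G')
          (fun t => G' t ω)) ∧
        (∀ᵐ ω ∂μ, ∃ C : ℝ, ∀ t, |G' t ω| ≤ C)) := by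
  obtain ⟨ε, hε, h⟩ := hreg
  have hne : ∀ t : LevyDonsker.Idx ζ, (t : ℝ) ≠ 0 := fun t => abs_pos.1 (hζ.trans_le t.2)
  exact ⟨fun t => hP.hWellDefined h hε (hne t), hP.exists_isLimitProcess h hε hζ,
    fun _ _ _ _ _ hG => hP.exists_version h hε hζ hΔ hG⟩
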